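/- Consider the two-player game $\dot x=\alpha_1+\alpha_2$, $x(0)=y\in\mathbb R$, on $[0,\infty)$, where player $i$ uses a control with values in a compact set $A_i\subset\mathbb R$ and minimizes $\int_0^\infty e^{-t}\big[h_i(x(t))+\tfrac12\alpha_i(t)^2\big]\,dt$. A pair of feedbacks $(\alpha_1^*,\alpha_2^*)$ is a feedback Nash equilibrium if for every $y$ the equation $\dot x=\alpha_1^*(x)+\alpha_2^*(x)$, $x(0)=y$, has a Carathéodory solution on $[0,\infty)$ and, along every such solution, the feedback of each player is optimal against that of the other. An admissible solution is a locally absolutely continuous $u=(u_1,u_2):\mathbb R\to\mathbb R^2$ with $$u_i=h_i-u_1'u_2'-\tfrac12(u_i')^2\quad\text{a.e.},\qquad i=1,2,$$ with $|u(x)|\le C(1+|x|)$ for some $C$, and such that $u'$ has one-sided limits at every point $y$, which satisfy $u_1'(y+)+u_2'(y+)\le0$ or $u_1'(y-)+u_2'(y-)\ge0$ wherever $u'$ is discontinuous. Let $h_1,h_2$ be continuous with $(h_1',h_2')=K^0$ on $(-\infty,0)$ and $(h_1',h_2')=K^1$ on $(0,\infty)$, where $K^0\in\mathcal A_4$, $K^1\in\mathcal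 A_3$ and $\mathcal A_i=\{\rho(\cos\theta,\sin\theta):\rho>0,\ (i-1)\frac\pi4<\theta<i\frac\pi4\}$. For $K=(\kappa_1,\kappa_2)$ let $(S_K)$ be the system $$\frac{dp_1}{ds}=(\kappa_1-\kappa_2)p_1+\kappa_1p_2-p_1^2,\qquad \frac{dp_2}{ds}=(\kappa_2-\kappa_1)p_2+\kappa_2p_1-p_2^2,$$ and let its stable (unstable) orbits consist of the points $\neq0$ whose $(S_K)$-orbit tends to $0$ as $s\to+\infty$ (as $s\to-\infty$). Let $\Delta(p)=(p_1+p_2)^2-p_1p_2$. Say that a trajectory $p(s)$ represents $u$ through $x(s)$ if $dx/ds=\Delta(p(s))$ and $u'(x(s))=p(s)$ for all $s\in\mathbb R$. Then: 1. There are infinitely many admissible solutions. 2. There is $R>0$ such that, for all compact $A_1,A_2\supseteq[-R,R]$, the game has infinitely many feedback Nash equilibria (even with continuous feedbacks). 3. There is $\varepsilon>0$ such that every $p^{\rm in}$ with $p^{\rm in}_1+p^{\rm in}_2=0$, $p^{\rm in}_1<0<p^{\rm in}_2$ and $|p^{\rm in}|<\varepsilon$ lies between the unstable orbit of $(S_{K^1})$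 and the stable orbit of $(S_{K^0})$ in the second quadrant (on the arc in $\{p_1<0<p_2\}$ of the circle about $0$ through $p^{\rm in}$), and there is an admissible solution $u$ represented through some $x(s)$ with $x(0)=0$, $x(\pm\infty)=\pm\infty$, by the continuous trajectory $p$ with $p(0)=p^{\rm in}$ that solves $(S_{K^0})$ for $s<0$ and $(S_{K^1})$ for $s>0$; moreover $p(s)\to K^1$ as $s\to+\infty$ and $p(s)\to K^0$ as $s\to-\infty$. The feedbacks $(-u_1',-u_2')$ form a Nash equilibrium for all compact $A_1,A_2$ that contain their values. 4. If $P$ lies both on an unstable orbit of $(S_{K^0})$ and on a stable orbit of $(S_{K^1})$, there is a further admissible solution $u$, with $(-u_1',-u_2')$ a Nash equilibrium for all compact $A_1,A_2$ that contain their values, and there are $x_-<0<x_+$ with $u'(x_\pm)=0$, such that $u'$ is represented on $(x_-,x_+)$, through some $x(s)$ with $x(0)=0$, $x(\pm\infty)=x_\pm$, by the continuous trajectory through $P$ at $s=0$ that solves $(S_{K^0})$ for $s<0$ and $(S_{K^1})$ for $s>0$ (and tends to $0$ as $s\to\pm\infty$); on $(-\infty,x_-)$ by a stable orbit of $(S_{K^0})$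 coming from $K^0$; and on $(x_+,\infty)$ by an unstable orbit of $(S_{K^1})$ tending to $K^1$. -/

import Mathlib

open Set Filter Topology MeasureTheory

noncomputable section

namespace DiffGame

/-! ### Feedback Nash equilibria

Two players steer `ẋ = α₁ + α₂`, `x(0) = y`, on `[0, ∞)`. Player `i` chooses a measurable control
with values in `A i` and pays `∫₀^∞ e^{-t} (h i (x t) + α i (t)² / 2) dt`. -/

/-- `x` is a Caratheodory solution on `[0, ∞)` of `ẋ = f(t, x)`, `x(0) = y`.
Values of `x` at negative times play no role. -/
def IsCaratheodorySol (f : ℝ → ℝ → ℝ) (y : ℝ) (x : ℝ → ℝ) : Prop :=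
  x 0 = y ∧ (∀ T, 0 < T → AbsolutelyContinuousOnInterval x 0 T) ∧
    ∀ᵐ t : ℝ, 0 < t → HasDerivAt x (f t (x t)) t

/-- The discounted running cost of a player with control `a` along the trajectory `x`. -/
def runningCost (h : ℝ → ℝ) (x a : ℝ → ℝ) (t : ℝ) : ℝ :=
  Real.exp (-t) * (h (x t) + a t ^ 2 / 2)

/-- The total discounted cost. -/
def totalCost (h : ℝ → ℝ) (x a : ℝ → ℝ) : ℝ :=
  ∫ t in Ici (0 : ℝ), runningCost h x a t

/-- `a` is an open-loop control with values in `A`, and `x` is a trajectory from `y` that it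
produces when the other player uses the feedback `β`. -/
def IsAdmissiblePair (A : Set ℝ) (β : ℝ → ℝ) (y : ℝ) (x a : ℝ → ℝ) : Prop :=
  AEMeasurable a (volume.restrict (Ici 0)) ∧ (∀ t, 0 ≤ t → a t ∈ A) ∧
    IsCaratheodorySol (fun t z => a t + β z) y x

/-- The pair `(x, a)` solves the optimal control problem of a player with cost `h` and control set
`A` against the feedback `β`, from the initial point `y`. -/
def IsOptimalPair (h : ℝ → ℝ) (A : Set ℝ) (β : ℝ → ℝ) (y : ℝ) (x a : ℝ → ℝ) : Prop :=
  IsAdmissiblePair A β y x a ∧ IntegrableOn (runningCost h x a) (Ici 0) ∧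
    ∀ x' a' : ℝ → ℝ, IsAdmissiblePair A β y x' a' → totalCost h x a ≤ totalCost h x' a'

/-- `(α₁, α₂)` is a Nash equilibrium solution in feedback form: from every initial point the
closed-loop equation has a Caratheodory solution on `[0, ∞)`, and along every such solution the
feedback of each player is optimal against the feedback of the other one. -/
def IsFeedbackNash (h₁ h₂ : ℝ → ℝ) (A₁ A₂ : Set ℝ) (α₁ α₂ : ℝ → ℝ) : Prop :=
  (∀ x, α₁ x ∈ A₁) ∧ (∀ x, α₂ x ∈ A₂) ∧
    ∀ y : ℝ,
      (∃ x, IsCaratheodorySol (fun _ z => α₁ z + α₂ z) y x) ∧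
      ∀ x, IsCaratheodorySol (fun _ z => α₁ z + α₂ z) y x →
        IsOptimalPair h₁ A₁ α₂ y x (fun t => α₁ (x t)) ∧
        IsOptimalPair h₂ A₂ α₁ y x (fun t => α₂ (x t))

/-! ### Admissible solutions of the Hamilton-Jacobi system -/

/-- `u i (x) = h i (x) - p₁ p₂ - (p i)² / 2` for `i = 1, 2`, at the point `x` and with `u'(x) = p`. -/
def HJAt (h₁ h₂ : ℝ → ℝ) (u : ℝ → ℝ × ℝ) (x : ℝ) (p : ℝ × ℝ) : Prop :=
  (u x).1 = h₁ x - p.1 * p.2 - p.1 ^ 2 / 2 ∧ (u x).2 = h₂ x - p.1 * p.2 - p.2 ^ 2 / 2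

/-- Admissible solutions. The one-sided limits of `u'` are taken through the (almost all) points
at which `u` is differentiable. -/
structure IsAdmissibleSolution (h₁ h₂ : ℝ → ℝ) (u : ℝ → ℝ × ℝ) : Prop where
  absolutelyContinuous : ∀ a b : ℝ, AbsolutelyContinuousOnInterval u a b
  solves : ∀ᵐ x : ℝ, DifferentiableAt ℝ u x ∧ HJAt h₁ h₂ u x (deriv u x)
  growth : ∃ C : ℝ, ∀ x, ‖u x‖ ≤ C * (1 + |x|)
  jumps : ∀ y : ℝ, ∃ pm pp : ℝ × ℝ,
    Tendsto (deriv u) (𝓝[Iio y ∩ {x | DifferentiableAt ℝ u x}] y) (𝓝 pm) ∧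
    Tendsto (deriv u) (𝓝[Ioi y ∩ {x | DifferentiableAt ℝ u x}] y) (𝓝 pp) ∧
    (pm ≠ pp → pp.1 + pp.2 ≤ 0 ∨ 0 ≤ pm.1 + pm.2)

/-! ### The planar systems -/

/-- The open sector `{ρ (cos θ, sin θ) : ρ > 0, (i - 1) π / 4 < θ < i π / 4}`. -/
def sector (i : ℕ) : Set (ℝ × ℝ) :=
  {p | ∃ ρ θ : ℝ, 0 < ρ ∧ ((i : ℝ) - 1) * (Real.pi / 4) < θ ∧ θ < (i : ℝ) * (Real.pi / 4) ∧
    p = (ρ * Real.cos θ, ρ * Real.sin θ)}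

/-- The vector field of the system for `p = u'` in the variable `s`, where the derivatives of the
costs equal `K`. -/
def field (K p : ℝ × ℝ) : ℝ × ℝ :=
  ((K.1 - K.2) * p.1 + K.1 * p.2 - p.1 ^ 2, (K.2 - K.1) * p.2 + K.2 * p.1 - p.2 ^ 2)

/-- The determinant of `!![p₁ + p₂, p₁; p₂, p₁ + p₂]`; the variables are related by
`dx/ds = Δ(p)`. -/
def Delta (p : ℝ × ℝ) : ℝ := Matrix.det !![p.1 + p.2, p.1; p.2, p.1 + p.2]

/-- The points different from the origin whose orbit tends to the origin as `s → +∞`. -/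
def stableOrbit (K : ℝ × ℝ) : Set (ℝ × ℝ) :=
  {P | P ≠ 0 ∧ ∃ p : ℝ → ℝ × ℝ, p 0 = P ∧ (∀ s, 0 ≤ s → HasDerivAt p (field K (p s)) s) ∧
    Tendsto p atTop (𝓝 0)}

/-- The points different from the origin whose orbit tends to the origin as `s → -∞`. -/
def unstableOrbit (K : ℝ × ℝ) : Set (ℝ × ℝ) :=
  {P | P ≠ 0 ∧ ∃ p : ℝ → ℝ × ℝ, p 0 = P ∧ (∀ s, s ≤ 0 → HasDerivAt p (field K (p s)) s) ∧
    Tendsto p atBot (𝓝 0)}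

/-- The second quadrant `p₁ < 0 < p₂`. -/
def secondQuadrant : Set (ℝ × ℝ) := {p | p.1 < 0 ∧ 0 < p.2}

/-- On the arc of the circle around the origin through `P` that lies in the second quadrant, `P`
is strictly between a point of `U` and a point of `S`. On such an arc the slope `p₂ / p₁` is
strictly monotone. -/
def LiesBetween (U S : Set (ℝ × ℝ)) (P : ℝ × ℝ) : Prop :=
  P ∈ secondQuadrant ∧ ∃ q ∈ U ∩ secondQuadrant, ∃ r ∈ S ∩ secondQuadrant,
    q.1 ^ 2 + q.2 ^ 2 = P.1 ^ 2 + P.2 ^ 2 ∧ r.1 ^ 2 + r.2 ^ 2 = P.1 ^ 2 + P.2 ^ 2 ∧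
    q.2 / q.1 < P.2 / P.1 ∧ P.2 / P.1 < r.2 / r.1

/-- `p` passes through `P` at `s = 0`, follows the system of `K₀` for `s < 0` and that of `K₁`
for `s > 0`. -/
def IsSwitchedTrajectory (K₀ K₁ P : ℝ × ℝ) (p : ℝ → ℝ × ℝ) : Prop :=
  Continuous p ∧ p 0 = P ∧ (∀ s, s < 0 → HasDerivAt p (field K₀ (p s)) s) ∧
    ∀ s, 0 < s → HasDerivAt p (field K₁ (p s)) s

/-- `s ↦ x(s)` is a change of variable with `dx/ds = Δ(p)`, and `u'(x(s)) = p(s)`. -/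
def Represents (p : ℝ → ℝ × ℝ) (x : ℝ → ℝ) (u : ℝ → ℝ × ℝ) : Prop :=
  ∀ s, HasDerivAt x (Delta (p s)) s ∧ HasDerivAt u (p s) (x s)

/-- The feedbacks `-u₁'`, `-u₂'` form a Nash equilibrium, for all compact control sets that
contain their values. -/
def GivesNash (h₁ h₂ : ℝ → ℝ) (u : ℝ → ℝ × ℝ) : Prop :=
  ∀ A₁ A₂ : Set ℝ, IsCompact A₁ → IsCompact A₂ →
    (∀ x, -(deriv u x).1 ∈ A₁) → (∀ x, -(deriv u x).2 ∈ A₂) →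
      IsFeedbackNash h₁ h₂ A₁ A₂ (fun x => -(deriv u x).1) (fun x => -(deriv u x).2)

end DiffGame

end

noncomputable section

namespace DiffGame

/-! The problem reduces to the dynamics of two planar systems. Where `h' = K`, differentiating the
Hamilton-Jacobi system gives a linear system for `u''` whose determinant is `Delta (u')`, and in the
variable `s` with `dx/ds = Δ` it becomes the quadratic system of `field K`. Conversely, if `P`
follows these systems, the Hamilton-Jacobi equations, read as a formula, define `u` (`hjSol`), and
`u' = P` holds by `hasDerivAt_hjSol`. At the few exceptional points continuity of `P` is enough. A
`C¹` solution with bounded derivative is the value function of each player against the other's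
feedback (`cost_of_isAdmissiblePair`), so every such `u` is admissible and gives a Nash equilibrium.

For `K.1 < 0 < K.1 + K.2` the system has a Lyapunov function `energy` on the strip `0 ≤ uu`, `0 <
yy`: it is a kinetic term plus a potential well with bottom at `K` and top at the origin, and `K.1 +
K.2 > 0` makes the friction term dissipative. Sublevel sets below the level of the origin are
compact, avoid `uu = 0` and hence are forward invariant, and a LaSalle argument gives convergence to
`K` (`tendsto_of_mem_sublevel`). Two kinds of points lie below that level: small points of the
antidiagonal, and the unstable orbit of the origin, which is constructed as a power series in `exp
(λ s)`.

The reflection `refl` with reversal of time carries `K₀` to a parameter of the same type as `K₁` and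
fixes the antidiagonal pointwise. Hence each small point `P` of the antidiagonal flows forward to
`K₁` and backward to `K₀`. The resulting solutions differ, since `u'(0) = P`. This is the infinite
family.

A common point of an unstable orbit of `K₀` and a stable orbit of `K₁` gives a trajectory that tends
to the origin at both ends. Its length in `x` is finite (`exists_tendsto_of_tendsto_zero`), so on
either side a heteroclinic orbit between the origin and `K₀` or `K₁` can be attached, and `u'` stays
continuous because it vanishes at the junctions. -/

/-! ### Ordinary differential equations -/

section ODE

variable {E : Type*} [NormedAddCommGroup E] [NormedSpace ℝ E] [CompleteSpace E]

/-- A bounded Lipschitz vector field has a solution on every bounded time interval. -/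
theorem exists_solution_Icc {f : E → E} {k L : NNReal} (hf : LipschitzWith k f)
    (hL : ∀ x, ‖f x‖ ≤ L) (x₀ : E) {T : ℝ} (hT : 0 < T) :
    ∃ α : ℝ → E, α 0 = x₀ ∧ ∀ t ∈ Ioo (-T) T, HasDerivAt α (f (α t)) t := by
  have h0 : (0 : ℝ) ∈ Icc (-T) T := ⟨by linarith, hT.le⟩
  have hpl : IsPicardLindelof (fun _ => f) (tmin := -T) (tmax := T) ⟨0, h0⟩ x₀
      (L * T.toNNReal) 0 L k :=
    { lipschitzOnWith := fun t _ => hf.lipschitzOnWith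
      continuousOn := fun x _ => continuousOn_const
      norm_le := fun t _ x _ => hL x
      mul_max_le := by simp [Real.coe_toNNReal T hT.le] }
  obtain ⟨α, h, h'⟩ := hpl.exists_eq_forall_mem_Icc_hasDerivWithinAt₀
  exact ⟨α, h, fun t ht => (h' t (Ioo_subset_Icc_self ht)).hasDerivAt (Icc_mem_nhds ht.1 ht.2)⟩

/-- A bounded Lipschitz vector field has a solution for all times. -/
theorem exists_global_solution {f : E → E} {k L : NNReal} (hf : LipschitzWith k f)
    (hL : ∀ x, ‖f x‖ ≤ L) (x₀ : E) :
    ∃ α : ℝ → E, α 0 = x₀ ∧ ∀ t, HasDerivAt α (f (α t)) t := by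
  choose β hβ0 hβ using fun n : ℕ =>
    exists_solution_Icc hf hL x₀ (T := n + 1) (by positivity)
  have key : ∀ m n : ℕ, m ≤ n → EqOn (β m) (β n) (Ioo (-(m + 1 : ℝ)) (m + 1)) := by
    intro m n hmn
    have hmn' : (m : ℝ) ≤ n := by exact_mod_cast hmn
    have h0 : (0 : ℝ) ∈ Ioo (-(m + 1 : ℝ)) (m + 1) := ⟨by linarith [m.cast_nonneg (α := ℝ)], by positivity⟩
    exact ODE_solution_unique_of_mem_Ioo (v := fun _ => f) (s := fun _ => univ) (K := k)
      (fun t _ => hf.lipschitzOnWith) h0 (fun t ht => ⟨hβ m t ht, trivial⟩)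
      (fun t ht => ⟨hβ n t ⟨by linarith [ht.1], by linarith [ht.2]⟩, trivial⟩)
      ((hβ0 m).trans (hβ0 n).symm)
  refine ⟨fun t => β ⌈|t|⌉₊ t, by simp [hβ0], fun t => ?_⟩
  -- The extra 1 makes `β n` agree with the patched curve at all times within distance 1 of `t`.
  set n := ⌈|t|⌉₊ + 1 with hn
  have hnt : ∀ s, |s| ≤ |t| + 1 → s ∈ Ioo (-(n + 1 : ℝ)) (n + 1) := by
    intro s hs
    have : |s| < n + 1 := by
      have := Nat.le_ceil |t|
      push_cast [hn]; linarith
    exact abs_lt.1 this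
  have heq : (fun t => β ⌈|t|⌉₊ t) =ᶠ[𝓝 t] β n := by
    filter_upwards [Metric.ball_mem_nhds t one_pos] with s hs
    rw [Metric.mem_ball, Real.dist_eq] at hs
    have h1 : |s| ≤ |t| + 1 := by
      have := abs_sub_abs_le_abs_sub s t
      linarith
    have h2 : ⌈|s|⌉₊ ≤ n := by
      rw [hn]
      apply Nat.ceil_le.2
      push_cast
      linarith [Nat.le_ceil |t|]
    apply key _ _ h2
    have := Nat.le_ceil |s|
    exact abs_lt.1 (by linarith)
  have h := hβ n t (hnt t (by linarith))
  have h' := h.congr_of_eventuallyEq heq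
  rw [← heq.eq_of_nhds] at h'
  exact h'

end ODE

/-- Peano's theorem for bounded continuous scalar autonomous equations, on the whole time axis. -/
theorem exists_solution_of_continuous_bounded {f : ℝ → ℝ} (hf : Continuous f) {L : ℝ}
    (hL : ∀ x, |f x| ≤ L) (y : ℝ) :
    ∃ x : ℝ → ℝ, x 0 = y ∧ ∀ t, HasDerivAt x (f (x t)) t := by
  have hL0 : 0 ≤ L := (abs_nonneg _).trans (hL 0)
  have hint : ∀ a b : ℝ, IntervalIntegrable f volume a b := fun a b => hf.intervalIntegrable a b
  -- Forward means of `f` over windows of length `1 / (n + 1)`: Lipschitz for each `n`, bounded by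
  -- the same `L`, and equal to `f` at some point of the window.
  set F : ℕ → ℝ → ℝ := fun n x => (n + 1) * ∫ z in x..x + 1 / (n + 1 : ℝ), f z with hF
  have hmean : ∀ (n : ℕ) x, ∃ z ∈ Icc x (x + 1 / (n + 1 : ℝ)), F n x = f z := by
    intro n x
    have hpos : (0 : ℝ) < 1 / (n + 1 : ℝ) := by positivity
    obtain ⟨z, hz, h⟩ := exists_hasDerivAt_eq_slope (fun w => ∫ z in x..w, f z) f
      (show x < x + 1 / (n + 1 : ℝ) by linarith)
      (fun w _ => ((hf.integral_hasStrictDerivAt x w).hasDerivAt).continuousAt.continuousWithinAt)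
      (fun w _ => (hf.integral_hasStrictDerivAt x w).hasDerivAt)
    refine ⟨z, Ioo_subset_Icc_self hz, ?_⟩
    rw [h]
    simp only [hF, intervalIntegral.integral_same, sub_zero, add_sub_cancel_left]
    field_simp
  have hFL : ∀ n x, ‖F n x‖ ≤ (L.toNNReal : ℝ) := by
    intro n x
    obtain ⟨z, -, h⟩ := hmean n x
    rw [h, Real.coe_toNNReal _ hL0]
    exact hL z
  have hlip : ∀ n : ℕ, LipschitzWith ((n + 1) * (2 * L)).toNNReal (F n) := by
    intro n
    apply LipschitzWith.of_dist_le_mul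
    intro x x'
    rw [Real.coe_toNNReal _ (by positivity), Real.dist_eq, Real.dist_eq]
    set δ := 1 / (n + 1 : ℝ)
    have e : F n x - F n x' = (n + 1) * ((∫ z in x' + δ..x + δ, f z) - ∫ z in x'..x, f z) := by
      simp only [hF]
      rw [← mul_sub]
      congr 1
      rw [← intervalIntegral.integral_add_adjacent_intervals (hint x x') (hint x' (x + δ)),
        ← intervalIntegral.integral_add_adjacent_intervals (hint x' (x' + δ)) (hint (x' + δ) (x + δ)),
        intervalIntegral.integral_symm x x']
      ring
    have b1 : |∫ z in x' + δ..x + δ, f z| ≤ L * |x - x'| := by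
      have := intervalIntegral.norm_integral_le_of_norm_le_const (a := x' + δ) (b := x + δ)
        (f := f) (C := L) (fun z _ => hL z)
      simpa using this
    have b2 : |∫ z in x'..x, f z| ≤ L * |x - x'| := by
      have := intervalIntegral.norm_integral_le_of_norm_le_const (a := x') (b := x)
        (f := f) (C := L) (fun z _ => hL z)
      simpa using this
    rw [e, abs_mul, abs_of_nonneg (by positivity : (0 : ℝ) ≤ n + 1), mul_assoc]
    refine mul_le_mul_of_nonneg_left ?_ (by positivity)
    have := abs_sub (∫ z in x' + δ..x + δ, f z) (∫ z in x'..x, f z)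
    linarith
  choose X hX0 hX using fun n => exists_global_solution (hlip n) (hFL n) y
  have hXL : ∀ n s t, |X n s - X n t| ≤ L * |s - t| := by
    intro n s t
    have := Convex.norm_image_sub_le_of_norm_hasDerivWithin_le (f := X n) (s := univ) (C := L)
      (fun t _ => (hX n t).hasDerivWithinAt) (fun t _ => by
        simpa [Real.coe_toNNReal _ hL0] using hFL n (X n t)) convex_univ (mem_univ t) (mem_univ s)
    simpa using this
  -- An ultrafilter gives a limit of the approximate solutions at all times at once, in place of a
  -- subsequence from Arzelà-Ascoli.
  let 𝒰 : Ultrafilter ℕ := Ultrafilter.of atTop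
  have h𝒰 : (𝒰 : Filter ℕ) ≤ atTop := Ultrafilter.of_le atTop
  have hlim : ∀ t, ∃ l, Tendsto (fun n => X n t) 𝒰 (𝓝 l) := by
    intro t
    have hc : IsCompact (Metric.closedBall y (L * |t|)) := isCompact_closedBall _ _
    obtain ⟨l, -, hl⟩ := hc.ultrafilter_le_nhds (𝒰.map fun n => X n t) (by
      rw [le_principal_iff]
      refine Ultrafilter.mem_coe.1 (Filter.mem_map.2 (univ_mem' fun n => ?_))
      have := hXL n t 0
      rw [hX0] at this
      simpa [Real.dist_eq] using this)
    exact ⟨l, hl⟩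
  choose x hx using hlim
  have hx0 : x 0 = y := tendsto_nhds_unique (hx 0) (by simp only [hX0]; exact tendsto_const_nhds)
  refine ⟨x, hx0, fun t => ?_⟩
  rw [hasDerivAt_iff_isLittleO, Asymptotics.isLittleO_iff]
  intro ε hε
  obtain ⟨δ, hδ, hfδ⟩ := Metric.continuousAt_iff.1 (hf.continuousAt (x := x t)) ε hε
  set η := δ / (3 * (L + 1)) with hη
  have hηpos : 0 < η := by positivity
  have hηL : L * η ≤ δ / 3 := by
    rw [hη, mul_div_assoc', div_le_div_iff₀ (by positivity) (by positivity)]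
    nlinarith
  filter_upwards [Metric.ball_mem_nhds t hηpos] with s hs
  rw [Metric.mem_ball, Real.dist_eq] at hs
  have ev : ∀ᶠ n in (𝒰 : Filter ℕ), ‖X n s - X n t - (s - t) • f (x t)‖ ≤ ε * ‖s - t‖ := by
    have e1 : ∀ᶠ n in (𝒰 : Filter ℕ), dist (X n t) (x t) < δ / 3 :=
      (Metric.tendsto_nhds.1 (hx t)) _ (by positivity)
    have e2 : ∀ᶠ n : ℕ in (𝒰 : Filter ℕ), 1 / (n + 1 : ℝ) < δ / 3 :=
      h𝒰 ((tendsto_one_div_add_atTop_nhds_zero_nat (𝕜 := ℝ)).eventually_lt_const (by positivity))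
    filter_upwards [e1, e2] with n h1 h2
    -- The three bounds `δ / 3` (convergence at `t`, motion during time `η`, width of the averaging
    -- window) keep the mean-value point within `δ` of `x t`, uniformly in such `n`. So the slope of
    -- `X n` near `t` is within `ε` of `f (x t)`.
    have := Convex.norm_image_sub_le_of_norm_hasDerivWithin_le
      (f := fun τ => X n τ - τ * f (x t)) (f' := fun τ => F n (X n τ) - f (x t))
      (s := Metric.ball t η) (C := ε)
      (fun τ _ => by
        have := (hX n τ).sub ((hasDerivAt_id τ).mul_const (f (x t)))
        rw [one_mul] at this
        exact this.hasDerivWithinAt)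
      (fun τ hτ => by
        obtain ⟨z, hz, h⟩ := hmean n (X n τ)
        rw [h, ← dist_eq_norm]
        refine (hfδ ?_).le
        rw [Metric.mem_ball, Real.dist_eq] at hτ
        rw [Real.dist_eq] at h1 ⊢
        have h3 := hXL n τ t
        have h4 : L * |τ - t| ≤ δ / 3 := le_trans (by gcongr) hηL
        have := abs_lt.1 h1
        have := abs_le.1 (h3.trans h4)
        rw [abs_lt]
        constructor <;> linarith [hz.1, hz.2])
      (convex_ball t η) (Metric.mem_ball_self hηpos)
      (by rwa [Metric.mem_ball, Real.dist_eq])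
    have e : X n s - X n t - (s - t) • f (x t) = X n s - s * f (x t) - (X n t - t * f (x t)) := by
      rw [smul_eq_mul]; ring
    rw [e]
    exact this
  refine le_of_tendsto ?_ ev
  exact (((hx s).sub (hx t)).sub tendsto_const_nhds).norm

/-- A solution of an autonomous equation on `[0, ∞)` that stays in a compact set `Ω`, with one
component of its derivative equal to the derivative of a converging function. -/
theorem tendsto_zero_of_hasDerivAt {X : Type*} [PseudoMetricSpace X] {Ω : Set X} (hΩ : IsCompact Ω)
    {G : X → ℝ} (hG : ContinuousOn G Ω) {p : ℝ → X} {k : NNReal}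
    (hp : LipschitzOnWith k p (Ici 0)) (hpΩ : ∀ s, 0 ≤ s → p s ∈ Ω) {f : ℝ → ℝ} {l : ℝ}
    (hf : ∀ s, 0 < s → HasDerivAt f (G (p s)) s) (hl : Tendsto f atTop (𝓝 l)) :
    Tendsto (fun s => G (p s)) atTop (𝓝 0) := by
  have huc := hΩ.uniformContinuousOn_of_continuous hG
  rw [Metric.uniformContinuousOn_iff] at huc
  rw [Metric.tendsto_atTop]
  intro ε hε
  obtain ⟨δ, hδ, hd⟩ := huc (ε / 2) (by positivity)
  set η := δ / (2 * (k + 1)) with hη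
  have hk : (0 : ℝ) ≤ k := k.2
  have hηpos : 0 < η := by positivity
  have hkη : k * η < δ := by
    rw [hη, mul_div_assoc', div_lt_iff₀ (by positivity)]
    nlinarith
  -- This is Barbalat's lemma. Over a window of length `η` the function `f` changes by less than `ε
  -- * η / 2`, so `G ∘ p` is below `ε / 2` in absolute value somewhere in it, and by uniform
  -- continuity it varies by less than `ε / 2` there.
  obtain ⟨N, hN⟩ := (Metric.tendsto_atTop.1 hl) (ε * η / 4) (by positivity)
  refine ⟨max N 1, fun s hs => ?_⟩
  have hsN : N ≤ s := (le_max_left _ _).trans hs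
  have hs1 : 1 ≤ s := (le_max_right _ _).trans hs
  obtain ⟨z, hz, h⟩ := exists_hasDerivAt_eq_slope f (fun s => G (p s)) (show s < s + η by linarith)
    (fun w hw => (hf w (by linarith [hw.1])).continuousAt.continuousWithinAt)
    (fun w hw => hf w (by linarith [hw.1]))
  have h1 := hN s hsN
  have h2 := hN (s + η) (by linarith)
  rw [Real.dist_eq] at h1 h2
  rw [add_sub_cancel_left] at h
  have h3 : |G (p z)| < ε / 2 := by
    rw [h, abs_div, abs_of_pos hηpos, div_lt_iff₀ hηpos, abs_lt]
    have := abs_lt.1 h1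
    have := abs_lt.1 h2
    constructor <;> linarith
  have h4 : dist (G (p s)) (G (p z)) < ε / 2 := by
    apply hd _ (hpΩ s (by linarith)) _ (hpΩ z (by linarith [hz.1]))
    refine lt_of_le_of_lt (hp.dist_le_mul s (by simp; linarith) z (by simp; linarith [hz.1])) ?_
    refine lt_of_le_of_lt ?_ hkη
    rw [Real.dist_eq, abs_sub_comm, abs_of_pos (by linarith [hz.1])]
    gcongr
    linarith [hz.2]
  rw [Real.dist_eq] at h4 ⊢
  rw [sub_zero]
  have := abs_sub_abs_le_abs_sub (G (p s)) (G (p z))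
  linarith

/-! ### The verification theorem -/

/-- A Caratheodory solution of an equation with right-hand side bounded by `L` along it is
`L`-Lipschitz. -/
theorem IsCaratheodorySol.abs_sub_le {f : ℝ → ℝ → ℝ} {y : ℝ} {x : ℝ → ℝ}
    (hx : IsCaratheodorySol f y x) {L : ℝ} (hL : ∀ t, 0 < t → |f t (x t)| ≤ L) {s t : ℝ}
    (hs : 0 ≤ s) (hst : s ≤ t) : |x t - x s| ≤ L * (t - s) := by
  rcases hst.eq_or_lt with rfl | hlt
  · simp
  have hac : AbsolutelyContinuousOnInterval x s t := by
    refine (hx.2.1 t (hs.trans_lt hlt)).mono ?_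
    rw [uIcc_of_le hst, uIcc_of_le (hs.trans hst)]
    exact Icc_subset_Icc_left hs
  rw [← hac.integral_deriv_eq_sub, ← abs_of_nonneg (sub_nonneg.2 hst)]
  refine intervalIntegral.norm_integral_le_of_norm_le_const_ae (f := deriv x) ?_
  filter_upwards [hx.2.2] with τ hτ hmem
  rw [uIoc_of_le hst] at hmem
  have hpos : 0 < τ := hs.trans_lt hmem.1
  rw [(hτ hpos).deriv]
  exact hL τ hpos

theorem lipschitzWith_of_hasDerivAt_bounded {F : Type*} [NormedAddCommGroup F] [NormedSpace ℝ F]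
    {V P : ℝ → F} (hV : ∀ x, HasDerivAt V (P x) x) {M : NNReal} (hP : ∀ x, ‖P x‖ ≤ M) :
    LipschitzWith M V := by
  rw [← lipschitzOnWith_univ]
  exact Convex.lipschitzOnWith_of_nnnorm_hasDerivWithin_le convex_univ
    (fun x _ => (hV x).hasDerivWithinAt) (fun x _ => hP x)

theorem integrableOn_exp_neg_half : IntegrableOn (fun t : ℝ => Real.exp (-(1 / 2) * t)) (Ici 0) := by
  rw [integrableOn_Ici_iff_integrableOn_Ioi]
  exact exp_neg_integrableOn_Ioi 0 (by norm_num)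

/-- Half of the discount absorbs the linear growth, since `t * exp (-t / 2) ≤ 2`. This yields both
the integrability of the costs and the decay of the discounted value. -/
theorem exp_neg_mul_add_le {c d t : ℝ} (hc : 0 ≤ c) (hd : 0 ≤ d) (ht : 0 ≤ t) :
    Real.exp (-t) * (c + d * t) ≤ (c + 2 * d) * Real.exp (-(1 / 2) * t) := by
  set q := Real.exp (-(1 / 2) * t) with hq
  have h1 : Real.exp (-t) = q * q := by
    rw [hq, ← Real.exp_add]; ring_nf
  have h2 : q * Real.exp (1 / 2 * t) = 1 := by
    rw [hq, ← Real.exp_add]; ring_nf; simp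
  have h3 := Real.add_one_le_exp (1 / 2 * t)
  have h4 : 0 < q := Real.exp_pos _
  have h5 : q ≤ 1 := Real.exp_le_one_iff.2 (by linarith)
  have h6 : t * q ≤ 2 := by nlinarith
  rw [h1, mul_assoc, mul_comm (c + 2 * d)]
  refine mul_le_mul_of_nonneg_left ?_ h4.le
  nlinarith [mul_le_mul_of_nonneg_left h6 hd, mul_le_mul_of_nonneg_left h5 hc]

/-- Verification: if `V` solves the Hamilton-Jacobi equation `V = h - P Q - P² / 2` with `P = V'`,
then `V y` is the least cost from `y` against the feedback `-Q`, and the feedback `-P` attains it. -/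
theorem cost_of_isAdmissiblePair {V P Q h : ℝ → ℝ} (hV : ∀ x, HasDerivAt V (P x) x)
    (hh : Continuous h) {M : ℝ} (hP : ∀ x, |P x| ≤ M) (hQ : ∀ x, |Q x| ≤ M)
    (hHJ : ∀ x, V x = h x - P x * Q x - P x ^ 2 / 2) {A : Set ℝ} (hA : IsCompact A) {y : ℝ}
    {x a : ℝ → ℝ} (hxa : IsAdmissiblePair A (fun z => -Q z) y x a) :
    IntegrableOn (runningCost h x a) (Ici 0) ∧ V y ≤ totalCost h x a ∧
      ((∀ t, 0 ≤ t → a t = -P (x t)) → totalCost h x a = V y) := by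
  obtain ⟨ham, haA, hx⟩ := hxa
  have hM0 : 0 ≤ M := (abs_nonneg _).trans (hP 0)
  obtain ⟨N, hN⟩ := hA.isBounded.exists_norm_le
  have ha : ∀ t, 0 ≤ t → |a t| ≤ N := fun t ht => hN _ (haA t ht)
  have hN0 : 0 ≤ N := (abs_nonneg _).trans (ha 0 le_rfl)
  set L := N + M with hL
  have hxL : ∀ s t, 0 ≤ s → s ≤ t → |x t - x s| ≤ L * (t - s) := by
    intro s t hs hst
    refine hx.abs_sub_le (fun τ hτ => ?_) hs hst
    refine (abs_add_le _ _).trans (add_le_add (ha τ hτ.le) ?_)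
    rw [abs_neg]; exact hQ _
  have hxgrow : ∀ t, 0 ≤ t → |x t| ≤ |y| + L * t := by
    intro t ht
    have h1 := hxL 0 t le_rfl ht
    rw [hx.1, sub_zero] at h1
    have := abs_sub_abs_le_abs_sub (x t) y
    linarith
  have hVlip := lipschitzWith_of_hasDerivAt_bounded hV (M := M.toNNReal) (by
    intro x; rw [Real.coe_toNNReal _ hM0]; exact hP x)
  have hVgrow : ∀ z, |V z| ≤ |V 0| + M * |z| := by
    intro z
    have h1 := hVlip.dist_le_mul z 0
    rw [Real.dist_eq, Real.dist_eq, sub_zero, Real.coe_toNNReal _ hM0] at h1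
    have := abs_sub_abs_le_abs_sub (V z) (V 0)
    linarith
  have hPQ : ∀ z, |P z * Q z| ≤ M ^ 2 := by
    intro z
    rw [abs_mul, sq]
    exact mul_le_mul (hP z) (hQ z) (abs_nonneg _) hM0
  have hP2 : ∀ z, P z ^ 2 ≤ M ^ 2 := fun z => sq_le_sq' (abs_le.1 (hP z)).1 (abs_le.1 (hP z)).2
  have ha2 : ∀ t, 0 ≤ t → a t ^ 2 ≤ N ^ 2 := fun t ht =>
    sq_le_sq' (abs_le.1 (ha t ht)).1 (abs_le.1 (ha t ht)).2
  -- The growth of `h` need not be assumed: it is read off from the Hamilton-Jacobi equation.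
  have hhgrow : ∀ z, |h z| ≤ |V 0| + M * |z| + 2 * M ^ 2 := by
    intro z
    have e : h z = V z + P z * Q z + P z ^ 2 / 2 := by rw [hHJ z]; ring
    have h1 := abs_le.1 (hVgrow z)
    have h2 := abs_le.1 (hPQ z)
    have h3 := hP2 z
    have h4 := sq_nonneg (P z)
    rw [e, abs_le]
    constructor <;> nlinarith
  have hxc : ContinuousOn x (Ici 0) := by
    have : LipschitzOnWith L.toNNReal x (Ici 0) := by
      apply LipschitzOnWith.of_dist_le_mul
      intro s hs t ht
      rw [Real.coe_toNNReal _ (by positivity), Real.dist_eq, Real.dist_eq]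
      rcases le_total s t with hst | hst
      · rw [abs_sub_comm, abs_sub_comm s t, abs_of_nonneg (sub_nonneg.2 hst)]
        exact hxL s t hs hst
      · rw [abs_of_nonneg (sub_nonneg.2 hst)]
        exact hxL t s ht hst
    exact this.continuousOn
  set c := |V 0| + M * |y| + 2 * M ^ 2 + N ^ 2 with hc
  set d := M * L with hd
  have hbound : ∀ t, 0 ≤ t →
      ‖runningCost h x a t‖ ≤ (c + 2 * d) * Real.exp (-(1 / 2) * t) := by
    intro t ht
    refine le_trans ?_ (exp_neg_mul_add_le (c := c) (d := d) (by positivity) (by positivity) ht)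
    rw [runningCost, norm_mul, Real.norm_eq_abs, Real.norm_eq_abs, abs_of_pos (Real.exp_pos _)]
    refine mul_le_mul_of_nonneg_left ?_ (Real.exp_pos _).le
    have h1 := abs_le.1 (hhgrow (x t))
    have h2 := ha2 t ht
    have h3 := sq_nonneg (a t)
    have h4 := mul_le_mul_of_nonneg_left (hxgrow t ht) hM0
    rw [abs_le]
    constructor <;> simp only [hc, hd] <;> nlinarith
  have hmeas : AEStronglyMeasurable (runningCost h x a) (volume.restrict (Ici 0)) := by
    apply AEMeasurable.aestronglyMeasurable
    refine AEMeasurable.mul (by fun_prop) (AEMeasurable.add ?_ ((ham.pow_const 2).div_const 2))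
    exact (hh.comp_continuousOn hxc).aemeasurable measurableSet_Ici
  have hint : IntegrableOn (runningCost h x a) (Ici 0) := by
    refine Integrable.mono' (integrableOn_exp_neg_half.const_mul (c + 2 * d)) hmeas ?_
    exact (ae_restrict_iff' measurableSet_Ici).2 (Eventually.of_forall hbound)
  have htc : Tendsto (fun T => ∫ t in (0 : ℝ)..T, runningCost h x a t) atTop
      (𝓝 (totalCost h x a)) := by
    have := intervalIntegral_tendsto_integral_Ioi 0 (hint.mono_set Ioi_subset_Ici_self)
      tendsto_id
    rwa [← integral_Ici_eq_integral_Ioi] at this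
  set φ : ℝ → ℝ := fun t => Real.exp (-t) * V (x t) with hφ
  have hφac : ∀ T, 0 < T → AbsolutelyContinuousOnInterval φ 0 T := by
    intro T hT
    refine AbsolutelyContinuousOnInterval.mul (f := fun t => Real.exp (-t))
      (g := fun t => V (x t)) ?_ ?_
    · exact ContDiffOn.absolutelyContinuousOnInterval (by fun_prop)
    · have : LipschitzOnWith (M.toNNReal * L.toNNReal) (V ∘ x) (uIcc 0 T) := by
        refine hVlip.comp_lipschitzOnWith (LipschitzOnWith.of_dist_le_mul ?_)
        rw [uIcc_of_le hT.le]
        intro s hs t ht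
        rw [Real.coe_toNNReal _ (by positivity), Real.dist_eq, Real.dist_eq]
        rcases le_total s t with hst | hst
        · rw [abs_sub_comm, abs_sub_comm s t, abs_of_nonneg (sub_nonneg.2 hst)]
          exact hxL s t hs.1 hst
        · rw [abs_of_nonneg (sub_nonneg.2 hst)]
          exact hxL t s ht.1 hst
      exact this.absolutelyContinuousOnInterval
  -- Completion of the square: by the Hamilton-Jacobi equation, `φ'` plus the running cost is `exp
  -- (-t) * (P + a)² / 2`. It is nonnegative for every control and vanishes for `a = -P`, which
  -- gives the inequality and the equality below.
  have hφder : ∀ᵐ t : ℝ, 0 < t → deriv φ t =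
      Real.exp (-t) * ((P (x t) + a t) ^ 2 / 2) - runningCost h x a t := by
    filter_upwards [hx.2.2] with t ht h0
    have h1 : HasDerivAt (fun t => V (x t)) (P (x t) * (a t + -Q (x t))) t :=
      (hV (x t)).comp t (ht h0)
    have h2 : HasDerivAt (fun t : ℝ => Real.exp (-t)) (-Real.exp (-t)) t := by
      simpa using (hasDerivAt_neg t).exp
    have h3 : HasDerivAt φ _ t := h2.mul h1
    rw [h3.deriv, runningCost, hHJ]
    ring
  have hφint : ∀ T, 0 < T → ∫ t in (0 : ℝ)..T, deriv φ t = φ T - V y := by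
    intro T hT
    rw [(hφac T hT).integral_deriv_eq_sub]
    simp [hφ, hx.1]
  have hφ0 : Tendsto φ atTop (𝓝 0) := by
    have h1 : Tendsto (fun t : ℝ => (c + 2 * d) * Real.exp (-(1 / 2) * t)) atTop (𝓝 0) := by
      have : Tendsto (fun t : ℝ => Real.exp (-(1 / 2) * t)) atTop (𝓝 0) := by
        refine Real.tendsto_exp_atBot.comp ?_
        exact tendsto_id.const_mul_atTop_of_neg (by norm_num)
      simpa using this.const_mul (c + 2 * d)
    refine squeeze_zero_norm' ?_ h1
    filter_upwards [eventually_ge_atTop 0] with t ht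
    refine le_trans ?_ (exp_neg_mul_add_le (c := c) (d := d) (by positivity) (by positivity) ht)
    rw [hφ, norm_mul, Real.norm_eq_abs, Real.norm_eq_abs, abs_of_pos (Real.exp_pos _)]
    refine mul_le_mul_of_nonneg_left ?_ (Real.exp_pos _).le
    have h1 := hVgrow (x t)
    have h4 := mul_le_mul_of_nonneg_left (hxgrow t ht) hM0
    simp only [hc, hd]
    nlinarith
  have hrint : ∀ T, 0 < T → IntervalIntegrable (runningCost h x a) volume 0 T := by
    intro T hT
    rw [intervalIntegrable_iff_integrableOn_Ioc_of_le hT.le]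
    exact hint.mono_set fun t ht => ht.1.le
  have hlim : Tendsto (fun T => V y - φ T) atTop (𝓝 (V y)) := by
    simpa using hφ0.const_sub (V y)
  refine ⟨hint, ?_, fun hopt => ?_⟩
  · refine le_of_tendsto_of_tendsto hlim htc ?_
    filter_upwards [eventually_gt_atTop 0] with T hT
    have h1 : ∫ t in (0 : ℝ)..T, -deriv φ t ≤ ∫ t in (0 : ℝ)..T, runningCost h x a t := by
      refine intervalIntegral.integral_mono_ae_restrict hT.le
        (hφac T hT).intervalIntegrable_deriv.neg (hrint T hT) ?_
      refine (ae_restrict_iff' measurableSet_Icc).2 ?_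
      have h0 : ∀ᵐ t : ℝ, t ≠ 0 := by simp [ae_iff]
      filter_upwards [hφder, h0] with t ht ht0 hmem
      simp only [ht (lt_of_le_of_ne hmem.1 ht0.symm)]
      have : 0 ≤ Real.exp (-t) * ((P (x t) + a t) ^ 2 / 2) := by positivity
      linarith
    rw [intervalIntegral.integral_neg, hφint T hT] at h1
    linarith
  · refine tendsto_nhds_unique htc (hlim.congr' ?_)
    filter_upwards [eventually_gt_atTop 0] with T hT
    have h1 : ∫ t in (0 : ℝ)..T, -deriv φ t = ∫ t in (0 : ℝ)..T, runningCost h x a t := by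
      refine intervalIntegral.integral_congr_ae ?_
      filter_upwards [hφder] with t ht hmem
      rw [uIoc_of_le hT.le] at hmem
      simp only [ht hmem.1, hopt t hmem.1.le]
      ring
    rw [intervalIntegral.integral_neg, hφint T hT] at h1
    linarith

/-! ### Equilibria from `C¹` solutions -/

theorem IsCaratheodorySol.continuousOn {f : ℝ → ℝ → ℝ} {y : ℝ} {x : ℝ → ℝ}
    (hx : IsCaratheodorySol f y x) : ContinuousOn x (Ici 0) := by
  intro t ht
  have h1 := (hx.2.1 (t + 1) (by linarith [mem_Ici.1 ht])).continuousOn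
  rw [uIcc_of_le (by linarith [mem_Ici.1 ht])] at h1
  have h2 := h1 t ⟨ht, by linarith⟩
  refine h2.mono_of_mem_nhdsWithin ?_
  rw [← Ici_inter_Iic]
  exact inter_mem self_mem_nhdsWithin (mem_nhdsWithin_of_mem_nhds (Iic_mem_nhds (by linarith)))

/-- A continuously differentiable solution of the Hamilton-Jacobi system with bounded derivative
gives a Nash equilibrium. -/
theorem givesNash_of_hasDerivAt {h₁ h₂ : ℝ → ℝ} (hc₁ : Continuous h₁) (hc₂ : Continuous h₂)
    {u P : ℝ → ℝ × ℝ} (hu : ∀ x, HasDerivAt u (P x) x) (hP : Continuous P) {M : ℝ}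
    (hM : ∀ x, ‖P x‖ ≤ M) (hHJ : ∀ x, HJAt h₁ h₂ u x (P x)) : GivesNash h₁ h₂ u := by
  have hd : deriv u = P := funext fun x => (hu x).deriv
  intro A₁ A₂ hA₁ hA₂ hm₁ hm₂
  simp only [hd] at hm₁ hm₂ ⊢
  have hM1 : ∀ x, |(P x).1| ≤ M := fun x => (norm_fst_le (P x)).trans (hM x)
  have hM2 : ∀ x, |(P x).2| ≤ M := fun x => (norm_snd_le (P x)).trans (hM x)
  have hu1 : ∀ x, HasDerivAt (fun x => (u x).1) (P x).1 x := fun x => (hu x).fst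
  have hu2 : ∀ x, HasDerivAt (fun x => (u x).2) (P x).2 x := fun x => (hu x).snd
  refine ⟨hm₁, hm₂, fun y => ⟨?_, fun x hx => ?_⟩⟩
  · have hb : ∀ z, |-(P z).1 + -(P z).2| ≤ 2 * M := by
      intro z
      have := abs_add_le (-(P z).1) (-(P z).2)
      rw [abs_neg, abs_neg] at this
      linarith [hM1 z, hM2 z]
    have hM0 : 0 ≤ 2 * M := (abs_nonneg _).trans (hb 0)
    -- The feedbacks are only continuous, possibly not Lipschitz where `u'` vanishes, hence the
    -- appeal to Peano's theorem.
    obtain ⟨x, hx0, hx⟩ := exists_solution_of_continuous_bounded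
      (f := fun z => -(P z).1 + -(P z).2) (by fun_prop) hb y
    refine ⟨x, hx0, fun T _ => ?_, Eventually.of_forall fun t _ => hx t⟩
    have := lipschitzWith_of_hasDerivAt_bounded hx (M := (2 * M).toNNReal) (by
      intro t; rw [Real.coe_toNNReal _ hM0]; exact hb _)
    exact this.lipschitzOnWith.absolutelyContinuousOnInterval
  · have hadm1 : IsAdmissiblePair A₁ (fun z => -(P z).2) y x (fun t => -(P (x t)).1) :=
      ⟨((by fun_prop : Continuous fun z => -(P z).1).comp_continuousOn
        hx.continuousOn).aemeasurable measurableSet_Ici, fun t _ => hm₁ _, hx⟩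
    have hadm2 : IsAdmissiblePair A₂ (fun z => -(P z).1) y x (fun t => -(P (x t)).2) := by
      refine ⟨((by fun_prop : Continuous fun z => -(P z).2).comp_continuousOn
        hx.continuousOn).aemeasurable measurableSet_Ici, fun t _ => hm₂ _, hx.1, hx.2.1, ?_⟩
      filter_upwards [hx.2.2] with t ht h0
      rw [add_comm]
      exact ht h0
    have hHJ2 : ∀ x, (u x).2 = h₂ x - (P x).2 * (P x).1 - (P x).2 ^ 2 / 2 := by
      intro x; rw [(hHJ x).2]; ring
    have c1 := cost_of_isAdmissiblePair hu1 hc₁ hM1 hM2 (fun x => (hHJ x).1) hA₁ hadm1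
    have c2 := cost_of_isAdmissiblePair hu2 hc₂ hM2 hM1 hHJ2 hA₂ hadm2
    refine ⟨⟨hadm1, c1.1, fun x' a' h' => ?_⟩, ⟨hadm2, c2.1, fun x' a' h' => ?_⟩⟩
    · rw [c1.2.2 fun _ _ => rfl]
      exact (cost_of_isAdmissiblePair hu1 hc₁ hM1 hM2 (fun x => (hHJ x).1) hA₁ h').2.1
    · rw [c2.2.2 fun _ _ => rfl]
      exact (cost_of_isAdmissiblePair hu2 hc₂ hM2 hM1 hHJ2 hA₂ h').2.1

/-- A continuously differentiable solution of the Hamilton-Jacobi system with bounded derivative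
is admissible. -/
theorem isAdmissibleSolution_of_hasDerivAt {h₁ h₂ : ℝ → ℝ}
    {u P : ℝ → ℝ × ℝ} (hu : ∀ x, HasDerivAt u (P x) x) (hP : Continuous P) {M : ℝ}
    (hM : ∀ x, ‖P x‖ ≤ M) (hHJ : ∀ x, HJAt h₁ h₂ u x (P x)) : IsAdmissibleSolution h₁ h₂ u := by
  have hd : deriv u = P := funext fun x => (hu x).deriv
  have hM0 : 0 ≤ M := (norm_nonneg _).trans (hM 0)
  have hlip := lipschitzWith_of_hasDerivAt_bounded hu (M := M.toNNReal) (by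
      intro t; rw [Real.coe_toNNReal _ hM0]; exact hM _)
  refine ⟨fun a b => hlip.lipschitzOnWith.absolutelyContinuousOnInterval,
    Eventually.of_forall fun x => ⟨(hu x).differentiableAt, by rw [hd]; exact hHJ x⟩,
    ⟨‖u 0‖ + M, fun x => ?_⟩, fun y => ⟨P y, P y, ?_, ?_, fun h => (h rfl).elim⟩⟩
  · have h1 := hlip.dist_le_mul x 0
    rw [dist_eq_norm, Real.dist_eq, sub_zero, Real.coe_toNNReal _ hM0] at h1
    have h2 := norm_sub_norm_le (u x) (u 0)
    nlinarith [norm_nonneg (u 0), abs_nonneg x, mul_nonneg (norm_nonneg (u 0)) (abs_nonneg x)]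
  · rw [hd]; exact hP.continuousAt.continuousWithinAt
  · rw [hd]; exact hP.continuousAt.continuousWithinAt

/-! ### Sectors and the reflection symmetry -/

theorem mem_sector_three {K : ℝ × ℝ} (hK : K ∈ sector 3) : K.1 < 0 ∧ 0 < K.2 ∧ 0 < K.1 + K.2 := by
  obtain ⟨ρ, θ, hρ, h1, h2, rfl⟩ := hK
  have hpi := Real.pi_pos
  norm_num at h1 h2
  have hc : Real.cos θ < 0 := Real.cos_neg_of_pi_div_two_lt_of_lt (by linarith) (by linarith)
  have hs : 0 < Real.sin θ := Real.sin_pos_of_pos_of_lt_pi (by linarith) (by linarith)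
  have hsum : 0 < Real.sin (θ + Real.pi / 4) :=
    Real.sin_pos_of_pos_of_lt_pi (by linarith) (by linarith)
  rw [Real.sin_add, Real.cos_pi_div_four, Real.sin_pi_div_four] at hsum
  have h3 : 0 < Real.cos θ + Real.sin θ := by
    have h2 : 0 < √2 / 2 := by positivity
    nlinarith
  refine ⟨mul_neg_of_pos_of_neg hρ hc, mul_pos hρ hs, ?_⟩
  rw [← mul_add]
  exact mul_pos hρ h3

theorem mem_sector_four {K : ℝ × ℝ} (hK : K ∈ sector 4) : K.1 < 0 ∧ 0 < K.2 ∧ K.1 + K.2 < 0 := by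
  obtain ⟨ρ, θ, hρ, h1, h2, rfl⟩ := hK
  have hpi := Real.pi_pos
  norm_num at h1 h2
  have hc : Real.cos θ < 0 := Real.cos_neg_of_pi_div_two_lt_of_lt (by linarith) (by linarith)
  have hs : 0 < Real.sin θ := Real.sin_pos_of_pos_of_lt_pi (by linarith) (by linarith)
  have hsum : Real.sin (θ + Real.pi / 4 - 2 * Real.pi) < 0 :=
    Real.sin_neg_of_neg_of_neg_pi_lt (by linarith) (by linarith)
  rw [Real.sin_sub_two_pi, Real.sin_add, Real.cos_pi_div_four, Real.sin_pi_div_four] at hsum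
  have h3 : Real.cos θ + Real.sin θ < 0 := by
    have h2 : 0 < √2 / 2 := by positivity
    nlinarith
  refine ⟨mul_neg_of_pos_of_neg hρ hc, mul_pos hρ hs, ?_⟩
  rw [← mul_add]
  exact mul_neg_of_pos_of_neg hρ h3

/-- The reflection in the antidiagonal. Together with a reversal of time it exchanges the systems
of `K` and `refl K`. -/
def refl (p : ℝ × ℝ) : ℝ × ℝ := (-p.2, -p.1)

@[simp] theorem refl_fst (p : ℝ × ℝ) : (refl p).1 = -p.2 := rfl
@[simp] theorem refl_snd (p : ℝ × ℝ) : (refl p).2 = -p.1 := rfl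
@[simp] theorem refl_refl (p : ℝ × ℝ) : refl (refl p) = p := by simp [refl]
@[simp] theorem refl_zero : refl 0 = 0 := by simp [refl]

theorem refl_eq_zero {p : ℝ × ℝ} : refl p = 0 ↔ p = 0 := by
  constructor
  · intro h; rw [← refl_refl p, h, refl_zero]
  · rintro rfl; exact refl_zero

theorem continuous_refl : Continuous refl := by unfold refl; fun_prop

theorem norm_refl (p : ℝ × ℝ) : ‖refl p‖ = ‖p‖ := by
  simp [refl, Prod.norm_def, max_comm]

theorem Delta_eq (p : ℝ × ℝ) : Delta p = p.1 ^ 2 + p.1 * p.2 + p.2 ^ 2 := by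
  simp [Delta, Matrix.det_fin_two]; ring

theorem Delta_refl (p : ℝ × ℝ) : Delta (refl p) = Delta p := by
  simp [Delta_eq]; ring

theorem Delta_pos {p : ℝ × ℝ} (hp : p ≠ 0) : 0 < Delta p := by
  have h : p.1 ≠ 0 ∨ p.2 ≠ 0 := by
    by_contra! h
    exact hp (Prod.ext h.1 h.2)
  rw [Delta_eq]
  rcases h with h | h
  · have := pow_pos (abs_pos.2 h) 2
    rw [sq_abs] at this
    nlinarith [sq_nonneg (p.1 + 2 * p.2)]
  · have := pow_pos (abs_pos.2 h) 2
    rw [sq_abs] at this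
    nlinarith [sq_nonneg (2 * p.1 + p.2)]

theorem continuous_Delta : Continuous Delta := by
  simp only [funext Delta_eq]; fun_prop

/-- `Prod.swap` is minus `refl`, and reversal of time absorbs the sign. Facts about `K.1 < 0 < K.1 +
K.2` thereby transfer to `K.1 + K.2 < 0 < K.2`, with stable and unstable exchanged. -/
theorem field_refl (K p : ℝ × ℝ) : field (refl K) (refl p) = (field K p).swap := by
  ext <;> simp [field] <;> ring

theorem hasDerivAt_fst {p : ℝ → ℝ × ℝ} {q : ℝ × ℝ} {s : ℝ} (h : HasDerivAt p q s) :
    HasDerivAt (fun s => (p s).1) q.1 s := h.fst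

theorem hasDerivAt_snd {p : ℝ → ℝ × ℝ} {q : ℝ × ℝ} {s : ℝ} (h : HasDerivAt p q s) :
    HasDerivAt (fun s => (p s).2) q.2 s := h.snd

theorem hasDerivAt_refl_comp_neg {K : ℝ × ℝ} {p : ℝ → ℝ × ℝ} {s : ℝ}
    (h : HasDerivAt p (field K (p (-s))) (-s)) :
    HasDerivAt (fun s => refl (p (-s))) (field (refl K) (refl (p (-s)))) s := by
  have h1 : HasDerivAt (fun s => p (-s)) (-field K (p (-s))) s := by
    have := h.scomp s (hasDerivAt_neg s)
    rw [neg_one_smul] at this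
    exact this
  rw [field_refl]
  refine ((hasDerivAt_snd h1).neg.prodMk (hasDerivAt_fst h1).neg).congr_deriv ?_
  simp [Prod.swap]

theorem contDiff_field (K : ℝ × ℝ) : ContDiff ℝ 1 (field K) := by
  unfold field; fun_prop

/-! ### From trajectories to solutions -/

/-- A `C¹` function with positive derivative has an inverse with the expected derivative. -/
theorem exists_local_inverse {x D : ℝ → ℝ} (hx : ∀ s, HasDerivAt x (D s) s) (hD : Continuous D)
    (hpos : ∀ s, 0 < D s) :
    ∃ σ : ℝ → ℝ, (∀ s, σ (x s) = s) ∧ (∀ s, HasDerivAt σ (D s)⁻¹ (x s)) ∧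
      ∀ s, ∀ᶠ z in 𝓝 (x s), x (σ z) = z := by
  have hmono : StrictMono x := strictMono_of_deriv_pos fun s => by
    rw [(hx s).deriv]; exact hpos s
  have hσ : ∀ s, Function.invFun x (x s) = s := Function.leftInverse_invFun hmono.injective
  have hst : ∀ s, HasStrictDerivAt x (D s) s := fun s =>
    hasStrictDerivAt_of_hasDerivAt_of_continuousAt (Eventually.of_forall hx) hD.continuousAt
  refine ⟨Function.invFun x, hσ, fun s => ?_, fun s => ?_⟩
  · exact ((hst s).to_local_left_inverse (hpos s).ne' (Eventually.of_forall hσ)).hasDerivAt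
  · have := (hst s).map_nhds_eq (hpos s).ne'
    rw [← this, eventually_map]
    exact Eventually.of_forall fun t => by rw [hσ]

/-- The solution of the Hamilton-Jacobi system with `u' = P`. -/
def hjSol (h₁ h₂ : ℝ → ℝ) (P : ℝ → ℝ × ℝ) (x : ℝ) : ℝ × ℝ :=
  (h₁ x - (P x).1 * (P x).2 - (P x).1 ^ 2 / 2, h₂ x - (P x).1 * (P x).2 - (P x).2 ^ 2 / 2)

theorem continuousAt_of_comp_eq {P p : ℝ → ℝ × ℝ} {x : ℝ → ℝ} (hp : Continuous p)
    (hp0 : ∀ s, p s ≠ 0) (hx : ∀ s, HasDerivAt x (Delta (p s)) s) (hP : ∀ s, P (x s) = p s)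
    (s : ℝ) : ContinuousAt P (x s) := by
  obtain ⟨σ, h1, h2, h3⟩ := exists_local_inverse hx (continuous_Delta.comp hp)
    fun s => Delta_pos (hp0 s)
  have : P =ᶠ[𝓝 (x s)] p ∘ σ := by
    filter_upwards [h3 s] with z hz
    rw [Function.comp, ← hP, hz]
  exact (hp.continuousAt.comp (h2 s).continuousAt).congr this.symm

/-- Differentiating the two equations gives `(p₁ + p₂) p₁' + p₁ p₂' = K.1 - p₁` and `p₂ p₁' + (p₁ +
p₂) p₂' = K.2 - p₂`. By Cramer's rule this is `p' = Δ⁻¹ • field K p`, so the computation can be run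
backwards. -/
theorem hasDerivAt_hjSol {h₁ h₂ : ℝ → ℝ} {K : ℝ × ℝ} {P p : ℝ → ℝ × ℝ} {x : ℝ → ℝ}
    (hp : Continuous p) (hp0 : ∀ s, p s ≠ 0) (hx : ∀ s, HasDerivAt x (Delta (p s)) s)
    (hP : ∀ s, P (x s) = p s) {s : ℝ} (hps : HasDerivAt p (field K (p s)) s)
    (hh₁ : HasDerivAt h₁ K.1 (x s)) (hh₂ : HasDerivAt h₂ K.2 (x s)) :
    HasDerivAt (hjSol h₁ h₂ P) (P (x s)) (x s) := by
  obtain ⟨σ, h1, h2, h3⟩ := exists_local_inverse hx (continuous_Delta.comp hp)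
    fun s => Delta_pos (hp0 s)
  have heq : P =ᶠ[𝓝 (x s)] p ∘ σ := by
    filter_upwards [h3 s] with z hz
    rw [Function.comp, ← hP, hz]
  have hP' : HasDerivAt P ((Delta (p s))⁻¹ • field K (p s)) (x s) := by
    refine HasDerivAt.congr_of_eventuallyEq ?_ heq
    refine HasDerivAt.scomp (x s) ?_ (h2 s)
    rwa [h1]
  have ha := hasDerivAt_fst hP'
  have hb := hasDerivAt_snd hP'
  have hD := inv_mul_cancel₀ (Delta_pos (hp0 s)).ne'
  nth_rewrite 2 [Delta_eq] at hD
  have c1 := (hh₁.sub (ha.mul hb)).sub ((ha.pow 2).div_const 2)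
  have c2 := (hh₂.sub (ha.mul hb)).sub ((hb.pow 2).div_const 2)
  have e := c1.prodMk c2
  refine e.congr_deriv ?_
  rw [hP]
  ext
  · simp [field]
    linear_combination -(K.1 - (p s).1) * hD
  · simp [field]
    linear_combination -(K.2 - (p s).2) * hD

/-- By the fundamental theorem of calculus `u` is a primitive of the continuous `P`. This covers the
kink of the costs at `x = 0` and the points where `P` vanishes, at which the change of variable
degenerates. -/
theorem hasDerivAt_of_off_countable {F : Type*} [NormedAddCommGroup F] [NormedSpace ℝ F]
    [CompleteSpace F] {u P : ℝ → F} {S : Set ℝ} (hS : S.Countable)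
    (hu : Continuous u) (hP : Continuous P) (h : ∀ x, x ∉ S → HasDerivAt u (P x) x) (x : ℝ) :
    HasDerivAt u (P x) x := by
  have e : u = fun x => u 0 + ∫ z in (0 : ℝ)..x, P z := by
    funext x
    rw [integral_eq_of_hasDerivAt_off_countable u P hS hu.continuousOn (fun z hz => h z hz.2)
      (hP.intervalIntegrable _ _)]
    abel
  rw [e]
  exact ((hP.integral_hasStrictDerivAt 0 x).hasDerivAt).const_add _

/-- `hjSol` is an admissible solution that gives a Nash equilibrium, as soon as its derivative is
the continuous bounded function `P` outside of a countable set. -/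
theorem hjSol_spec {h₁ h₂ : ℝ → ℝ} (hc₁ : Continuous h₁) (hc₂ : Continuous h₂) {P : ℝ → ℝ × ℝ}
    (hP : Continuous P) {M : ℝ} (hM : ∀ x, ‖P x‖ ≤ M) {S : Set ℝ} (hS : S.Countable)
    (h : ∀ x, x ∉ S → HasDerivAt (hjSol h₁ h₂ P) (P x) x) :
    (∀ x, HasDerivAt (hjSol h₁ h₂ P) (P x) x) ∧ IsAdmissibleSolution h₁ h₂ (hjSol h₁ h₂ P) ∧
      GivesNash h₁ h₂ (hjSol h₁ h₂ P) := by
  have hc : Continuous (hjSol h₁ h₂ P) := by unfold hjSol; fun_prop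
  have hd := hasDerivAt_of_off_countable hS hc hP h
  exact ⟨hd, isAdmissibleSolution_of_hasDerivAt hd hP hM fun x => ⟨rfl, rfl⟩,
    givesNash_of_hasDerivAt hc₁ hc₂ hd hP hM fun x => ⟨rfl, rfl⟩⟩

/-! ### The change of variable -/

theorem exists_changeOfVariable {p : ℝ → ℝ × ℝ} (hp : Continuous p) (c : ℝ) :
    ∃ x : ℝ → ℝ, x 0 = c ∧ ∀ s, HasDerivAt x (Delta (p s)) s :=
  ⟨fun s => c + ∫ z in (0 : ℝ)..s, Delta (p z), by simp, fun s =>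
    (((continuous_Delta.comp hp).integral_hasStrictDerivAt 0 s).hasDerivAt).const_add _⟩

theorem tendsto_atTop_of_hasDerivAt {x D : ℝ → ℝ} (hx : ∀ s, HasDerivAt x (D s) s) {d : ℝ}
    (hd : 0 < d) (hD : Tendsto D atTop (𝓝 d)) : Tendsto x atTop atTop := by
  obtain ⟨N, hN⟩ := eventually_atTop.1 (hD.eventually_const_lt (half_lt_self hd))
  have h1 : ∀ s, N ≤ s → d / 2 * (s - N) ≤ x s - x N := by
    intro s hs
    refine Convex.mul_sub_le_image_sub_of_le_deriv (convex_Ici N)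
      (fun z _ => (hx z).continuousAt.continuousWithinAt)
      (fun z _ => (hx z).differentiableAt.differentiableWithinAt) ?_ N self_mem_Ici s hs hs
    intro z hz
    rw [interior_Ici] at hz
    rw [(hx z).deriv]
    exact (hN z (le_of_lt hz)).le
  refine tendsto_atTop_mono' atTop (f₁ := fun s => d / 2 * (s - N) + x N) ?_ ?_
  · filter_upwards [eventually_ge_atTop N] with s hs
    linarith [h1 s hs]
  · refine tendsto_atTop_add_const_right _ _ ?_
    refine Tendsto.const_mul_atTop (by positivity) ?_
    exact tendsto_atTop_add_const_right _ _ tendsto_id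

theorem hasDerivAt_neg_comp_neg {x D : ℝ → ℝ} (hx : ∀ s, HasDerivAt x (D s) s) (s : ℝ) :
    HasDerivAt (fun s => -x (-s)) (D (-s)) s := by
  have := ((hx (-s)).comp s (hasDerivAt_neg s)).neg
  rw [mul_neg_one, neg_neg] at this
  exact this

theorem tendsto_atBot_of_hasDerivAt {x D : ℝ → ℝ} (hx : ∀ s, HasDerivAt x (D s) s) {d : ℝ}
    (hd : 0 < d) (hD : Tendsto D atBot (𝓝 d)) : Tendsto x atBot atBot := by
  have h1 := tendsto_atTop_of_hasDerivAt (hasDerivAt_neg_comp_neg hx) hd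
    (hD.comp tendsto_neg_atTop_atBot)
  have h2 := tendsto_neg_atTop_atBot.comp (h1.comp tendsto_neg_atBot_atTop)
  refine h2.congr fun s => ?_
  simp

/-- Along a trajectory that tends to the origin, the change of variable has a finite limit. -/
theorem exists_tendsto_of_tendsto_zero {K : ℝ × ℝ} (hK : K ≠ 0) {p : ℝ → ℝ × ℝ} {x : ℝ → ℝ}
    (hp : ∀ s, 0 < s → HasDerivAt p (field K (p s)) s) (h0 : Tendsto p atTop (𝓝 0))
    (hx : ∀ s, HasDerivAt x (Delta (p s)) s) : ∃ l, Tendsto x atTop (𝓝 l) := by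
  set Λ := K.1 ^ 2 - K.1 * K.2 + K.2 ^ 2 with hΛ
  have hΛpos : 0 < Λ := by
    have h := Delta_pos (p := (K.1, -K.2)) (by
      intro h
      rw [Prod.ext_iff] at h
      exact hK (Prod.ext h.1 (neg_eq_zero.1 h.2)))
    rw [Delta_eq] at h
    simp only [hΛ]
    nlinarith
  set C := 2 * |K.2 - K.1| + |K.1 + K.2| with hC
  have hC0 : 0 ≤ C := by positivity
  -- In the ball of radius `δ` the cubic terms below are at most half of `Λ * |q|²`.
  set δ := Λ / (2 * (C + 1)) with hδ
  have hδpos : 0 < δ := by positivity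
  have hCδ : C * δ ≤ Λ / 2 := by
    rw [hδ, mul_div_assoc', div_le_div_iff₀ (by positivity) (by positivity)]
    nlinarith
  obtain ⟨N, hN⟩ := Metric.tendsto_atTop.1 h0 δ hδpos
  set N' := max N 1
  -- `V q = -⟨q, A q⟩` with `A` the linear part of the field. As `A² = Λ`, the linear flow gives `V'
  -- = -|A q|² - Λ |q|²`, and near the origin the full flow has `V' ≤ -(Λ / 3) Δ`. So `Λ / 3 * x + V
  -- (p)` decreases while `V (p)` tends to 0, which bounds `x` without any rate of decay of `p`.
  set V : ℝ × ℝ → ℝ := fun p =>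
    -((K.2 - K.1) * (p.2 ^ 2 - p.1 ^ 2) + (K.1 + K.2) * (p.1 * p.2)) with hV
  have hVd : ∀ s, 0 < s → HasDerivAt (fun s => V (p s))
      (-((K.2 - K.1) * (2 * (p s).2 * (field K (p s)).2 - 2 * (p s).1 * (field K (p s)).1) +
        (K.1 + K.2) * ((field K (p s)).1 * (p s).2 + (p s).1 * (field K (p s)).2))) s := by
    intro s hs
    have ha := hasDerivAt_fst (hp s hs)
    have hb := hasDerivAt_snd (hp s hs)
    have := ((((hb.pow 2).sub (ha.pow 2)).const_mul (K.2 - K.1)).add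
      ((ha.mul hb).const_mul (K.1 + K.2))).neg
    refine this.congr_deriv ?_
    simp
  have hineq : ∀ q : ℝ × ℝ, ‖q‖ ≤ δ →
      -((K.2 - K.1) * (2 * q.2 * (field K q).2 - 2 * q.1 * (field K q).1) +
        (K.1 + K.2) * ((field K q).1 * q.2 + q.1 * (field K q).2)) ≤ -(Λ / 3) * Delta q := by
    intro q hq
    have h1 : |q.1| ≤ δ := (norm_fst_le q).trans hq
    have h2 : |q.2| ≤ δ := (norm_snd_le q).trans hq
    set m := (K.1 - K.2) * q.1 + K.1 * q.2
    set n := (K.2 - K.1) * q.2 + K.2 * q.1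
    have e : -((K.2 - K.1) * (2 * q.2 * (field K q).2 - 2 * q.1 * (field K q).1) +
        (K.1 + K.2) * ((field K q).1 * q.2 + q.1 * (field K q).2)) =
        -(m ^ 2 + n ^ 2) - Λ * (q.1 ^ 2 + q.2 ^ 2) +
        (2 * (K.2 - K.1) * (q.2 ^ 3 - q.1 ^ 3) + (K.1 + K.2) * (q.1 * q.2 * (q.1 + q.2))) := by
      simp only [m, n, field, hΛ]; ring
    have c1 : 2 * (K.2 - K.1) * (q.2 ^ 3 - q.1 ^ 3) ≤
        2 * |K.2 - K.1| * (δ * (q.1 ^ 2 + q.2 ^ 2)) := by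
      refine (le_abs_self _).trans ?_
      rw [abs_mul, abs_mul, abs_two]
      refine mul_le_mul_of_nonneg_left ?_ (by positivity)
      have a1 := abs_le.1 h1
      have a2 := abs_le.1 h2
      rw [abs_le]
      constructor <;> nlinarith [sq_nonneg q.1, sq_nonneg q.2]
    have c2 : (K.1 + K.2) * (q.1 * q.2 * (q.1 + q.2)) ≤
        |K.1 + K.2| * (δ * (q.1 ^ 2 + q.2 ^ 2)) := by
      refine (le_abs_self _).trans ?_
      rw [abs_mul]
      refine mul_le_mul_of_nonneg_left ?_ (by positivity)
      have a3 : |q.1 * q.2| ≤ (q.1 ^ 2 + q.2 ^ 2) / 2 := by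
        rw [abs_le]
        constructor <;> nlinarith [sq_nonneg (q.1 + q.2), sq_nonneg (q.1 - q.2)]
      have a4 : |q.1 + q.2| ≤ 2 * δ := (abs_add_le _ _).trans (by linarith)
      rw [abs_mul]
      calc |q.1 * q.2| * |q.1 + q.2| ≤ (q.1 ^ 2 + q.2 ^ 2) / 2 * (2 * δ) :=
            mul_le_mul a3 a4 (abs_nonneg _) (by positivity)
        _ = _ := by ring
    have c3 : C * δ * (q.1 ^ 2 + q.2 ^ 2) ≤ Λ / 2 * (q.1 ^ 2 + q.2 ^ 2) :=
      mul_le_mul_of_nonneg_right hCδ (by positivity)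
    have c4 : Delta q ≤ 3 / 2 * (q.1 ^ 2 + q.2 ^ 2) := by
      rw [Delta_eq]; nlinarith [sq_nonneg (q.1 - q.2)]
    have c5 := mul_le_mul_of_nonneg_left c4 hΛpos.le
    rw [e]
    simp only [hC] at c3
    nlinarith [sq_nonneg m, sq_nonneg n]
  have hanti : AntitoneOn (fun s => Λ / 3 * x s + V (p s)) (Ici N') := by
    have hder : ∀ s, N' ≤ s → HasDerivAt (fun s => Λ / 3 * x s + V (p s)) _ s := fun s hs =>
      ((hx s).const_mul (Λ / 3)).add
        (hVd s (lt_of_lt_of_le one_pos ((le_max_right _ _).trans hs)))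
    refine antitoneOn_of_deriv_nonpos (convex_Ici N')
      (fun s hs => (hder s hs).continuousAt.continuousWithinAt)
      (fun s hs => (hder s (interior_subset hs)).differentiableAt.differentiableWithinAt) ?_
    intro s hs
    have hs' := interior_subset hs
    rw [(hder s hs').deriv]
    have h1 := hN s ((le_max_left _ _).trans hs')
    rw [dist_zero_right] at h1
    linarith [hineq (p s) h1.le]
  have hmono : Monotone x := monotone_of_deriv_nonneg (fun s => (hx s).differentiableAt) fun s => by
    rw [(hx s).deriv]
    by_cases h : p s = 0
    · simp [h, Delta_eq]
    · exact (Delta_pos h).le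
  have hVc : Continuous V := by simp only [hV]; fun_prop
  have hV0 : Tendsto (fun s => V (p s)) atTop (𝓝 0) := by
    have h : V 0 = 0 := by simp [hV]
    rw [← h]
    exact (hVc.tendsto 0).comp h0
  obtain ⟨N₂, hN₂⟩ := eventually_atTop.1 (hV0.eventually_const_lt (show (-1 : ℝ) < 0 by norm_num))
  have hbdd : BddAbove (range x) := by
    refine ⟨(Λ / 3 * x N' + V (p N') + 1) / (Λ / 3), ?_⟩
    rintro _ ⟨s, rfl⟩
    rw [le_div_iff₀ (by positivity)]
    set t := max s (max N' N₂)
    have h1 := hanti (self_mem_Ici) (show N' ≤ t from (le_max_left _ _).trans (le_max_right _ _))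
      ((le_max_left _ _).trans (le_max_right _ _))
    have h2 := hN₂ t ((le_max_right _ _).trans (le_max_right _ _))
    have h3 := mul_le_mul_of_nonneg_left (hmono (le_max_left s (max N' N₂))) (by positivity : 0 ≤ Λ / 3)
    simp only at h1
    linarith
  exact ⟨_, tendsto_atTop_ciSup hmono hbdd⟩

/-- A trajectory through a point other than the origin does not meet the origin. -/
theorem ne_zero_of_hasDerivAt {K : ℝ × ℝ} {p : ℝ → ℝ × ℝ}
    (hp : ∀ s, 0 ≤ s → HasDerivAt p (field K (p s)) s) (h0 : p 0 ≠ 0) {s : ℝ} (hs : 0 ≤ s) :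
    p s ≠ 0 := by
  intro hps
  have hc : ContinuousOn p (Icc 0 s) := fun t ht => (hp t ht.1).continuousAt.continuousWithinAt
  obtain ⟨B, hB⟩ := isCompact_Icc.exists_bound_of_continuousOn hc
  have hB0 : 0 ≤ B := (norm_nonneg _).trans (hB s ⟨hs, le_rfl⟩)
  obtain ⟨k, hk⟩ := ((contDiff_field K).contDiffOn (s := Metric.closedBall 0 B)).exists_lipschitzOnWith
    (by decide) (convex_closedBall _ _) (isCompact_closedBall _ _)
  -- Uniqueness backward in time from `s`, against the constant solution 0.
  have := ODE_solution_unique_of_mem_Icc_left (v := fun _ => field K) (f := p) (g := fun _ => 0)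
    (s := fun _ => Metric.closedBall 0 B) (K := k) (a := 0) (b := s)
    (fun t _ => hk) hc (fun t ht => (hp t ht.1.le).hasDerivWithinAt)
    (fun t ht => by simpa using hB t ⟨ht.1.le, ht.2⟩) continuousOn_const
    (fun t ht => by
      have : field K 0 = 0 := by simp [field]
      simpa [this] using! (hasDerivWithinAt_const t (Iic t) (0 : ℝ × ℝ)))
    (fun t _ => by simpa using hB0) hps
  exact h0 (this ⟨le_rfl, hs⟩)

/-! ### A Lyapunov function for `K₁ < 0 < K₂` -/

/-- The sum of the absolute values of the components in the second quadrant. -/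
def uu (p : ℝ × ℝ) : ℝ := p.2 - p.1

/-- The distance to the invariant value of `uu`, with `dy/ds = -y w`. -/
def yy (K p : ℝ × ℝ) : ℝ := 3 / 2 * (K.2 - K.1) - uu p

/-- The variable `w` with `du/ds = y w`. -/
def ww (K p : ℝ × ℝ) : ℝ := p.1 + p.2 - (K.1 + K.2) * uu p / (2 * yy K p)

/-- The potential, as a function of `y`. -/
def potential (K : ℝ × ℝ) (y : ℝ) : ℝ :=
  -y + 2 * (K.2 - K.1) * Real.log y + 3 * (K.2 - K.1) ^ 2 / 4 * y⁻¹ +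
    3 * (K.1 + K.2) ^ 2 / 4 *
      (y⁻¹ - (K.2 - K.1) * (y⁻¹) ^ 2 + (K.2 - K.1) ^ 2 / 4 * (y⁻¹) ^ 3)

/-- The Lyapunov function. -/
def energy (K p : ℝ × ℝ) : ℝ := ww K p ^ 2 / yy K p + potential K (yy K p)

/-- The derivative of the Lyapunov function along trajectories. -/
def energyRate (K p : ℝ × ℝ) : ℝ := -(2 * (K.1 + K.2) * uu p * ww K p ^ 2 / yy K p ^ 2)

/-- The derivative of `ww` along trajectories. -/
def wRate (K p : ℝ × ℝ) : ℝ :=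
  1 / 2 * (K.2 - K.1 - uu p) * uu p * (1 + 3 * (K.1 + K.2) ^ 2 / (4 * yy K p ^ 2)) -
    (K.1 + K.2) * uu p / yy K p * ww K p - ww K p ^ 2 / 2

theorem continuous_uu : Continuous uu := by unfold uu; fun_prop

theorem continuous_yy (K : ℝ × ℝ) : Continuous (yy K) := by unfold yy uu; fun_prop

theorem continuousAt_ww {K p : ℝ × ℝ} (h : yy K p ≠ 0) : ContinuousAt (ww K) p := by
  unfold ww
  have h1 := (continuous_yy K).continuousAt (x := p)
  have h2 := continuous_uu.continuousAt (x := p)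
  exact (by fun_prop : ContinuousAt (fun p : ℝ × ℝ => p.1 + p.2) p).sub
    ((h2.const_mul _).div (h1.const_mul 2) (by simpa using h))

/-- In terms of `u = 3 / 2 * (K.2 - K.1) - y` this is `u * (K.2 - K.1 - u)` times a positive factor.
For `K.1 < K.2` the well thus has its bottom at `u = K.2 - K.1`, the value at `K`, and a maximum at
`u = 0`, the value at the origin. -/
theorem hasDerivAt_potential (K : ℝ × ℝ) {y : ℝ} (hy : y ≠ 0) :
    HasDerivAt (potential K) (-((y - (K.2 - K.1) / 2) * (y - 3 / 2 * (K.2 - K.1)) *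
      (1 + 3 * (K.1 + K.2) ^ 2 / (4 * y ^ 2)) / y ^ 2)) y := by
  have hi := hasDerivAt_inv hy
  have hl := Real.hasDerivAt_log hy
  have h := (((hasDerivAt_id y).neg.add (hl.const_mul (2 * (K.2 - K.1)))).add
    (hi.const_mul (3 * (K.2 - K.1) ^ 2 / 4))).add
    (((hi.sub ((hi.pow 2).const_mul (K.2 - K.1))).add
      ((hi.pow 3).const_mul ((K.2 - K.1) ^ 2 / 4))).const_mul (3 * (K.1 + K.2) ^ 2 / 4))
  refine h.congr_deriv ?_
  norm_num
  field_simp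
  ring

theorem continuousAt_energy {K p : ℝ × ℝ} (h : yy K p ≠ 0) : ContinuousAt (energy K) p := by
  have h1 := (continuous_yy K).continuousAt (x := p)
  exact (((continuousAt_ww h).pow 2).div h1 h).add
    ((hasDerivAt_potential K h).continuousAt.comp h1)

theorem continuousAt_energyRate {K p : ℝ × ℝ} (h : yy K p ≠ 0) :
    ContinuousAt (energyRate K) p := by
  have h1 := (continuous_yy K).continuousAt (x := p)
  have h2 := continuous_uu.continuousAt (x := p)
  exact ((((h2.const_mul _).mul ((continuousAt_ww h).pow 2))).div (h1.pow 2)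
    (pow_ne_zero 2 h)).neg

theorem continuousAt_wRate {K p : ℝ × ℝ} (h : yy K p ≠ 0) : ContinuousAt (wRate K) p := by
  have h1 := (continuous_yy K).continuousAt (x := p)
  have h2 := continuous_uu.continuousAt (x := p)
  have h3 := continuousAt_ww h
  refine ContinuousAt.sub (ContinuousAt.sub (ContinuousAt.mul ?_ (continuousAt_const.add ?_))
    (((h2.const_mul _).div h1 h).mul h3)) ((h3.pow 2).div_const 2)
  · exact ((h2.const_sub (K.2 - K.1)).const_mul (1 / 2)).mul h2
  · exact continuousAt_const.div ((h1.pow 2).const_mul 4)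
      (mul_ne_zero four_ne_zero (pow_ne_zero 2 h))

section Trajectory

variable {K : ℝ × ℝ} {p : ℝ → ℝ × ℝ} {s : ℝ}

theorem hasDerivAt_uu (hp : HasDerivAt p (field K (p s)) s) (h : yy K (p s) ≠ 0) :
    HasDerivAt (fun s => uu (p s)) (yy K (p s) * ww K (p s)) s := by
  refine ((hasDerivAt_snd hp).sub (hasDerivAt_fst hp)).congr_deriv ?_
  unfold ww
  field_simp
  simp only [field, yy, uu]
  ring

theorem hasDerivAt_yy (hp : HasDerivAt p (field K (p s)) s) (h : yy K (p s) ≠ 0) :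
    HasDerivAt (fun s => yy K (p s)) (-(yy K (p s) * ww K (p s))) s :=
  (hasDerivAt_uu hp h).const_sub _

theorem hasDerivAt_ww (hp : HasDerivAt p (field K (p s)) s) (h : yy K (p s) ≠ 0) :
    HasDerivAt (fun s => ww K (p s)) (wRate K (p s)) s := by
  have hu := hasDerivAt_uu hp h
  have hy := hasDerivAt_yy hp h
  have hd := ((hasDerivAt_fst hp).add (hasDerivAt_snd hp)).sub
    ((hu.const_mul (K.1 + K.2)).div (hy.const_mul 2) (mul_ne_zero two_ne_zero h))
  refine hd.congr_deriv ?_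
  have e : (p s).1 + (p s).2 =
      ww K (p s) + (K.1 + K.2) * uu (p s) / (2 * yy K (p s)) := by simp [ww]
  have eu : uu (p s) = 3 / 2 * (K.2 - K.1) - yy K (p s) := by simp [yy]
  have e1 : (p s).1 = (ww K (p s) + (K.1 + K.2) * uu (p s) / (2 * yy K (p s)) - uu (p s)) / 2 := by
    rw [← e, uu]; ring
  have e2 : (p s).2 = (ww K (p s) + (K.1 + K.2) * uu (p s) / (2 * yy K (p s)) + uu (p s)) / 2 := by
    rw [← e, uu]; ring
  simp only [field, wRate]
  rw [e1, e2, eu]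
  generalize yy K (p s) = y at *
  generalize ww K (p s) = w at *
  field_simp
  ring

/-- The weight `1 / y` in the kinetic term cancels the `-w² / 2` of `wRate`, and the potential
cancels the part of `wRate` free of `w`. Only the friction, linear in `w`, survives. -/
theorem hasDerivAt_energy (hp : HasDerivAt p (field K (p s)) s) (h : yy K (p s) ≠ 0) :
    HasDerivAt (fun s => energy K (p s)) (energyRate K (p s)) s := by
  have hy := hasDerivAt_yy hp h
  have hw := hasDerivAt_ww hp h
  have hd := ((hw.pow 2).div hy h).add ((hasDerivAt_potential K h).comp s hy)
  refine hd.congr_deriv ?_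
  have eu : uu (p s) = 3 / 2 * (K.2 - K.1) - yy K (p s) := by simp [yy]
  simp only [energyRate, wRate, eu, Pi.pow_apply]
  generalize yy K (p s) = y at *
  generalize ww K (p s) = w at *
  push_cast
  field_simp
  ring

end Trajectory

/-! ### Invariant sublevel sets and convergence to `K` -/

theorem energyRate_nonpos {K p : ℝ × ℝ} (hK : 0 < K.1 + K.2) (hu : 0 ≤ uu p) :
    energyRate K p ≤ 0 := by
  unfold energyRate
  have : 0 ≤ 2 * (K.1 + K.2) * uu p * ww K p ^ 2 / yy K p ^ 2 := by positivity
  linarith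

/-- A sublevel set of the Lyapunov function in the strip. -/
def sublevel (K : ℝ × ℝ) (e : ℝ) : Set (ℝ × ℝ) := {p | 0 ≤ uu p ∧ 0 < yy K p ∧ energy K p ≤ e}

/-- The potential blows up as `y → 0`. The terms with `K.1 + K.2` form `y⁻¹` times a square, and
`log z ≤ z` at `z = S / (8 y)`, where `S = K.2 - K.1`, costs only a third of the term `3 S² / (4
y)`. -/
theorem potential_lower_bound {K : ℝ × ℝ} (hS : 0 < K.2 - K.1) {y : ℝ} (hy : 0 < y) :
    (K.2 - K.1) ^ 2 / (2 * y) + 2 * (K.2 - K.1) * Real.log ((K.2 - K.1) / 8) - y ≤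
      potential K y := by
  set S := K.2 - K.1 with hSdef
  have h1 : Real.log (S / 8 / y) ≤ S / 8 / y :=
    (Real.log_le_sub_one_of_pos (by positivity)).trans (by linarith)
  rw [Real.log_div (by positivity) hy.ne'] at h1
  have h2 : y⁻¹ - S * (y⁻¹) ^ 2 + S ^ 2 / 4 * (y⁻¹) ^ 3 = y⁻¹ * (1 - S / 2 * y⁻¹) ^ 2 := by ring
  have h3 : 0 ≤ 3 * (K.1 + K.2) ^ 2 / 4 * (y⁻¹ * (1 - S / 2 * y⁻¹) ^ 2) := by positivity
  unfold potential
  rw [← hSdef, h2]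
  have h4 : S ^ 2 / (2 * y) = S ^ 2 * y⁻¹ / 2 := by field_simp
  have h5 : S / 8 / y = S * y⁻¹ / 8 := by field_simp
  rw [h5] at h1
  rw [h4]
  nlinarith [mul_le_mul_of_nonneg_left h1 hS.le]

/-- The blow-up of the potential keeps `y` away from 0, which is the only singularity of the energy.
The kinetic term then bounds `w`, and with `u` confined to the strip this bounds `p`. -/
theorem isCompact_sublevel {K : ℝ × ℝ} (hS : 0 < K.2 - K.1) (e : ℝ) :
    IsCompact (sublevel K e) := by
  set S := K.2 - K.1 with hSdef
  set c := 2 * S * Real.log (S / 8) - 3 / 2 * S with hc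
  set Q := |e - c| + 1 with hQ
  have hQpos : 0 < Q := by positivity
  have hyle : ∀ p ∈ sublevel K e, yy K p ≤ 3 / 2 * S := fun p hp => by
    have := hp.1
    unfold yy; linarith
  have hkey : ∀ p ∈ sublevel K e, S ^ 2 / (2 * yy K p) + ww K p ^ 2 / yy K p ≤ Q := by
    intro p hp
    have h1 := potential_lower_bound hS hp.2.1
    have h2 := hp.2.2
    unfold energy at h2
    have h3 := le_abs_self (e - c)
    have h4 := hyle p hp
    simp only [hc, hQ] at *
    linarith
  set m := S ^ 2 / (2 * Q) with hm
  have hmpos : 0 < m := by positivity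
  have hym : ∀ p ∈ sublevel K e, m ≤ yy K p := by
    intro p hp
    have hy := hp.2.1
    have h1 := hkey p hp
    have h2 : 0 ≤ ww K p ^ 2 / yy K p := by positivity
    have h3 : S ^ 2 / (2 * yy K p) ≤ Q := by linarith
    rw [div_le_iff₀ (by positivity)] at h3
    rw [hm, div_le_iff₀ (by positivity)]
    linarith
  have hset : sublevel K e = {p | 0 ≤ uu p} ∩ ({p | m ≤ yy K p} ∩ energy K ⁻¹' Iic e) := by
    ext p
    constructor
    · intro hp
      exact ⟨hp.1, hym p hp, hp.2.2⟩
    · rintro ⟨h1, h2, h3⟩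
      exact ⟨h1, hmpos.trans_le h2, h3⟩
  have hclosed : IsClosed (sublevel K e) := by
    rw [hset]
    refine (isClosed_le continuous_const continuous_uu).inter ?_
    refine ContinuousOn.preimage_isClosed_of_isClosed (fun p hp => ?_)
      (isClosed_le continuous_const (continuous_yy K)) isClosed_Iic
    exact (continuousAt_energy (hmpos.trans_le hp).ne').continuousWithinAt
  set B := (Q * (3 / 2 * S) + 1) + |K.1 + K.2| * (3 / 2 * S) / (2 * m) + 3 / 2 * S with hB
  refine Metric.isCompact_of_isClosed_isBounded hclosed
    ((Metric.isBounded_closedBall (x := (0 : ℝ × ℝ)) (r := B)).subset fun p hp => ?_)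
  have hy := hp.2.1
  have hu0 := hp.1
  have hu1 : uu p ≤ 3 / 2 * S := by
    unfold yy at hy; linarith
  have hw : |ww K p| ≤ Q * (3 / 2 * S) + 1 := by
    have h1 := hkey p hp
    have h2 : 0 ≤ S ^ 2 / (2 * yy K p) := by positivity
    have h3 : ww K p ^ 2 / yy K p ≤ Q := by linarith
    rw [div_le_iff₀ hy] at h3
    have h4 := mul_le_mul_of_nonneg_left (hyle p hp) hQpos.le
    rw [← sq_abs] at h3
    nlinarith [abs_nonneg (ww K p)]
  have hv : |p.1 + p.2| ≤ (Q * (3 / 2 * S) + 1) + |K.1 + K.2| * (3 / 2 * S) / (2 * m) := by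
    have e1 : p.1 + p.2 = ww K p + (K.1 + K.2) * uu p / (2 * yy K p) := by simp [ww]
    rw [e1]
    refine (abs_add_le _ _).trans (add_le_add hw ?_)
    rw [abs_div, abs_mul, abs_of_nonneg hu0, abs_of_pos (by positivity : 0 < 2 * yy K p)]
    have := hym p hp
    gcongr
  have h1 := abs_le.1 hv
  unfold uu at hu0 hu1
  rw [mem_closedBall_zero_iff, Prod.norm_def, max_le_iff, Real.norm_eq_abs, Real.norm_eq_abs,
    abs_le, abs_le]
  refine ⟨⟨?_, ?_⟩, ?_, ?_⟩ <;> linarith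

/-- The value of the Lyapunov function at the origin. -/
def energyZero (K : ℝ × ℝ) : ℝ := potential K (3 / 2 * (K.2 - K.1))

/-- On `uu = 0` the potential already equals the level of the origin and the kinetic term is
nonnegative. Trajectories below that level therefore cannot leave through this edge. -/
theorem uu_pos_of_mem_sublevel {K p : ℝ × ℝ} {e : ℝ} (he : e < energyZero K)
    (hp : p ∈ sublevel K e) : 0 < uu p := by
  rcases hp.1.eq_or_lt with h | h
  · exfalso
    have h1 : yy K p = 3 / 2 * (K.2 - K.1) := by simp [yy, ← h]
    have h2 := hp.2.2
    have h3 := hp.2.1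
    have h4 : 0 ≤ ww K p ^ 2 / yy K p := by positivity
    unfold energy at h2
    unfold energyZero at he
    rw [h1] at h2 h4
    linarith
  · exact h

/-- A vector field truncated outside of a ball. -/
theorem exists_truncation (K : ℝ × ℝ) (R : ℝ) (hR : 0 ≤ R) :
    ∃ (f : ℝ × ℝ → ℝ × ℝ) (k L : NNReal), LipschitzWith k f ∧ (∀ p, ‖f p‖ ≤ L) ∧
      ∀ p, ‖p‖ ≤ R → f p = field K p := by
  have hR' : -R ≤ R := by linarith
  set c : ℝ × ℝ → ℝ × ℝ := fun p => (projIcc (-R) R hR' p.1, projIcc (-R) R hR' p.2) with hc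
  have hcR : ∀ p, c p ∈ Metric.closedBall (0 : ℝ × ℝ) R := by
    intro p
    rw [mem_closedBall_zero_iff, Prod.norm_def, max_le_iff, Real.norm_eq_abs, Real.norm_eq_abs,
      abs_le, abs_le]
    exact ⟨(projIcc (-R) R hR' p.1).2, (projIcc (-R) R hR' p.2).2⟩
  have hclip : LipschitzWith 1 c := by
    have h : LipschitzWith 1 fun z : ℝ => (projIcc (-R) R hR' z : ℝ) := LipschitzWith.projIcc hR'
    have := (h.comp (LipschitzWith.prod_fst (α := ℝ) (β := ℝ))).prodMk
      (h.comp (LipschitzWith.prod_snd (α := ℝ) (β := ℝ)))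
    simpa [hc, Function.comp_def] using this
  obtain ⟨k, hk⟩ := ((contDiff_field K).contDiffOn (s := Metric.closedBall 0 R)).exists_lipschitzOnWith
    (by decide) (convex_closedBall _ _) (isCompact_closedBall _ _)
  obtain ⟨L, hL⟩ := (isCompact_closedBall (0 : ℝ × ℝ) R).exists_bound_of_continuousOn
    (contDiff_field K).continuous.continuousOn
  have hL0 : 0 ≤ L := (norm_nonneg _).trans (hL _ (hcR 0))
  refine ⟨field K ∘ c, k, L.toNNReal, ?_, fun p => ?_, fun p hp => ?_⟩
  · rw [← lipschitzOnWith_univ] at hclip ⊢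
    have := hk.comp hclip (fun p _ => hcR p)
    rwa [mul_one] at this
  · rw [Real.coe_toNNReal _ hL0]
    exact hL _ (hcR p)
  · have h1 := (norm_fst_le p).trans hp
    have h2 := (norm_snd_le p).trans hp
    rw [Real.norm_eq_abs, abs_le] at h1 h2
    simp only [Function.comp, hc, projIcc_of_mem hR' h1, projIcc_of_mem hR' h2]

/-- Inside the strip the energy cannot increase, and neither edge can be reached: the level excludes
`uu = 0` and the potential excludes `yy = 0`. So the trajectory stays in a compact set and is
global. -/
theorem exists_forward_trajectory {K : ℝ × ℝ} (hS : 0 < K.2 - K.1) (hD : 0 < K.1 + K.2) {e : ℝ}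
    (he : e < energyZero K) {P : ℝ × ℝ} (hP : P ∈ sublevel K e) :
    ∃ p : ℝ → ℝ × ℝ, p 0 = P ∧ ∀ s, 0 ≤ s → HasDerivAt p (field K (p s)) s ∧ p s ∈ sublevel K e := by
  have hcomp := isCompact_sublevel hS e
  obtain ⟨R, hR⟩ := hcomp.isBounded.exists_norm_le
  have hR0 : 0 ≤ R := (norm_nonneg _).trans (hR P hP)
  -- The margin 1 makes the truncated field equal to `field K` in a neighbourhood of the sublevel
  -- set, as needed to continue past its boundary.
  obtain ⟨f, k, L, hf, hL, hfK⟩ := exists_truncation K (R + 1) (by linarith)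
  obtain ⟨p, hp0, hp⟩ := exists_global_solution hf hL P
  have hpc : Continuous p := continuous_iff_continuousAt.2 fun s => (hp s).continuousAt
  have hmem : ∀ s, 0 ≤ s → p s ∈ sublevel K e := by
    intro T hT
    have hsub : Icc 0 T ⊆ p ⁻¹' sublevel K e := by
      -- Continuous induction: the set of good times is closed and can be prolonged to the right
      -- from each of its points.
      refine IsClosed.Icc_subset_of_forall_mem_nhdsWithin ?_ ?_ ?_
      · exact (hcomp.isClosed.preimage hpc).inter isClosed_Icc
      · rw [mem_preimage, hp0]; exact hP
      · rintro s ⟨hs, -⟩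
        have e1 : ∀ᶠ t in 𝓝 s, 0 < uu (p t) :=
          (continuous_uu.comp hpc).continuousAt.eventually_const_lt (uu_pos_of_mem_sublevel he hs)
        have e2 : ∀ᶠ t in 𝓝 s, 0 < yy K (p t) :=
          ((continuous_yy K).comp hpc).continuousAt.eventually_const_lt hs.2.1
        have e3 : ∀ᶠ t in 𝓝 s, ‖p t‖ < R + 1 :=
          (continuous_norm.comp hpc).continuousAt.eventually_lt_const
            (by have := hR _ hs; simp only [Function.comp]; linarith)
        obtain ⟨δ, hδ, hball⟩ := Metric.eventually_nhds_iff_ball.1 (e1.and (e2.and e3))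
        have hmemI : Ioo s (s + δ) ∈ 𝓝[>] s := Ioo_mem_nhdsGT (by linarith)
        refine mem_of_superset hmemI fun t ht => ?_
        have hb : ∀ z, z ∈ Icc s t → 0 < uu (p z) ∧ 0 < yy K (p z) ∧ ‖p z‖ < R + 1 := by
          intro z hz
          refine hball z ?_
          rw [Metric.mem_ball, Real.dist_eq, abs_lt]
          constructor <;> linarith [hz.1, hz.2, ht.2]
        have hder : ∀ z ∈ Icc s t,
            HasDerivAt (fun z => energy K (p z)) (energyRate K (p z)) z := by
          intro z hz
          obtain ⟨b1, b2, b3⟩ := hb z hz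
          refine hasDerivAt_energy ?_ b2.ne'
          rw [← hfK _ b3.le]
          exact hp z
        have hanti : AntitoneOn (fun z => energy K (p z)) (Icc s t) := by
          refine antitoneOn_of_deriv_nonpos (convex_Icc s t)
            (fun z hz => (hder z hz).continuousAt.continuousWithinAt)
            (fun z hz => (hder z (interior_subset hz)).differentiableAt.differentiableWithinAt) ?_
          intro z hz
          rw [(hder z (interior_subset hz)).deriv]
          exact energyRate_nonpos hD (hb z (interior_subset hz)).1.le
        have hle := hanti ⟨le_rfl, ht.1.le⟩ ⟨ht.1.le, le_rfl⟩ ht.1.le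
        obtain ⟨b1, b2, -⟩ := hb t ⟨ht.1.le, le_rfl⟩
        exact ⟨b1.le, b2, hle.trans hs.2.2⟩
    exact hsub ⟨hT, le_rfl⟩
  refine ⟨p, hp0, fun s hs => ⟨?_, hmem s hs⟩⟩
  rw [← hfK _ (by have := hR _ (hmem s hs); linarith)]
  exact hp s

/-- On the compact part of `Ω` where `|Φ| ≥ ε`, the function `|F|` has a positive minimum. This
carries convergence from a quantity to anything that vanishes with it. -/
theorem tendsto_zero_of_compact {X : Type*} [TopologicalSpace X] [T2Space X] {Ω : Set X}
    (hΩ : IsCompact Ω) {F Φ : X → ℝ} (hF : ContinuousOn F Ω) (hΦ : ContinuousOn Φ Ω)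
    (h : ∀ q ∈ Ω, F q = 0 → Φ q = 0) {p : ℝ → X} (hp : ∀ s, 0 ≤ s → p s ∈ Ω)
    (hlim : Tendsto (fun s => F (p s)) atTop (𝓝 0)) :
    Tendsto (fun s => Φ (p s)) atTop (𝓝 0) := by
  rw [Metric.tendsto_atTop]
  intro ε hε
  set C := Ω ∩ (fun q => |Φ q|) ⁻¹' Ici ε with hCdef
  have hC : IsCompact C := hΩ.of_isClosed_subset
    (hΦ.abs.preimage_isClosed_of_isClosed hΩ.isClosed isClosed_Ici) inter_subset_left
  rcases C.eq_empty_or_nonempty with hCe | hCe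
  · refine ⟨0, fun s hs => ?_⟩
    rw [dist_zero_right, Real.norm_eq_abs]
    by_contra hlt
    have : p s ∈ C := ⟨hp s hs, not_lt.1 hlt⟩
    rw [hCe] at this
    exact this
  · obtain ⟨q, hq, hmin⟩ := hC.exists_isMinOn hCe (hF.mono inter_subset_left).abs
    have hqpos : 0 < |F q| := by
      rw [abs_pos]
      intro h0
      have h1 : ε ≤ |Φ q| := hq.2
      rw [h q hq.1 h0, abs_zero] at h1
      linarith
    obtain ⟨N, hN⟩ := Metric.tendsto_atTop.1 hlim _ hqpos
    refine ⟨max N 0, fun s hs => ?_⟩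
    have h1 := hN s ((le_max_left _ _).trans hs)
    rw [dist_zero_right, Real.norm_eq_abs] at h1 ⊢
    by_contra hlt
    have h2 : |F q| ≤ |F (p s)| :=
      hmin (show p s ∈ C from ⟨hp s ((le_max_right _ _).trans hs), not_lt.1 hlt⟩)
    linarith

/-- LaSalle's principle by two uses of Barbalat's lemma. The energy converges, so its rate and hence
`ww` tend to 0. Then `wRate`, the derivative of `ww`, tends to 0 too. In the sublevel set both
vanish only at `K`, since `uu > 0` excludes the origin. -/
theorem tendsto_of_mem_sublevel {K : ℝ × ℝ} (hS : 0 < K.2 - K.1) (hD : 0 < K.1 + K.2) {e : ℝ}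
    (he : e < energyZero K) {p : ℝ → ℝ × ℝ}
    (hp : ∀ s, 0 ≤ s → HasDerivAt p (field K (p s)) s ∧ p s ∈ sublevel K e) :
    Tendsto p atTop (𝓝 K) := by
  have hΩ := isCompact_sublevel hS e
  have hmem : ∀ s, 0 ≤ s → p s ∈ sublevel K e := fun s hs => (hp s hs).2
  have hy : ∀ q ∈ sublevel K e, yy K q ≠ 0 := fun q hq => hq.2.1.ne'
  have cE : ContinuousOn (energy K) (sublevel K e) := fun q hq =>
    (continuousAt_energy (hy q hq)).continuousWithinAt
  have cER : ContinuousOn (energyRate K) (sublevel K e) := fun q hq =>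
    (continuousAt_energyRate (hy q hq)).continuousWithinAt
  have cw : ContinuousOn (ww K) (sublevel K e) := fun q hq =>
    (continuousAt_ww (hy q hq)).continuousWithinAt
  have cwR : ContinuousOn (wRate K) (sublevel K e) := fun q hq =>
    (continuousAt_wRate (hy q hq)).continuousWithinAt
  obtain ⟨B, hB⟩ := hΩ.exists_bound_of_continuousOn (contDiff_field K).continuous.continuousOn
  have hB0 : 0 ≤ B := (norm_nonneg _).trans (hB _ (hmem 0 le_rfl))
  have hlip : LipschitzOnWith B.toNNReal p (Ici 0) :=
    Convex.lipschitzOnWith_of_nnnorm_hasDerivWithin_le (convex_Ici 0)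
      (fun s hs => (hp s hs).1.hasDerivWithinAt)
      (fun s hs => by
        rw [← NNReal.coe_le_coe, coe_nnnorm, Real.coe_toNNReal _ hB0]
        exact hB _ (hmem s hs))
  have hE : ∀ s, 0 ≤ s → HasDerivAt (fun s => energy K (p s)) (energyRate K (p s)) s := fun s hs =>
    hasDerivAt_energy (hp s hs).1 (hy _ (hmem s hs))
  have hEanti : AntitoneOn (fun s => energy K (p s)) (Ici 0) := by
    refine antitoneOn_of_deriv_nonpos (convex_Ici 0)
      (fun z hz => (hE z hz).continuousAt.continuousWithinAt)
      (fun z hz => (hE z (interior_subset hz)).differentiableAt.differentiableWithinAt) ?_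
    intro z hz
    rw [(hE z (interior_subset hz)).deriv]
    exact energyRate_nonpos hD (hmem z (interior_subset hz)).1
  obtain ⟨l, hl⟩ : ∃ l, Tendsto (fun s => energy K (p s)) atTop (𝓝 l) := by
    obtain ⟨b, hb⟩ := hΩ.exists_bound_of_continuousOn cE
    have hanti : Antitone fun s => energy K (p (max s 0)) := fun s t hst =>
      hEanti (le_max_right s 0) (le_max_right t 0) (max_le_max_right 0 hst)
    have hbdd : BddBelow (range fun s => energy K (p (max s 0))) := by
      refine ⟨-b, ?_⟩
      rintro _ ⟨s, rfl⟩
      exact (abs_le.1 (hb _ (hmem _ (le_max_right s 0)))).1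
    refine ⟨_, (tendsto_atTop_ciInf hanti hbdd).congr' ?_⟩
    filter_upwards [eventually_ge_atTop 0] with s hs
    rw [max_eq_left hs]
  have h1 := tendsto_zero_of_hasDerivAt hΩ cER hlip hmem (fun s hs => hE s hs.le) hl
  have h2 : Tendsto (fun s => ww K (p s)) atTop (𝓝 0) := by
    refine tendsto_zero_of_compact hΩ cER cw (fun q hq h0 => ?_) hmem h1
    have hu := uu_pos_of_mem_sublevel he hq
    have hyq := hy q hq
    unfold energyRate at h0
    rw [neg_eq_zero, div_eq_zero_iff] at h0
    rcases h0 with h0 | h0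
    · have : 2 * (K.1 + K.2) * uu q ≠ 0 := by positivity
      simpa using (mul_eq_zero.1 h0).resolve_left this
    · exact absurd h0 (pow_ne_zero 2 hyq)
  have h3 := tendsto_zero_of_hasDerivAt hΩ cwR hlip hmem
    (fun s hs => hasDerivAt_ww (hp s hs.le).1 (hy _ (hmem s hs.le))) h2
  have h4 : Tendsto (fun s => wRate K (p s) ^ 2 + ww K (p s) ^ 2) atTop (𝓝 0) := by
    simpa using (h3.pow 2).add (h2.pow 2)
  have h5 : Tendsto (fun s => ‖p s - K‖) atTop (𝓝 0) := by
    refine tendsto_zero_of_compact (F := fun q => wRate K q ^ 2 + ww K q ^ 2)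
      (Φ := fun q => ‖q - K‖) hΩ ((cwR.pow 2).add (cw.pow 2)) (by fun_prop)
      (fun q hq h0 => ?_) hmem h4
    have hw : ww K q = 0 := by
      have := sq_nonneg (wRate K q)
      have := sq_nonneg (ww K q)
      exact pow_eq_zero_iff two_ne_zero |>.1 (by linarith)
    have hr : wRate K q = 0 := by
      rw [hw] at h0
      simpa using h0
    have hu := uu_pos_of_mem_sublevel he hq
    have hyq := hq.2.1
    unfold wRate at hr
    rw [hw] at hr
    simp only [mul_zero, sub_zero, ne_eq, OfNat.ofNat_ne_zero, not_false_eq_true, zero_pow,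
      zero_div] at hr
    have hpos : 0 < 1 + 3 * (K.1 + K.2) ^ 2 / (4 * yy K q ^ 2) := by positivity
    have huS : uu q = K.2 - K.1 := by
      have := (mul_eq_zero.1 hr).resolve_right hpos.ne'
      have := (mul_eq_zero.1 this).resolve_right hu.ne'
      linarith
    have hyS : yy K q = (K.2 - K.1) / 2 := by unfold yy; rw [huS]; ring
    unfold ww at hw
    rw [hyS, huS] at hw
    have e : (K.1 + K.2) * (K.2 - K.1) / (2 * ((K.2 - K.1) / 2)) = K.1 + K.2 := by
      field_simp
    rw [e] at hw
    unfold uu at huS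
    rw [norm_eq_zero, sub_eq_zero]
    exact Prod.ext (by linarith) (by linarith)
  exact tendsto_iff_norm_sub_tendsto_zero.2 h5

/-! ### Points below the energy level of the origin -/

/-- Points of the antidiagonal near the origin lie strictly below the level of the origin. -/
theorem energy_antidiagonal_lt {K : ℝ × ℝ} (h1 : K.1 < 0) (hD : 0 < K.1 + K.2) {P : ℝ × ℝ}
    (hP : P.1 + P.2 = 0) (hP0 : 0 < P.2) (hPS : P.2 ≤ (K.2 - K.1) / 4) :
    0 < uu P ∧ 0 < yy K P ∧ energy K P < energyZero K := by
  have h2 : 0 < K.2 := by linarith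
  have hS : 0 < K.2 - K.1 := by linarith
  have hu : uu P = 2 * P.2 := by unfold uu; linarith
  have hyP : yy K P = 3 / 2 * (K.2 - K.1) - uu P := rfl
  -- The energy on the antidiagonal as a function of `u = uu P`. It decreases on `[0, (K.2 - K.1) /
  -- 2]`, and the bound on `P.2` puts `uu P = 2 * P.2` there.
  set Z : ℝ → ℝ := fun u => ((K.1 + K.2) * u / (2 * (3 / 2 * (K.2 - K.1) - u))) ^ 2 /
    (3 / 2 * (K.2 - K.1) - u) + potential K (3 / 2 * (K.2 - K.1) - u) with hZ
  have hder : ∀ u ∈ Icc 0 ((K.2 - K.1) / 2), HasDerivAt Z (u * ((K.1 + K.2) ^ 2 * u /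
      (3 / 2 * (K.2 - K.1) - u) ^ 4 + (u - (K.2 - K.1)) / (3 / 2 * (K.2 - K.1) - u) ^ 2)) u := by
    intro u hu
    have hy : 3 / 2 * (K.2 - K.1) - u ≠ 0 := by linarith [hu.2]
    have hyd : HasDerivAt (fun u => 3 / 2 * (K.2 - K.1) - u) (-1) u :=
      (hasDerivAt_id u).const_sub _
    have hd := ((((hasDerivAt_id u).const_mul (K.1 + K.2)).div (hyd.const_mul 2)
      (mul_ne_zero two_ne_zero hy)).pow 2).div hyd hy
    refine (hd.add ((hasDerivAt_potential K hy).comp u hyd)).congr_deriv ?_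
    simp only [id, Pi.div_apply, Pi.pow_apply]
    have eu : u = 3 / 2 * (K.2 - K.1) - (3 / 2 * (K.2 - K.1) - u) := by ring
    generalize 3 / 2 * (K.2 - K.1) - u = y at *
    rw [eu]
    push_cast
    field_simp
    ring
  have hanti : StrictAntiOn Z (Icc 0 ((K.2 - K.1) / 2)) := by
    refine strictAntiOn_of_deriv_neg (convex_Icc _ _)
      (fun u hu => (hder u hu).continuousAt.continuousWithinAt) fun u hu => ?_
    rw [(hder u (interior_subset hu)).deriv]
    rw [interior_Icc] at hu
    have hy : K.2 - K.1 < 3 / 2 * (K.2 - K.1) - u := by linarith [hu.2]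
    set y := 3 / 2 * (K.2 - K.1) - u with hydef
    have hy0 : 0 < y := by linarith
    refine mul_neg_of_pos_of_neg hu.1 ?_
    have e : (K.1 + K.2) ^ 2 * u / y ^ 4 + (u - (K.2 - K.1)) / y ^ 2 =
        ((K.1 + K.2) ^ 2 * u - (K.2 - K.1 - u) * y ^ 2) / y ^ 4 := by
      field_simp; ring
    rw [e]
    refine div_neg_of_neg_of_pos ?_ (by positivity)
    -- `K.1 < 0` enters here: `K.1 + K.2 < K.2 - K.1 < y`. With `u < K.2 - K.1 - u` the potential
    -- beats the kinetic term.
    have hDy : (K.1 + K.2) ^ 2 < y ^ 2 := by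
      apply sq_lt_sq'
      · linarith
      · linarith
    have hu1 := hu.1
    have hu2 := hu.2
    nlinarith [mul_lt_mul_of_pos_right hDy hu1, sq_nonneg y,
      mul_nonneg (show 0 ≤ K.2 - K.1 - 2 * u by linarith) (sq_nonneg y)]
  have hlt := hanti ⟨le_rfl, by linarith⟩ (show uu P ∈ Icc 0 ((K.2 - K.1) / 2) from
    ⟨by linarith, by linarith⟩) (by linarith : 0 < uu P)
  refine ⟨by linarith, by linarith, ?_⟩
  have e0 : Z 0 = energyZero K := by simp [hZ, energyZero]
  have eP : Z (uu P) = energy K P := by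
    simp only [hZ, energy, ww, hP, ← hyP]
    ring
  rw [← e0, ← eP]
  exact hlt

/-- A trajectory that leaves the origin into the strip has a smaller energy than the origin. -/
theorem energy_lt_of_tendsto_atBot {K : ℝ × ℝ} (hS : 0 < K.2 - K.1) (hD : 0 < K.1 + K.2)
    {p : ℝ → ℝ × ℝ} (hp : ∀ s, s ≤ 0 → HasDerivAt p (field K (p s)) s)
    (h0 : Tendsto p atBot (𝓝 0)) (hu : ∀ s, s ≤ 0 → 0 < uu (p s))
    (hy : ∀ s, s ≤ 0 → 0 < yy K (p s)) (hw : ∀ s, s ≤ 0 → ww K (p s) ≠ 0) :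
    energy K (p 0) < energyZero K := by
  have hE : ∀ s, s ≤ 0 → HasDerivAt (fun s => energy K (p s)) (energyRate K (p s)) s := fun s hs =>
    hasDerivAt_energy (hp s hs) (hy s hs).ne'
  have hanti : StrictAntiOn (fun s => energy K (p s)) (Iic 0) := by
    refine strictAntiOn_of_deriv_neg (convex_Iic _)
      (fun u hu => (hE u hu).continuousAt.continuousWithinAt) fun s hs => ?_
    have hs' := interior_subset hs
    rw [(hE s hs').deriv]
    unfold energyRate
    have := hu s hs'
    have := hy s hs'
    have := hw s hs'
    have : 0 < 2 * (K.1 + K.2) * uu (p s) * ww K (p s) ^ 2 / yy K (p s) ^ 2 := by positivity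
    linarith
  have hlim : Tendsto (fun s => energy K (p s)) atBot (𝓝 (energyZero K)) := by
    have hy0 : yy K 0 ≠ 0 := by simp [yy, uu]; linarith
    have e : energy K 0 = energyZero K := by simp [energy, energyZero, ww, yy, uu]
    rw [← e]
    exact (continuousAt_energy hy0).tendsto.comp h0
  -- Passing to the limit loses strictness. The strict decrease between `-1` and 0 restores it.
  have h1 : energy K (p (-1)) ≤ energyZero K := by
    refine ge_of_tendsto hlim ?_
    filter_upwards [eventually_le_atBot (-1)] with s hs
    exact hanti.antitoneOn (show s ≤ 0 by linarith) (show (-1 : ℝ) ≤ 0 by norm_num) hs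
  exact (hanti (show (-1 : ℝ) ≤ 0 by norm_num) (show (0 : ℝ) ≤ 0 from le_rfl) (by norm_num)).trans_le h1

/-! ### The unstable curve of the origin as a power series in `exp (λ s)` -/

/-- The linear part of the vector field at the origin. -/
def lin (K : ℝ × ℝ) : (ℝ × ℝ) →L[ℝ] (ℝ × ℝ) :=
  ((K.1 - K.2) • ContinuousLinearMap.fst ℝ ℝ ℝ + K.1 • ContinuousLinearMap.snd ℝ ℝ ℝ).prod
    (K.2 • ContinuousLinearMap.fst ℝ ℝ ℝ + (K.2 - K.1) • ContinuousLinearMap.snd ℝ ℝ ℝ)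

@[simp] theorem lin_fst (K p : ℝ × ℝ) : (lin K p).1 = (K.1 - K.2) * p.1 + K.1 * p.2 := by simp [lin]
@[simp] theorem lin_snd (K p : ℝ × ℝ) : (lin K p).2 = K.2 * p.1 + (K.2 - K.1) * p.2 := by simp [lin]

theorem field_eq_lin_sub (K p : ℝ × ℝ) : field K p = lin K p - p * p := by
  ext <;> simp [field] <;> ring

/-- The square of the eigenvalues of the linear part. -/
def eigSq (K : ℝ × ℝ) : ℝ := K.1 ^ 2 - K.1 * K.2 + K.2 ^ 2

/-- The positive eigenvalue of the linear part. -/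
def eig (K : ℝ × ℝ) : ℝ := √(eigSq K)

/-- The solution `c` of `(μ - lin K) c = -q`. -/
def resolve (K : ℝ × ℝ) (μ : ℝ) (q : ℝ × ℝ) : ℝ × ℝ :=
  -((μ ^ 2 - eigSq K)⁻¹ • (μ • q + lin K q))

/-- `lin K` has trace 0 and square `eigSq K`, so `(μ - A)⁻¹ = (μ² - eigSq K)⁻¹ (μ + A)` for `A = lin
K`. -/
theorem resolve_spec {K : ℝ × ℝ} {μ : ℝ} (h : μ ^ 2 - eigSq K ≠ 0) (q : ℝ × ℝ) :
    μ • resolve K μ q = lin K (resolve K μ q) - q := by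
  have hi := inv_mul_cancel₀ h
  generalize hd : (μ ^ 2 - eigSq K)⁻¹ = d at hi
  unfold eigSq at hi
  ext
  · simp only [resolve, hd, Prod.smul_fst, Prod.fst_neg, Prod.fst_add, Prod.fst_sub, lin_fst,
      Prod.snd_neg, Prod.smul_snd, Prod.snd_add, lin_snd, smul_eq_mul]
    linear_combination (-q.1) * hi
  · simp only [resolve, hd, Prod.smul_fst, Prod.fst_neg, Prod.fst_add, Prod.snd_sub, lin_fst,
      Prod.snd_neg, Prod.smul_snd, Prod.snd_add, lin_snd, smul_eq_mul]
    linear_combination (-q.2) * hi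

/-- The coefficients of the power series of the unstable curve with tangent vector `c`. -/
def coeff (K c : ℝ × ℝ) : ℕ → ℝ × ℝ
  | 0 => c
  | n + 1 => resolve K ((n + 2) * eig K) (∑ k : Fin (n + 1), coeff K c k * coeff K c (n - k))
decreasing_by all_goals omega

theorem coeff_succ (K c : ℝ × ℝ) (n : ℕ) : coeff K c (n + 1) = resolve K ((n + 2) * eig K)
    (∑ k ∈ Finset.range (n + 1), coeff K c k * coeff K c (n - k)) := by
  rw [coeff, Finset.sum_range fun k => coeff K c k * coeff K c (n - k)]

theorem eig_sq {K : ℝ × ℝ} (hK : 0 < eigSq K) : eig K ^ 2 = eigSq K := Real.sq_sqrt hK.le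

theorem eig_pos {K : ℝ × ℝ} (hK : 0 < eigSq K) : 0 < eig K := Real.sqrt_pos.2 hK

/-- The bound is uniform in `n` because `n + 2 ≤ (n + 2)² - 1`. There is no resonance at the
multiples `n + 2 ≥ 2` of the eigenvalue. -/
theorem norm_resolve_le {K : ℝ × ℝ} (hK : 0 < eigSq K) (n : ℕ) (q : ℝ × ℝ) :
    ‖resolve K ((n + 2) * eig K) q‖ ≤ (eig K + ‖lin K‖) / eigSq K * ‖q‖ := by
  have hpos := eig_pos hK
  have hn : (0 : ℝ) ≤ n := n.cast_nonneg
  have e : ((n + 2) * eig K) ^ 2 - eigSq K = ((n + 2) ^ 2 - 1) * eigSq K := by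
    rw [mul_pow, eig_sq hK]; ring
  have hn2 : (n + 2 : ℝ) ≤ (n + 2) ^ 2 - 1 := by nlinarith
  have h1 : ‖((n + 2) * eig K) • q + lin K q‖ ≤ (n + 2) * (eig K + ‖lin K‖) * ‖q‖ := by
    refine (norm_add_le _ _).trans ?_
    rw [norm_smul, Real.norm_eq_abs, abs_of_pos (by positivity)]
    have h2 := (lin K).le_opNorm q
    have h3 : 0 ≤ ‖lin K‖ * ‖q‖ := by positivity
    nlinarith
  unfold resolve
  rw [norm_neg, norm_smul, e, norm_inv, Real.norm_eq_abs, abs_of_pos (by nlinarith)]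
  rw [inv_mul_le_iff₀ (by nlinarith)]
  refine h1.trans ?_
  have h4 : ((n + 2 : ℝ) ^ 2 - 1) * eigSq K * ((eig K + ‖lin K‖) / eigSq K * ‖q‖) =
      ((n + 2 : ℝ) ^ 2 - 1) * ((eig K + ‖lin K‖) * ‖q‖) := by field_simp
  rw [h4, mul_assoc]
  exact mul_le_mul_of_nonneg_right hn2 (by positivity)

/-- A majorant argument: the partial sums `σ` satisfy `σ_{N+1} ≤ ‖c‖ + C σ_N²`, and `2 * ‖c‖` is
preserved by this iteration when `4 * C * ‖c‖ ≤ 1`. -/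
theorem sum_norm_coeff_le {K c : ℝ × ℝ} (hK : 0 < eigSq K)
    (hc : 4 * ((eig K + ‖lin K‖) / eigSq K) * ‖c‖ ≤ 1) (N : ℕ) :
    ∑ n ∈ Finset.range N, ‖coeff K c n‖ ≤ 2 * ‖c‖ := by
  set C := (eig K + ‖lin K‖) / eigSq K with hC
  have hC0 : 0 ≤ C := by have := eig_pos hK; positivity
  induction N with
  | zero => simp
  | succ N ih =>
    rw [Finset.sum_range_succ']
    have h0 : coeff K c 0 = c := by rw [coeff]
    have h1 : ∀ n, ‖coeff K c (n + 1)‖ ≤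
        C * ∑ k ∈ Finset.range (n + 1), ‖coeff K c k‖ * ‖coeff K c (n - k)‖ := by
      intro n
      rw [coeff_succ]
      refine (norm_resolve_le hK n _).trans (mul_le_mul_of_nonneg_left ?_ hC0)
      exact (norm_sum_le _ _).trans (Finset.sum_le_sum fun k _ => norm_mul_le _ _)
    have h2 : ∑ n ∈ Finset.range N, ‖coeff K c (n + 1)‖ ≤
        C * (∑ n ∈ Finset.range N, ‖coeff K c n‖) ^ 2 := by
      refine (Finset.sum_le_sum fun n _ => h1 n).trans ?_
      rw [← Finset.mul_sum]
      refine mul_le_mul_of_nonneg_left ?_ hC0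
      rw [Finset.sum_range_diag_flip N fun j k => ‖coeff K c j‖ * ‖coeff K c k‖, sq,
        Finset.sum_mul_sum]
      refine Finset.sum_le_sum fun m _ => ?_
      refine Finset.sum_le_sum_of_subset_of_nonneg ?_ fun _ _ _ => by positivity
      exact Finset.range_mono (Nat.sub_le _ _)
    have h3 : (∑ n ∈ Finset.range N, ‖coeff K c n‖) ^ 2 ≤ (2 * ‖c‖) ^ 2 :=
      pow_le_pow_left₀ (Finset.sum_nonneg fun _ _ => norm_nonneg _) ih 2
    have h4 := mul_le_mul_of_nonneg_left h3 hC0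
    rw [h0]
    nlinarith [norm_nonneg c]

/-- The curve with the coefficients `coeff`. -/
def unstableCurve (K c : ℝ × ℝ) (s : ℝ) : ℝ × ℝ :=
  ∑' n : ℕ, Real.exp ((n + 1) * eig K * s) • coeff K c n

theorem summable_norm_coeff {K c : ℝ × ℝ} (hK : 0 < eigSq K)
    (hc : 4 * ((eig K + ‖lin K‖) / eigSq K) * ‖c‖ ≤ 1) :
    Summable fun n => ‖coeff K c n‖ :=
  summable_of_sum_range_le (fun _ => norm_nonneg _) (sum_norm_coeff_le hK hc)

theorem summable_norm_smul_coeff {K c : ℝ × ℝ} (hK : 0 < eigSq K)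
    (hc : 4 * ((eig K + ‖lin K‖) / eigSq K) * ‖c‖ ≤ 1)
    {s : ℝ} (hs : s ≤ 0) :
    Summable fun n : ℕ => ‖Real.exp ((n + 1) * eig K * s) • coeff K c n‖ := by
  refine (summable_norm_coeff hK hc).of_nonneg_of_le (fun _ => norm_nonneg _) fun n => ?_
  rw [norm_smul, Real.norm_eq_abs, abs_of_pos (Real.exp_pos _)]
  refine mul_le_of_le_one_left (norm_nonneg _) (Real.exp_le_one_iff.2 ?_)
  exact mul_nonpos_of_nonneg_of_nonpos (by have := eig_pos hK; positivity) hs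

/-- All terms after the first carry at least `exp (2 λ s)`. This yields the tangent direction `c` at
the origin. -/
theorem norm_unstableCurve_sub_le {K c : ℝ × ℝ} (hK : 0 < eigSq K)
    (hc : 4 * ((eig K + ‖lin K‖) / eigSq K) * ‖c‖ ≤ 1)
    {s : ℝ} (hs : s ≤ 0) :
    ‖unstableCurve K c s - Real.exp (eig K * s) • c‖ ≤
      2 * ‖c‖ * (Real.exp (eig K * s) * Real.exp (eig K * s)) := by
  have hsum := summable_norm_smul_coeff hK hc hs
  have h0 : coeff K c 0 = c := by rw [coeff]
  have hpos := eig_pos hK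
  unfold unstableCurve
  rw [hsum.of_norm.tsum_eq_zero_add, h0]
  simp only [Nat.cast_zero, zero_add, one_mul, add_sub_cancel_left]
  have hs1 := (summable_nat_add_iff 1).2 hsum
  refine (norm_tsum_le_tsum_norm hs1).trans ?_
  have hs2 := (summable_nat_add_iff 1).2 (summable_norm_coeff hK hc)
  have hle : ∑' n : ℕ, ‖coeff K c (n + 1)‖ ≤ 2 * ‖c‖ := by
    refine hs2.tsum_le_of_sum_range_le fun N => ?_
    have := sum_norm_coeff_le hK hc (N + 1)
    rw [Finset.sum_range_succ'] at this
    linarith [norm_nonneg (coeff K c 0)]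
  calc ∑' n : ℕ, ‖Real.exp (((n + 1 : ℕ) + 1) * eig K * s) • coeff K c (n + 1)‖
      ≤ ∑' n : ℕ, ‖coeff K c (n + 1)‖ * (Real.exp (eig K * s) * Real.exp (eig K * s)) := by
        refine hs1.tsum_le_tsum (fun n => ?_) (hs2.mul_right _)
        rw [norm_smul, Real.norm_eq_abs, abs_of_pos (Real.exp_pos _), mul_comm, ← Real.exp_add]
        refine mul_le_mul_of_nonneg_left (Real.exp_le_exp.2 ?_) (norm_nonneg _)
        push_cast
        have : (n : ℝ) * (eig K * s) ≤ 0 :=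
          mul_nonpos_of_nonneg_of_nonpos n.cast_nonneg (mul_nonpos_of_nonneg_of_nonpos hpos.le hs)
        linarith
    _ = (∑' n : ℕ, ‖coeff K c (n + 1)‖) * (Real.exp (eig K * s) * Real.exp (eig K * s)) :=
        tsum_mul_right
    _ ≤ _ := mul_le_mul_of_nonneg_right hle (by positivity)

theorem coeff_recursion {K c : ℝ × ℝ} (hK : 0 < eigSq K) (n : ℕ) :
    ((n + 2) * eig K) • coeff K c (n + 1) = lin K (coeff K c (n + 1)) -
      ∑ k ∈ Finset.range (n + 1), coeff K c k * coeff K c (n - k) := by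
  rw [coeff_succ]
  refine resolve_spec ?_ _
  rw [mul_pow, eig_sq hK]
  have hn : (0 : ℝ) ≤ n := n.cast_nonneg
  nlinarith [mul_nonneg hn hK.le]

theorem hasDerivAt_exp_mul (m s : ℝ) :
    HasDerivAt (fun s => Real.exp (m * s)) (m * Real.exp (m * s)) s := by
  have := ((hasDerivAt_id s).const_mul m).exp
  simp only [id, mul_one] at this
  rwa [mul_comm] at this

/-- A bound independent of `m`, which allows termwise differentiation of the series on `Iio (s / 2)`
using only the summability of the coefficients. -/
theorem mul_exp_mul_le {m s y : ℝ} (hm : 0 < m) (hs : s < 0) (hy : y ≤ s / 2) :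
    m * Real.exp (m * y) ≤ 2 / -s := by
  have h1 : m * (-s / 2) * Real.exp (m * y) ≤ 1 := by
    have h2 := Real.add_one_le_exp (m * (-s / 2))
    have h3 : Real.exp (m * y) ≤ Real.exp (m * (s / 2)) :=
      Real.exp_le_exp.2 (mul_le_mul_of_nonneg_left hy hm.le)
    have h4 : Real.exp (m * (-s / 2)) * Real.exp (m * (s / 2)) = 1 := by
      rw [← Real.exp_add]; ring_nf; simp
    have h5 : 0 < m * (-s / 2) := mul_pos hm (by linarith)
    calc m * (-s / 2) * Real.exp (m * y) ≤ Real.exp (m * (-s / 2)) * Real.exp (m * (s / 2)) :=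
          mul_le_mul (by linarith) h3 (Real.exp_pos _).le (Real.exp_pos _).le
      _ = 1 := h4
  rw [le_div_iff₀ (by linarith)]
  linarith

theorem hasDerivAt_unstableCurve_tsum {K c : ℝ × ℝ} (hK : 0 < eigSq K)
    (hc : 4 * ((eig K + ‖lin K‖) / eigSq K) * ‖c‖ ≤ 1) {s : ℝ} (hs : s < 0) :
    HasDerivAt (unstableCurve K c) (∑' n : ℕ,
      ((n + 1) * eig K * Real.exp ((n + 1) * eig K * s)) • coeff K c n) s := by
  have hpos := eig_pos hK
  have hu : Summable fun n => (2 / -s) * ‖coeff K c n‖ := (summable_norm_coeff hK hc).mul_left _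
  have hg : ∀ (n : ℕ) (y : ℝ), y ∈ Iio (s / 2) →
      HasDerivAt (fun y => Real.exp ((n + 1) * eig K * y) • coeff K c n)
        (((n + 1) * eig K * Real.exp ((n + 1) * eig K * y)) • coeff K c n) y :=
    fun n y _ => (hasDerivAt_exp_mul _ y).smul_const _
  have hg' : ∀ (n : ℕ) (y : ℝ), y ∈ Iio (s / 2) →
      ‖((n + 1) * eig K * Real.exp ((n + 1) * eig K * y)) • coeff K c n‖ ≤
        (2 / -s) * ‖coeff K c n‖ := by
    intro n y hy
    rw [norm_smul, Real.norm_eq_abs, abs_of_pos (by positivity)]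
    exact mul_le_mul_of_nonneg_right (mul_exp_mul_le (by positivity) hs (le_of_lt hy))
      (norm_nonneg _)
  have hs' : s ∈ Iio (s / 2) := show s < s / 2 by linarith
  exact hasDerivAt_tsum_of_isPreconnected hu isOpen_Iio isPreconnected_Iio hg hg' hs'
    (summable_norm_smul_coeff hK hc hs.le).of_norm hs'

/-- Comparison of powers of `exp (λ s)`: the first is the eigenvector equation `hcK`, the higher
ones are `coeff_recursion`. The quadratic term `p * p`, a componentwise product, is expanded as a
Cauchy product. -/
theorem hasDerivAt_unstableCurve {K c : ℝ × ℝ} (hK : 0 < eigSq K)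
    (hc : 4 * ((eig K + ‖lin K‖) / eigSq K) * ‖c‖ ≤ 1) (hcK : eig K • c = lin K c) {s : ℝ}
    (hs : s < 0) : HasDerivAt (unstableCurve K c) (field K (unstableCurve K c s)) s := by
  refine (hasDerivAt_unstableCurve_tsum hK hc hs).congr_deriv ?_
  have hsum := summable_norm_smul_coeff hK hc hs.le
  set E : ℕ → ℝ := fun n => Real.exp ((n + 1) * eig K * s) with hE
  set a : ℕ → ℝ × ℝ := fun n => E n • coeff K c n with ha
  have hlin : Summable fun n : ℕ => lin K (a n) := (lin K).summable hsum.of_norm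
  have hcauchy : Summable fun n : ℕ => ∑ k ∈ Finset.range (n + 1), a k * a (n - k) :=
    (summable_norm_sum_mul_range_of_summable_norm hsum hsum).of_norm
  have hterm : ∀ n : ℕ, (((n + 1 : ℕ) + 1) * eig K * E (n + 1)) • coeff K c (n + 1) =
      lin K (a (n + 1)) - ∑ k ∈ Finset.range (n + 1), a k * a (n - k) := by
    intro n
    have h1 : ∑ k ∈ Finset.range (n + 1), a k * a (n - k) =
        E (n + 1) • ∑ k ∈ Finset.range (n + 1), coeff K c k * coeff K c (n - k) := by
      rw [Finset.smul_sum]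
      refine Finset.sum_congr rfl fun k hk => ?_
      have hkn : k ≤ n := Nat.lt_succ_iff.1 (Finset.mem_range.1 hk)
      have h2 : E k * E (n - k) = E (n + 1) := by
        simp only [hE]
        rw [← Real.exp_add, Nat.cast_sub hkn]
        push_cast
        ring_nf
      simp only [ha]
      rw [smul_mul_smul_comm, h2]
    have h3 : (((n + 1 : ℕ) + 1) * eig K * E (n + 1)) • coeff K c (n + 1) =
        E (n + 1) • (((n + 2) * eig K) • coeff K c (n + 1)) := by
      rw [smul_smul]
      congr 1
      push_cast
      ring
    rw [h1, h3, coeff_recursion hK, smul_sub]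
    simp only [ha, map_smul]
  have hzero : (((0 : ℕ) + 1) * eig K * E 0) • coeff K c 0 = lin K (a 0) := by
    have h0 : coeff K c 0 = c := by rw [coeff]
    simp only [ha, map_smul, h0]
    rw [← hcK, smul_smul]
    congr 1
    push_cast
    ring
  have hU : unstableCurve K c s = ∑' n, a n := rfl
  rw [field_eq_lin_sub, hU, tsum_mul_tsum_eq_tsum_sum_range_of_summable_norm hsum hsum,
    (lin K).map_tsum hsum.of_norm, hlin.tsum_eq_zero_add]
  have hs1 := (summable_nat_add_iff 1).2 hlin
  have hall : Summable fun n : ℕ => ((n + 1) * eig K * E n) • coeff K c n := by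
    rw [← summable_nat_add_iff 1]
    exact (hs1.sub hcauchy).congr fun n => (hterm n).symm
  rw [hall.tsum_eq_zero_add, hzero, add_sub_assoc, ← hs1.tsum_sub hcauchy]
  congr 1
  exact tsum_congr hterm

/-- An orbit that leaves the origin in the second quadrant, in the open half plane
`0 < p₁ + p₂`. -/
theorem exists_local_unstable {K : ℝ × ℝ} (h1 : K.1 < 0) (hD : 0 < K.1 + K.2) :
    ∃ p : ℝ → ℝ × ℝ, Tendsto p atBot (𝓝 0) ∧ ∀ s, s ≤ 0 → HasDerivAt p (field K (p s)) s ∧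
      (p s).1 < 0 ∧ 0 < (p s).1 + (p s).2 ∧ 0 < yy K (p s) ∧ 0 < ww K (p s) := by
  have h2 : 0 < K.2 := by linarith
  have hS : 0 < K.2 - K.1 := by linarith
  have hK : 0 < eigSq K := by unfold eigSq; nlinarith [mul_pos (neg_pos.2 h1) h2]
  have hpos := eig_pos hK
  have hsq := eig_sq hK
  unfold eigSq at hsq
  set C := 4 * ((eig K + ‖lin K‖) / eigSq K) with hC
  have hC0 : 0 ≤ C := by positivity
  -- An eigenvector for the positive eigenvalue. The factor `η` only makes it small enough for the
  -- majorant.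
  set c₀ : ℝ × ℝ := (K.1, eig K + (K.2 - K.1)) with hc₀
  set η := (C * ‖c₀‖ + 1)⁻¹ with hη
  have hηpos : 0 < η := by positivity
  set c := η • c₀ with hcdef
  have hc : C * ‖c‖ ≤ 1 := by
    rw [hcdef, norm_smul, Real.norm_eq_abs, abs_of_pos hηpos, hη, mul_left_comm,
      inv_mul_le_iff₀ (by positivity)]
    linarith
  have hcK : eig K • c = lin K c := by
    rw [hcdef, map_smul, smul_comm]
    congr 1
    ext
    · simp [hc₀]; ring
    · simp [hc₀]; nlinarith
  set γ := unstableCurve K c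
  set z : ℝ → ℝ := fun s => Real.exp (eig K * s) with hz
  have hz0 : Tendsto z atBot (𝓝 0) :=
    Real.tendsto_exp_atBot.comp (tendsto_id.const_mul_atBot hpos)
  have hzpos : ∀ s, 0 < z s := fun s => Real.exp_pos _
  have hnorm : Tendsto (fun s => (z s)⁻¹ • γ s) atBot (𝓝 c) := by
    rw [tendsto_iff_norm_sub_tendsto_zero]
    have hb : Tendsto (fun s => 2 * ‖c‖ * z s) atBot (𝓝 0) := by simpa using hz0.const_mul (2 * ‖c‖)
    refine squeeze_zero' (Eventually.of_forall fun _ => norm_nonneg _) ?_ hb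
    filter_upwards [eventually_le_atBot 0] with s hs
    have h3 := norm_unstableCurve_sub_le hK hc hs
    have h4 : (z s)⁻¹ • γ s - c = (z s)⁻¹ • (γ s - z s • c) := by
      rw [smul_sub, smul_smul, inv_mul_cancel₀ (hzpos s).ne', one_smul]
    rw [h4, norm_smul, norm_inv, Real.norm_eq_abs, abs_of_pos (hzpos s),
      inv_mul_le_iff₀ (hzpos s)]
    refine h3.trans (le_of_eq ?_)
    simp only [hz]; ring
  have hγ0 : Tendsto γ atBot (𝓝 0) := by
    have := hz0.smul hnorm
    rw [zero_smul] at this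
    refine this.congr fun s => ?_
    rw [smul_smul, mul_inv_cancel₀ (hzpos s).ne', one_smul]
  have ef : Tendsto (fun s => ((z s)⁻¹ • γ s).1) atBot (𝓝 c.1) :=
    (continuous_fst.tendsto c).comp hnorm
  have es : Tendsto (fun s => ((z s)⁻¹ • γ s).2) atBot (𝓝 c.2) :=
    (continuous_snd.tendsto c).comp hnorm
  have ey : Tendsto (fun s => yy K (γ s)) atBot (𝓝 (3 / 2 * (K.2 - K.1))) := by
    have h := ((continuous_yy K).tendsto 0).comp hγ0
    have e0 : yy K 0 = 3 / 2 * (K.2 - K.1) := by simp [yy, uu]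
    rwa [e0] at h
  have hy0 : 0 < 3 / 2 * (K.2 - K.1) := by linarith
  have ew := (ef.add es).sub (((es.sub ef).const_mul (K.1 + K.2)).div (ey.const_mul 2)
    (by positivity))
  -- The limit of `ww / z` along the curve. Its positivity makes the energy decrease strictly on
  -- leaving the origin.
  have hwlim : 0 < c.1 + c.2 - (K.1 + K.2) * (c.2 - c.1) / (2 * (3 / 2 * (K.2 - K.1))) := by
    have e : c.1 + c.2 - (K.1 + K.2) * (c.2 - c.1) / (2 * (3 / 2 * (K.2 - K.1))) =
        η * (2 * eig K * (eig K + K.2 - 2 * K.1)) / (3 * (K.2 - K.1)) := by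
      simp only [hcdef, hc₀, Prod.smul_fst, Prod.smul_snd, smul_eq_mul]
      field_simp
      linear_combination (-2) * hsq
    rw [e]
    have : 0 < eig K + K.2 - 2 * K.1 := by linarith
    positivity
  have hc1 : c.1 < 0 := mul_neg_of_pos_of_neg hηpos h1
  have hc12 : 0 < c.1 + c.2 := by
    have : c.1 + c.2 = η * (eig K + K.2) := by
      simp only [hcdef, hc₀, Prod.smul_fst, Prod.smul_snd, smul_eq_mul]; ring
    rw [this]; positivity
  obtain ⟨N, hN⟩ := eventually_atBot.1 ((ef.eventually_lt_const hc1).and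
    (((ef.add es).eventually_const_lt hc12).and ((ey.eventually_const_lt hy0).and
      (ew.eventually_const_lt hwlim))))
  -- The series is differentiated only at negative times, hence a shift by at least 1 to have the
  -- equation on all of `s ≤ 0`.
  set N' := min N (-1) with hN'
  refine ⟨fun s => γ (s + N'), hγ0.comp (tendsto_atBot_add_const_right _ _ tendsto_id),
    fun s hs => ⟨?_, ?_⟩⟩
  · have hlt : s + N' < 0 := by
      have := min_le_right N (-1)
      linarith
    exact (hasDerivAt_unstableCurve hK hc hcK hlt).comp_add_const s N'
  · obtain ⟨a1, a2, a3, a4⟩ := hN (s + N') (by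
      have := min_le_left N (-1)
      linarith)
    have hzi := inv_pos.2 (hzpos (s + N'))
    simp only [Prod.smul_fst, Prod.smul_snd, smul_eq_mul, Pi.div_apply] at a1 a2 a4
    refine ⟨by by_contra h; push Not at h; nlinarith, ?_, a3, ?_⟩
    · rw [← mul_add] at a2
      exact (mul_pos_iff_of_pos_left hzi).1 a2
    · have e : (z (s + N'))⁻¹ * ww K (γ (s + N')) = (z (s + N'))⁻¹ * (γ (s + N')).1 +
          (z (s + N'))⁻¹ * (γ (s + N')).2 - (K.1 + K.2) * ((z (s + N'))⁻¹ * (γ (s + N')).2 -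
          (z (s + N'))⁻¹ * (γ (s + N')).1) / (2 * yy K (γ (s + N'))) := by
        simp only [ww, uu]; ring
      rw [← e] at a4
      exact (mul_pos_iff_of_pos_left hzi).1 a4

/-! ### Orbits near the origin and their reflections -/

theorem mem_stableOrbit_of_refl {K P : ℝ × ℝ} (h : refl P ∈ unstableOrbit (refl K)) :
    P ∈ stableOrbit K := by
  obtain ⟨hne, p, hp0, hp, hlim⟩ := h
  refine ⟨fun h => hne (by rw [h, refl_zero]), fun s => refl (p (-s)), by simp [hp0],
    fun s hs => ?_, ?_⟩
  · have := hasDerivAt_refl_comp_neg (hp (-s) (by linarith))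
    rwa [refl_refl] at this
  · have := (continuous_refl.tendsto 0).comp (hlim.comp tendsto_neg_atTop_atBot)
    rwa [refl_zero] at this

/-- The unstable orbit meets every small circle, in `0 < p₁ + p₂`. -/
theorem exists_unstableOrbit_mem_circle {K : ℝ × ℝ} (h1 : K.1 < 0) (hD : 0 < K.1 + K.2) :
    ∃ r : ℝ, 0 < r ∧ ∀ ρ : ℝ, 0 < ρ → ρ < r → ∃ q ∈ unstableOrbit K,
      q.1 < 0 ∧ 0 < q.1 + q.2 ∧ q.1 ^ 2 + q.2 ^ 2 = ρ := by
  obtain ⟨γ, hlim, hγ⟩ := exists_local_unstable h1 hD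
  set f : ℝ → ℝ := fun s => (γ s).1 ^ 2 + (γ s).2 ^ 2 with hf
  have hfc : ContinuousOn f (Iic 0) := by
    have hγc : ContinuousOn γ (Iic 0) := fun s hs => (hγ s hs).1.continuousAt.continuousWithinAt
    fun_prop
  have hf0 : Tendsto f atBot (𝓝 0) := by
    have h : Continuous fun q : ℝ × ℝ => q.1 ^ 2 + q.2 ^ 2 := by fun_prop
    simpa using! (h.tendsto 0).comp hlim
  refine ⟨f 0, ?_, fun ρ hρ hρr => ?_⟩
  · have := (hγ 0 le_rfl).2.1
    simp only [hf]
    nlinarith [sq_nonneg (γ 0).2]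
  obtain ⟨N, hN⟩ := eventually_atBot.1 (hf0.eventually_lt_const hρ)
  have hN0 := hN (min N 0) (min_le_left _ _)
  obtain ⟨s, hs, hsρ⟩ := intermediate_value_Icc (min_le_right N 0)
    (hfc.mono Icc_subset_Iic_self) ⟨hN0.le, hρr.le⟩
  obtain ⟨-, a1, a2, -, -⟩ := hγ s hs.2
  refine ⟨γ s, ⟨fun h => ?_, fun t => γ (t + s), by simp, fun t ht => ?_, ?_⟩, a1, a2, hsρ⟩
  · rw [h] at a1; simp at a1
  · exact (hγ (t + s) (by linarith [hs.2])).1.comp_add_const t s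
  · exact hlim.comp (tendsto_atBot_add_const_right _ _ tendsto_id)

/-- The antidiagonal has slope `-1`. The unstable orbit of `K₁` leaves on the side `0 < p₁ + p₂`,
and by reflection the stable orbit of `K₀` arrives on the side `p₁ + p₂ < 0`. -/
theorem exists_liesBetween {K₀ K₁ : ℝ × ℝ} (h0 : 0 < K₀.2) (hD0 : K₀.1 + K₀.2 < 0)
    (h1 : K₁.1 < 0) (hD1 : 0 < K₁.1 + K₁.2) :
    ∃ ε : ℝ, 0 < ε ∧ ∀ P : ℝ × ℝ, P.1 + P.2 = 0 → 0 < P.2 → P.2 < ε →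
      LiesBetween (unstableOrbit K₁) (stableOrbit K₀) P := by
  obtain ⟨r₁, hr₁, H₁⟩ := exists_unstableOrbit_mem_circle h1 hD1
  obtain ⟨r₀, hr₀, H₀⟩ := exists_unstableOrbit_mem_circle (K := refl K₀)
    (by simpa using h0) (by simp; linarith)
  -- The numbers `r₀`, `r₁` are squared radii, and `P.2 < 1` gives `2 * P.2 ^ 2 ≤ 2 * P.2 < min r₀
  -- r₁`.
  refine ⟨min 1 (min r₀ r₁ / 2), by positivity, fun P hP hP0 hPε => ?_⟩
  have hP1 : P.1 = -P.2 := by linarith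
  have hρ0 : 0 < P.1 ^ 2 + P.2 ^ 2 := by positivity
  have hρ : P.1 ^ 2 + P.2 ^ 2 < min r₀ r₁ := by
    have a := hPε.trans_le (min_le_left _ _)
    have b := hPε.trans_le (min_le_right _ _)
    rw [hP1]
    nlinarith
  obtain ⟨q, hq, q1, q2, hqρ⟩ := H₁ _ hρ0 (hρ.trans_le (min_le_right _ _))
  obtain ⟨r, hr, r1, r2, hrρ⟩ := H₀ _ hρ0 (hρ.trans_le (min_le_left _ _))
  have hslope : P.2 / P.1 = -1 := by rw [hP1, div_neg, div_self hP0.ne']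
  refine ⟨⟨by linarith, hP0⟩, q, ⟨hq, q1, by linarith⟩, refl r,
    ⟨mem_stableOrbit_of_refl (by rwa [refl_refl]), ?_⟩, hqρ, ?_, ?_, ?_⟩
  · exact ⟨by simp only [refl_fst]; linarith, by simp only [refl_snd]; linarith⟩
  · simp only [refl_fst, refl_snd]; linarith
  · rw [hslope, div_lt_iff_of_neg q1]; linarith
  · rw [hslope, lt_div_iff_of_neg (by simp only [refl_fst]; linarith)]
    simp only [refl_fst, refl_snd]; linarith

/-- Forward trajectories from the antidiagonal converge to `K` and are uniformly bounded. -/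
theorem exists_forward_from_antidiagonal {K : ℝ × ℝ} (h1 : K.1 < 0) (hD : 0 < K.1 + K.2) :
    ∃ R : ℝ, ∀ P : ℝ × ℝ, P.1 + P.2 = 0 → 0 < P.2 → P.2 ≤ (K.2 - K.1) / 4 →
      ∃ p : ℝ → ℝ × ℝ, p 0 = P ∧ Tendsto p atTop (𝓝 K) ∧
        ∀ s, 0 ≤ s → HasDerivAt p (field K (p s)) s ∧ p s ≠ 0 ∧ ‖p s‖ ≤ R := by
  have hS : 0 < K.2 - K.1 := by linarith
  -- The sublevel set at the level of the origin itself contains all the smaller ones, so `R` does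
  -- not depend on `P`.
  obtain ⟨R, hR⟩ := (isCompact_sublevel hS (energyZero K)).isBounded.exists_norm_le
  refine ⟨R, fun P hP hP0 hPS => ?_⟩
  obtain ⟨a1, a2, a3⟩ := energy_antidiagonal_lt h1 hD hP hP0 hPS
  obtain ⟨p, hp0, hp⟩ := exists_forward_trajectory hS hD a3 (P := P) ⟨a1.le, a2, le_rfl⟩
  refine ⟨p, hp0, tendsto_of_mem_sublevel hS hD a3 hp, fun s hs => ⟨(hp s hs).1, fun h => ?_, ?_⟩⟩
  · have := uu_pos_of_mem_sublevel a3 (hp s hs).2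
    simp [h, uu] at this
  · obtain ⟨b1, b2, b3⟩ := (hp s hs).2
    exact hR _ ⟨b1, b2, b3.trans a3.le⟩

/-! ### Gluing of trajectories -/

/-- The curve that agrees with `f` for `s ≤ 0` and with `g` for `s > 0`. -/
def glue (f g : ℝ → ℝ × ℝ) (s : ℝ) : ℝ × ℝ := if s ≤ 0 then f s else g s

theorem glue_of_le {f g : ℝ → ℝ × ℝ} {s : ℝ} (hs : s ≤ 0) : glue f g s = f s := if_pos hs

theorem glue_of_ge {f g : ℝ → ℝ × ℝ} (h : f 0 = g 0) {s : ℝ} (hs : 0 ≤ s) : glue f g s = g s := by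
  rcases hs.eq_or_lt with rfl | hs
  · rw [glue_of_le le_rfl, h]
  · exact if_neg (not_le.2 hs)

theorem hasDerivAt_glue_of_neg {f g : ℝ → ℝ × ℝ} {d : ℝ × ℝ} {s : ℝ} (hs : s < 0)
    (hf : HasDerivAt f d s) : HasDerivAt (glue f g) d s :=
  hf.congr_of_eventuallyEq (by filter_upwards [Iio_mem_nhds hs] with t ht using glue_of_le (le_of_lt ht))

theorem hasDerivAt_glue_of_pos {f g : ℝ → ℝ × ℝ} {d : ℝ × ℝ} {s : ℝ} (hs : 0 < s)
    (hg : HasDerivAt g d s) : HasDerivAt (glue f g) d s :=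
  hg.congr_of_eventuallyEq (by
    filter_upwards [Ioi_mem_nhds hs] with t ht using if_neg (not_le.2 ht))

theorem hasDerivAt_glue_zero {f g : ℝ → ℝ × ℝ} {d : ℝ × ℝ} (h : f 0 = g 0)
    (hf : HasDerivAt f d 0) (hg : HasDerivAt g d 0) : HasDerivAt (glue f g) d 0 := by
  have h1 : HasDerivWithinAt (glue f g) d (Iic 0) 0 :=
    hf.hasDerivWithinAt.congr (fun t ht => glue_of_le ht) (glue_of_le le_rfl)
  have h2 : HasDerivWithinAt (glue f g) d (Ici 0) 0 :=
    hg.hasDerivWithinAt.congr (fun t ht => glue_of_ge h ht) (glue_of_ge h le_rfl)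
  have := h1.union h2
  rwa [Iic_union_Ici, hasDerivWithinAt_univ] at this

theorem continuous_glue {f g : ℝ → ℝ × ℝ} (h : f 0 = g 0) (hf : ContinuousOn f (Iic 0))
    (hg : ContinuousOn g (Ici 0)) : Continuous (glue f g) := by
  rw [← continuousOn_univ, ← Iic_union_Ici (a := (0 : ℝ))]
  exact (hf.congr fun t ht => glue_of_le ht).union_of_isClosed
    (hg.congr fun t ht => glue_of_ge h ht) isClosed_Iic isClosed_Ici

theorem tendsto_glue_atBot {f g : ℝ → ℝ × ℝ} {l : ℝ × ℝ} (hf : Tendsto f atBot (𝓝 l)) :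
    Tendsto (glue f g) atBot (𝓝 l) :=
  hf.congr' (by filter_upwards [eventually_le_atBot 0] with s hs using (glue_of_le hs).symm)

theorem tendsto_glue_atTop {f g : ℝ → ℝ × ℝ} {l : ℝ × ℝ} (hg : Tendsto g atTop (𝓝 l)) :
    Tendsto (glue f g) atTop (𝓝 l) :=
  hg.congr' (by
    filter_upwards [eventually_gt_atTop 0] with s hs using (if_neg (not_le.2 hs)).symm)

theorem isSwitchedTrajectory_glue {K₀ K₁ P : ℝ × ℝ} {f g : ℝ → ℝ × ℝ} (hf0 : f 0 = P)
    (hg0 : g 0 = P) (hf : ∀ s, s ≤ 0 → HasDerivAt f (field K₀ (f s)) s)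
    (hg : ∀ s, 0 ≤ s → HasDerivAt g (field K₁ (g s)) s) :
    IsSwitchedTrajectory K₀ K₁ P (glue f g) := by
  have h : f 0 = g 0 := hf0.trans hg0.symm
  refine ⟨continuous_glue h (fun s hs => (hf s hs).continuousAt.continuousWithinAt)
    (fun s hs => (hg s hs).continuousAt.continuousWithinAt), (glue_of_le le_rfl).trans hf0,
    fun s hs => ?_, fun s hs => ?_⟩
  · rw [glue_of_le hs.le]
    exact hasDerivAt_glue_of_neg hs (hf s hs.le)
  · rw [glue_of_ge h hs.le]
    exact hasDerivAt_glue_of_pos hs (hg s hs.le)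

/-- The unstable orbit in the second quadrant connects the origin to `K`. -/
theorem exists_heteroclinic {K : ℝ × ℝ} (h1 : K.1 < 0) (hD : 0 < K.1 + K.2) :
    ∃ p : ℝ → ℝ × ℝ, (∀ s, HasDerivAt p (field K (p s)) s) ∧ (∀ s, p s ≠ 0) ∧
      Tendsto p atBot (𝓝 0) ∧ Tendsto p atTop (𝓝 K) := by
  have hS : 0 < K.2 - K.1 := by linarith
  obtain ⟨γ, hlim, hγ⟩ := exists_local_unstable h1 hD
  have hu : ∀ s, s ≤ 0 → 0 < uu (γ s) := fun s hs => by
    obtain ⟨-, a1, a2, -⟩ := hγ s hs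
    unfold uu; linarith
  -- The local orbit ends at `γ 0` strictly below the level of the origin, where the forward theory
  -- takes over.
  have hE := energy_lt_of_tendsto_atBot hS hD (fun s hs => (hγ s hs).1) hlim hu
    (fun s hs => (hγ s hs).2.2.2.1) (fun s hs => (hγ s hs).2.2.2.2.ne')
  obtain ⟨p, hp0, hp⟩ := exists_forward_trajectory hS hD hE (P := γ 0)
    ⟨(hu 0 le_rfl).le, (hγ 0 le_rfl).2.2.2.1, le_rfl⟩
  have hpos : ∀ q : ℝ × ℝ, 0 < uu q → q ≠ 0 := by
    rintro q hq rfl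
    simp [uu] at hq
  refine ⟨glue γ p, fun s => ?_, fun s => ?_, tendsto_glue_atBot hlim,
    tendsto_glue_atTop (tendsto_of_mem_sublevel hS hD hE hp)⟩
  · rcases lt_trichotomy s 0 with hs | rfl | hs
    · rw [glue_of_le hs.le]
      exact hasDerivAt_glue_of_neg hs (hγ s hs.le).1
    · rw [glue_of_le le_rfl]
      refine hasDerivAt_glue_zero hp0.symm (hγ 0 le_rfl).1 ?_
      rw [← hp0]
      exact (hp 0 le_rfl).1
    · rw [glue_of_ge hp0.symm hs.le]
      exact hasDerivAt_glue_of_pos hs (hp s hs.le).1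
  · rcases le_total s 0 with hs | hs
    · rw [glue_of_le hs]
      exact hpos _ (hu s hs)
    · rw [glue_of_ge hp0.symm hs]
      exact hpos _ (uu_pos_of_mem_sublevel hE (hp s hs).2)

theorem tendsto_refl_comp_neg_atBot {p : ℝ → ℝ × ℝ} {l : ℝ × ℝ} (h : Tendsto p atTop (𝓝 l)) :
    Tendsto (fun s => refl (p (-s))) atBot (𝓝 (refl l)) :=
  (continuous_refl.tendsto l).comp (h.comp tendsto_neg_atBot_atTop)

theorem tendsto_refl_comp_neg_atTop {p : ℝ → ℝ × ℝ} {l : ℝ × ℝ} (h : Tendsto p atBot (𝓝 l)) :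
    Tendsto (fun s => refl (p (-s))) atTop (𝓝 (refl l)) :=
  (continuous_refl.tendsto l).comp (h.comp tendsto_neg_atTop_atBot)

theorem hasDerivAt_refl_comp_neg' {K : ℝ × ℝ} {p : ℝ → ℝ × ℝ} {s : ℝ}
    (h : HasDerivAt p (field (refl K) (p (-s))) (-s)) :
    HasDerivAt (fun s => refl (p (-s))) (field K (refl (p (-s)))) s := by
  have := hasDerivAt_refl_comp_neg h
  rwa [refl_refl] at this

/-- Along a trajectory that comes from the origin, the change of variable has a finite limit. -/
theorem exists_tendsto_atBot_of_tendsto_zero {K : ℝ × ℝ} (hK : K ≠ 0) {p : ℝ → ℝ × ℝ} {x : ℝ → ℝ}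
    (hp : ∀ s, s < 0 → HasDerivAt p (field K (p s)) s) (h0 : Tendsto p atBot (𝓝 0))
    (hx : ∀ s, HasDerivAt x (Delta (p s)) s) : ∃ l, Tendsto x atBot (𝓝 l) := by
  have h1 := tendsto_refl_comp_neg_atTop h0
  rw [refl_zero] at h1
  obtain ⟨l, hl⟩ := exists_tendsto_of_tendsto_zero (K := refl K) (x := fun s => -x (-s))
    (fun h => hK (refl_eq_zero.1 h))
    (fun s hs => hasDerivAt_refl_comp_neg (hp (-s) (by linarith))) h1
    (fun s => by
      rw [Delta_refl]
      exact hasDerivAt_neg_comp_neg hx s)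
  refine ⟨-l, ?_⟩
  refine (hl.comp tendsto_neg_atBot_atTop).neg.congr fun s => ?_
  simp

theorem exists_norm_le_of_tendsto {p : ℝ → ℝ × ℝ} (hp : Continuous p) {l m : ℝ × ℝ}
    (hl : Tendsto p atBot (𝓝 l)) (hm : Tendsto p atTop (𝓝 m)) : ∃ R, ∀ s, ‖p s‖ ≤ R := by
  obtain ⟨a, ha⟩ := eventually_atBot.1 (hl.norm.eventually_le_const (lt_add_one ‖l‖))
  obtain ⟨b, hb⟩ := eventually_atTop.1 (hm.norm.eventually_le_const (lt_add_one ‖m‖))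
  obtain ⟨C, hC⟩ := (isCompact_Icc (a := a) (b := b)).exists_bound_of_continuousOn hp.continuousOn
  refine ⟨max (max (‖l‖ + 1) (‖m‖ + 1)) C, fun s => ?_⟩
  rcases le_or_gt s a with h | h
  · exact (ha s h).trans ((le_max_left _ _).trans (le_max_left _ _))
  rcases le_or_gt b s with h' | h'
  · exact (hb s h').trans ((le_max_right _ _).trans (le_max_left _ _))
  · exact (hC s ⟨h.le, h'.le⟩).trans (le_max_right _ _)

theorem strictMono_of_hasDerivAt_Delta {p : ℝ → ℝ × ℝ} (hp0 : ∀ s, p s ≠ 0) {x : ℝ → ℝ}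
    (hx : ∀ s, HasDerivAt x (Delta (p s)) s) : StrictMono x :=
  strictMono_of_deriv_pos fun s => by rw [(hx s).deriv]; exact Delta_pos (hp0 s)

/-! ### Solutions that switch at the origin -/

section Switch

variable {K₀ K₁ : ℝ × ℝ} {h₁ h₂ : ℝ → ℝ}

/-- A switched trajectory from `K₀` to `K₁` represents an admissible solution. -/
theorem exists_solution_of_switched (hK₀ : K₀ ≠ 0) (hK₁ : K₁ ≠ 0)
    (hc₁ : Continuous h₁) (hc₂ : Continuous h₂)
    (hneg₁ : ∀ x, x < 0 → HasDerivAt h₁ K₀.1 x) (hneg₂ : ∀ x, x < 0 → HasDerivAt h₂ K₀.2 x)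
    (hpos₁ : ∀ x, 0 < x → HasDerivAt h₁ K₁.1 x) (hpos₂ : ∀ x, 0 < x → HasDerivAt h₂ K₁.2 x)
    {P : ℝ × ℝ} {p : ℝ → ℝ × ℝ} (hp : IsSwitchedTrajectory K₀ K₁ P p) (hp0 : ∀ s, p s ≠ 0)
    {R : ℝ} (hR : ∀ s, ‖p s‖ ≤ R) (htop : Tendsto p atTop (𝓝 K₁)) (hbot : Tendsto p atBot (𝓝 K₀)) :
    ∃ (u : ℝ → ℝ × ℝ) (x : ℝ → ℝ), IsAdmissibleSolution h₁ h₂ u ∧ GivesNash h₁ h₂ u ∧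
      x 0 = 0 ∧ Tendsto x atTop atTop ∧ Tendsto x atBot atBot ∧ Represents p x u ∧
      Continuous (deriv u) ∧ ∀ z, ‖deriv u z‖ ≤ R := by
  obtain ⟨hpc, hpP, hpneg, hppos⟩ := hp
  obtain ⟨x, hx0, hx⟩ := exists_changeOfVariable hpc 0
  have hmono := strictMono_of_hasDerivAt_Delta hp0 hx
  have hxtop : Tendsto x atTop atTop := tendsto_atTop_of_hasDerivAt hx (Delta_pos hK₁)
    ((continuous_Delta.tendsto K₁).comp htop)
  have hxbot : Tendsto x atBot atBot := tendsto_atBot_of_hasDerivAt hx (Delta_pos hK₀)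
    ((continuous_Delta.tendsto K₀).comp hbot)
  have hxc : Continuous x := continuous_iff_continuousAt.2 fun s => (hx s).continuousAt
  have hsurj : Function.Surjective x := hxc.surjective hxtop hxbot
  set Q : ℝ → ℝ × ℝ := p ∘ Function.invFun x with hQ
  have hQx : ∀ s, Q (x s) = p s := fun s => by
    simp only [hQ, Function.comp, Function.leftInverse_invFun hmono.injective s]
  have hQc : Continuous Q := continuous_iff_continuousAt.2 fun z => by
    obtain ⟨s, rfl⟩ := hsurj z
    exact continuousAt_of_comp_eq hpc hp0 hx hQx s
  obtain ⟨hd, hadm, hnash⟩ := hjSol_spec hc₁ hc₂ hQc (fun z => hR _) (countable_singleton 0)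
    (fun z hz => by
      obtain ⟨s, rfl⟩ := hsurj z
      rcases lt_trichotomy s 0 with hs | rfl | hs
      · have : x s < 0 := by rw [← hx0]; exact hmono hs
        exact hasDerivAt_hjSol hpc hp0 hx hQx (hpneg s hs) (hneg₁ _ this) (hneg₂ _ this)
      · exact absurd hx0 hz
      · have : 0 < x s := by rw [← hx0]; exact hmono hs
        exact hasDerivAt_hjSol hpc hp0 hx hQx (hppos s hs) (hpos₁ _ this) (hpos₂ _ this))
  have hder : deriv (hjSol h₁ h₂ Q) = Q := funext fun z => (hd z).deriv
  refine ⟨hjSol h₁ h₂ Q, x, hadm, hnash, hx0, hxtop, hxbot, fun s => ⟨hx s, ?_⟩, ?_, ?_⟩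
  · rw [← hQx]; exact hd _
  · rw [hder]; exact hQc
  · rw [hder]; exact fun z => hR _

end Switch

/-! ### Solutions whose derivative vanishes at two points -/

theorem norm_lt_left_of_tendsto_zero {p Q : ℝ → ℝ × ℝ} {x : ℝ → ℝ} {b : ℝ} (hmono : StrictMono x)
    (hxc : Continuous x) (hQ : ∀ s, Q (x s) = p s) (hp : Tendsto p atTop (𝓝 0))
    (hx : Tendsto x atTop (𝓝 b)) {ε : ℝ} (hε : 0 < ε) : ∃ a < b, ∀ z ∈ Ioo a b, ‖Q z‖ < ε := by
  obtain ⟨N, hN⟩ := eventually_atTop.1 (hp.norm.eventually_lt_const (by simpa using hε))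
  refine ⟨x N, (hmono (lt_add_one N)).trans_le (hmono.monotone.ge_of_tendsto hx _), fun z hz => ?_⟩
  obtain ⟨M, hM⟩ := (hx.eventually_const_lt hz.2).exists
  obtain ⟨s, rfl⟩ := mem_range_of_exists_le_of_exists_ge hxc ⟨N, hz.1.le⟩ ⟨M, hM.le⟩
  rw [hQ]
  exact hN s (hmono.lt_iff_lt.1 hz.1).le

theorem norm_lt_right_of_tendsto_zero {p Q : ℝ → ℝ × ℝ} {x : ℝ → ℝ} {b : ℝ} (hmono : StrictMono x)
    (hxc : Continuous x) (hQ : ∀ s, Q (x s) = p s) (hp : Tendsto p atBot (𝓝 0))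
    (hx : Tendsto x atBot (𝓝 b)) {ε : ℝ} (hε : 0 < ε) : ∃ a > b, ∀ z ∈ Ioo b a, ‖Q z‖ < ε := by
  obtain ⟨N, hN⟩ := eventually_atBot.1 (hp.norm.eventually_lt_const (by simpa using hε))
  refine ⟨x N, (hmono.monotone.le_of_tendsto hx _).trans_lt (hmono (sub_one_lt N)), fun z hz => ?_⟩
  obtain ⟨M, hM⟩ := (hx.eventually_lt_const hz.1).exists
  obtain ⟨s, rfl⟩ := mem_range_of_exists_le_of_exists_ge hxc ⟨M, hM.le⟩ ⟨N, hz.2.le⟩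
  rw [hQ]
  exact hN s (hmono.lt_iff_lt.1 hz.2).le

theorem continuousAt_of_norm_lt {Q : ℝ → ℝ × ℝ} {b : ℝ} (hQ : Q b = 0)
    (hl : ∀ ε > 0, ∃ a < b, ∀ z ∈ Ioo a b, ‖Q z‖ < ε)
    (hr : ∀ ε > 0, ∃ a > b, ∀ z ∈ Ioo b a, ‖Q z‖ < ε) : ContinuousAt Q b := by
  rw [ContinuousAt, hQ, NormedAddGroup.tendsto_nhds_zero]
  intro ε hε
  obtain ⟨a, ha, hal⟩ := hl ε hε
  obtain ⟨c, hc, hcr⟩ := hr ε hε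
  filter_upwards [Ioo_mem_nhds ha hc] with z hz
  rcases lt_trichotomy z b with h | rfl | h
  · exact hal z ⟨hz.1, h⟩
  · rw [hQ, norm_zero]; exact hε
  · exact hcr z ⟨h, hz.2⟩

/-- Every common point of an unstable orbit of `K₀` and a stable orbit of `K₁` gives a solution
whose derivative vanishes at two points. -/
theorem exists_solution_of_intersection {K₀ K₁ : ℝ × ℝ} {h₁ h₂ : ℝ → ℝ}
    (h0 : 0 < K₀.2) (hD0 : K₀.1 + K₀.2 < 0) (h1 : K₁.1 < 0) (hD1 : 0 < K₁.1 + K₁.2)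
    (hc₁ : Continuous h₁) (hc₂ : Continuous h₂)
    (hneg₁ : ∀ x, x < 0 → HasDerivAt h₁ K₀.1 x) (hneg₂ : ∀ x, x < 0 → HasDerivAt h₂ K₀.2 x)
    (hpos₁ : ∀ x, 0 < x → HasDerivAt h₁ K₁.1 x) (hpos₂ : ∀ x, 0 < x → HasDerivAt h₂ K₁.2 x)
    {P : ℝ × ℝ} (hP : P ∈ unstableOrbit K₀ ∩ stableOrbit K₁) :
    ∃ (u : ℝ → ℝ × ℝ) (p : ℝ → ℝ × ℝ) (x : ℝ → ℝ) (xm xp : ℝ)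
      (pm : ℝ → ℝ × ℝ) (ym : ℝ → ℝ) (pp : ℝ → ℝ × ℝ) (yp : ℝ → ℝ),
      IsAdmissibleSolution h₁ h₂ u ∧ GivesNash h₁ h₂ u ∧
      xm < 0 ∧ 0 < xp ∧ HasDerivAt u 0 xm ∧ HasDerivAt u 0 xp ∧
      IsSwitchedTrajectory K₀ K₁ P p ∧ Tendsto p atTop (𝓝 0) ∧ Tendsto p atBot (𝓝 0) ∧
      x 0 = 0 ∧ Tendsto x atTop (𝓝 xp) ∧ Tendsto x atBot (𝓝 xm) ∧ Represents p x u ∧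
      (∀ s, HasDerivAt pm (field K₀ (pm s)) s) ∧ (∀ s, pm s ≠ 0) ∧
      Tendsto pm atTop (𝓝 0) ∧ Tendsto pm atBot (𝓝 K₀) ∧
      Tendsto ym atTop (𝓝 xm) ∧ Tendsto ym atBot atBot ∧ Represents pm ym u ∧
      (∀ s, HasDerivAt pp (field K₁ (pp s)) s) ∧ (∀ s, pp s ≠ 0) ∧
      Tendsto pp atBot (𝓝 0) ∧ Tendsto pp atTop (𝓝 K₁) ∧
      Tendsto yp atBot (𝓝 xp) ∧ Tendsto yp atTop atTop ∧ Represents pp yp u := by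
  have hK₀ : K₀ ≠ 0 := by rintro rfl; simp at h0
  have hK₁ : K₁ ≠ 0 := by rintro rfl; simp at h1
  obtain ⟨⟨hP0, f, hf0, hf, hflim⟩, -, g, hg0, hg, hglim⟩ := hP
  set p := glue f g with hpdef
  have hfg : f 0 = g 0 := hf0.trans hg0.symm
  have hsw : IsSwitchedTrajectory K₀ K₁ P p := isSwitchedTrajectory_glue hf0 hg0 hf hg
  have hptop : Tendsto p atTop (𝓝 0) := tendsto_glue_atTop hglim
  have hpbot : Tendsto p atBot (𝓝 0) := tendsto_glue_atBot hflim
  have hpc : Continuous p := hsw.1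
  -- `f` and `g` solve their equations on half-lines only. The backward half is handled by
  -- reflection.
  have hp0 : ∀ s, p s ≠ 0 := by
    intro s
    rcases le_total s 0 with hs | hs
    · rw [hpdef, glue_of_le hs]
      have := ne_zero_of_hasDerivAt (K := refl K₀) (p := fun s => refl (f (-s))) (s := -s)
        (fun t ht => hasDerivAt_refl_comp_neg (hf (-t) (by linarith)))
        (by simpa [hf0, refl_eq_zero] using hP0) (by linarith)
      simpa [refl_eq_zero] using this
    · rw [hpdef, glue_of_ge hfg hs]
      exact ne_zero_of_hasDerivAt hg (by rwa [hg0]) hs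
  obtain ⟨x, hx0, hx⟩ := exists_changeOfVariable hpc 0
  obtain ⟨xp, hxp⟩ := exists_tendsto_of_tendsto_zero hK₁ hsw.2.2.2 hptop hx
  obtain ⟨xm, hxm⟩ := exists_tendsto_atBot_of_tendsto_zero hK₀ hsw.2.2.1 hpbot hx
  have hxmono := strictMono_of_hasDerivAt_Delta hp0 hx
  have hxc : Continuous x := continuous_iff_continuousAt.2 fun s => (hx s).continuousAt
  have hxlt : ∀ s, x s < xp := fun s =>
    (hxmono (lt_add_one s)).trans_le (hxmono.monotone.ge_of_tendsto hxp _)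
  have hxgt : ∀ s, xm < x s := fun s =>
    (hxmono.monotone.le_of_tendsto hxm _).trans_lt (hxmono (sub_one_lt s))
  have hxm0 : xm < 0 := hx0 ▸ hxgt 0
  have hxp0 : 0 < xp := hx0 ▸ hxlt 0
  -- the right piece
  obtain ⟨pp, hpp, hpp0, hppbot, hpptop⟩ := exists_heteroclinic h1 hD1
  have hppc : Continuous pp := continuous_iff_continuousAt.2 fun s => (hpp s).continuousAt
  obtain ⟨yp, hyp, hypbot⟩ : ∃ yp : ℝ → ℝ, (∀ s, HasDerivAt yp (Delta (pp s)) s) ∧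
      Tendsto yp atBot (𝓝 xp) := by
    obtain ⟨y, -, hy⟩ := exists_changeOfVariable hppc 0
    obtain ⟨l, hl⟩ := exists_tendsto_atBot_of_tendsto_zero hK₁ (fun s _ => hpp s) hppbot hy
    -- `dx/ds = Δ(p)` fixes `x` up to a constant, chosen so that this piece starts at `xp`.
    refine ⟨fun s => xp - l + y s, fun s => (hy s).const_add _, ?_⟩
    simpa using hl.const_add (xp - l)
  have hyptop : Tendsto yp atTop atTop := tendsto_atTop_of_hasDerivAt hyp (Delta_pos hK₁)
    ((continuous_Delta.tendsto K₁).comp hpptop)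
  have hypmono := strictMono_of_hasDerivAt_Delta hpp0 hyp
  have hypc : Continuous yp := continuous_iff_continuousAt.2 fun s => (hyp s).continuousAt
  have hypgt : ∀ s, xp < yp s := fun s =>
    (hypmono.monotone.le_of_tendsto hypbot _).trans_lt (hypmono (sub_one_lt s))
  -- the left piece
  obtain ⟨q, hq, hq0, hqbot, hqtop⟩ := exists_heteroclinic (K := refl K₀)
    (by simpa using h0) (by simp only [refl_fst, refl_snd]; linarith)
  set pm : ℝ → ℝ × ℝ := fun s => refl (q (-s)) with hpmdef
  have hpm : ∀ s, HasDerivAt pm (field K₀ (pm s)) s := fun s => hasDerivAt_refl_comp_neg' (hq (-s))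
  have hpm0 : ∀ s, pm s ≠ 0 := fun s h => hq0 _ (refl_eq_zero.1 h)
  have hpmtop : Tendsto pm atTop (𝓝 0) := by
    have := tendsto_refl_comp_neg_atTop hqbot
    rwa [refl_zero] at this
  have hpmbot : Tendsto pm atBot (𝓝 K₀) := by
    have := tendsto_refl_comp_neg_atBot hqtop
    rwa [refl_refl] at this
  have hpmc : Continuous pm := continuous_iff_continuousAt.2 fun s => (hpm s).continuousAt
  obtain ⟨ym, hym, hymtop⟩ : ∃ ym : ℝ → ℝ, (∀ s, HasDerivAt ym (Delta (pm s)) s) ∧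
      Tendsto ym atTop (𝓝 xm) := by
    obtain ⟨y, -, hy⟩ := exists_changeOfVariable hpmc 0
    obtain ⟨l, hl⟩ := exists_tendsto_of_tendsto_zero hK₀ (fun s _ => hpm s) hpmtop hy
    refine ⟨fun s => xm - l + y s, fun s => (hy s).const_add _, ?_⟩
    simpa using hl.const_add (xm - l)
  have hymbot : Tendsto ym atBot atBot := tendsto_atBot_of_hasDerivAt hym (Delta_pos hK₀)
    ((continuous_Delta.tendsto K₀).comp hpmbot)
  have hymmono := strictMono_of_hasDerivAt_Delta hpm0 hym
  have hymc : Continuous ym := continuous_iff_continuousAt.2 fun s => (hym s).continuousAt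
  have hymlt : ∀ s, ym s < xm := fun s =>
    (hymmono (lt_add_one s)).trans_le (hymmono.monotone.ge_of_tendsto hymtop _)
  -- the derivative
  set X : ℝ ⊕ ℝ ⊕ ℝ → ℝ := Sum.elim ym (Sum.elim x yp) with hX
  have hXinj : Function.Injective X := by
    refine hymmono.injective.sumElim (hxmono.injective.sumElim hypmono.injective fun s t =>
      ((hxlt s).trans (hypgt t)).ne) fun s t => ?_
    rcases t with t | t
    · exact ((hymlt s).trans (hxgt t)).ne
    · exact ((hymlt s).trans ((hxm0.trans hxp0).trans (hypgt t))).ne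
  set Q : ℝ → ℝ × ℝ := Function.extend X (Sum.elim pm (Sum.elim p pp)) 0 with hQdef
  have hQm : ∀ s, Q (ym s) = pm s := fun s => hXinj.extend_apply _ _ (Sum.inl s)
  have hQx : ∀ s, Q (x s) = p s := fun s => hXinj.extend_apply _ _ (Sum.inr (Sum.inl s))
  have hQp : ∀ s, Q (yp s) = pp s := fun s => hXinj.extend_apply _ _ (Sum.inr (Sum.inr s))
  have hQxm : Q xm = 0 := by
    refine Function.extend_apply' _ _ _ ?_
    rintro ⟨s | s | s, hs⟩
    · exact (hymlt s).ne hs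
    · exact (hxgt s).ne' hs
    · exact ((hxm0.trans hxp0).trans (hypgt s)).ne' hs
  have hQxp : Q xp = 0 := by
    refine Function.extend_apply' _ _ _ ?_
    rintro ⟨s | s | s, hs⟩
    · exact ((hymlt s).trans (hxm0.trans hxp0)).ne hs
    · exact (hxlt s).ne hs
    · exact (hypgt s).ne' hs
  have hcases : ∀ z, z = xm ∨ z = xp ∨ (∃ s, ym s = z) ∨ (∃ s, x s = z) ∨ ∃ s, yp s = z := by
    intro z
    rcases lt_trichotomy z xm with hz | hz | hz
    · obtain ⟨a, ha⟩ := (hymbot.eventually_le_atBot z).exists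
      obtain ⟨b, hb⟩ := (hymtop.eventually_const_lt hz).exists
      exact Or.inr (Or.inr (Or.inl
        (mem_range_of_exists_le_of_exists_ge hymc ⟨a, ha⟩ ⟨b, hb.le⟩)))
    · exact Or.inl hz
    rcases lt_trichotomy z xp with hz' | hz' | hz'
    · obtain ⟨a, ha⟩ := (hxm.eventually_lt_const hz).exists
      obtain ⟨b, hb⟩ := (hxp.eventually_const_lt hz').exists
      exact Or.inr (Or.inr (Or.inr (Or.inl
        (mem_range_of_exists_le_of_exists_ge hxc ⟨a, ha.le⟩ ⟨b, hb.le⟩))))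
    · exact Or.inr (Or.inl hz')
    · obtain ⟨a, ha⟩ := (hypbot.eventually_lt_const hz').exists
      obtain ⟨b, hb⟩ := (hyptop.eventually_ge_atTop z).exists
      exact Or.inr (Or.inr (Or.inr (Or.inr
        (mem_range_of_exists_le_of_exists_ge hypc ⟨a, ha.le⟩ ⟨b, hb⟩))))
  obtain ⟨R₁, hR₁⟩ := exists_norm_le_of_tendsto hpmc hpmbot hpmtop
  obtain ⟨R₂, hR₂⟩ := exists_norm_le_of_tendsto hpc hpbot hptop
  obtain ⟨R₃, hR₃⟩ := exists_norm_le_of_tendsto hppc hppbot hpptop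
  have hQR : ∀ z, ‖Q z‖ ≤ max R₁ (max R₂ R₃) := by
    intro z
    have hR0 : 0 ≤ max R₁ (max R₂ R₃) := ((norm_nonneg _).trans (hR₁ 0)).trans (le_max_left _ _)
    rcases hcases z with rfl | rfl | ⟨s, rfl⟩ | ⟨s, rfl⟩ | ⟨s, rfl⟩
    · rw [hQxm, norm_zero]; exact hR0
    · rw [hQxp, norm_zero]; exact hR0
    · rw [hQm]; exact (hR₁ s).trans (le_max_left _ _)
    · rw [hQx]; exact (hR₂ s).trans ((le_max_left _ _).trans (le_max_right _ _))
    · rw [hQp]; exact (hR₃ s).trans ((le_max_right _ _).trans (le_max_right _ _))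
  have hQc : Continuous Q := continuous_iff_continuousAt.2 fun z => by
    rcases hcases z with rfl | rfl | ⟨s, rfl⟩ | ⟨s, rfl⟩ | ⟨s, rfl⟩
    · exact continuousAt_of_norm_lt hQxm
        (fun ε hε => norm_lt_left_of_tendsto_zero hymmono hymc hQm hpmtop hymtop hε)
        (fun ε hε => norm_lt_right_of_tendsto_zero hxmono hxc hQx hpbot hxm hε)
    · exact continuousAt_of_norm_lt hQxp
        (fun ε hε => norm_lt_left_of_tendsto_zero hxmono hxc hQx hptop hxp hε)
        (fun ε hε => norm_lt_right_of_tendsto_zero hypmono hypc hQp hppbot hypbot hε)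
    · exact continuousAt_of_comp_eq hpmc hpm0 hym hQm s
    · exact continuousAt_of_comp_eq hpc hp0 hx hQx s
    · exact continuousAt_of_comp_eq hppc hpp0 hyp hQp s
  obtain ⟨hd, hadm, hnash⟩ := hjSol_spec (S := {0, xm, xp}) hc₁ hc₂ hQc hQR
    (Set.toFinite _).countable (fun z hz => by
      simp only [mem_insert_iff, mem_singleton_iff, not_or] at hz
      obtain ⟨z0, zm, zp⟩ := hz
      rcases hcases z with h | h | ⟨s, rfl⟩ | ⟨s, rfl⟩ | ⟨s, rfl⟩
      · exact absurd h zm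
      · exact absurd h zp
      · have : ym s < 0 := (hymlt s).trans hxm0
        exact hasDerivAt_hjSol hpmc hpm0 hym hQm (hpm s) (hneg₁ _ this) (hneg₂ _ this)
      · rcases lt_trichotomy s 0 with hs | rfl | hs
        · have : x s < 0 := by rw [← hx0]; exact hxmono hs
          exact hasDerivAt_hjSol hpc hp0 hx hQx (hsw.2.2.1 s hs) (hneg₁ _ this) (hneg₂ _ this)
        · exact absurd hx0 z0
        · have : 0 < x s := by rw [← hx0]; exact hxmono hs
          exact hasDerivAt_hjSol hpc hp0 hx hQx (hsw.2.2.2 s hs) (hpos₁ _ this) (hpos₂ _ this)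
      · have : 0 < yp s := hxp0.trans (hypgt s)
        exact hasDerivAt_hjSol hppc hpp0 hyp hQp (hpp s) (hpos₁ _ this) (hpos₂ _ this))
  refine ⟨hjSol h₁ h₂ Q, p, x, xm, xp, pm, ym, pp, yp, hadm, hnash, hxm0, hxp0, ?_, ?_, hsw,
    hptop, hpbot, hx0, hxp, hxm, fun s => ⟨hx s, ?_⟩, hpm, hpm0, hpmtop, hpmbot, hymtop, hymbot,
    fun s => ⟨hym s, ?_⟩, hpp, hpp0, hppbot, hpptop, hypbot, hyptop, fun s => ⟨hyp s, ?_⟩⟩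
  · rw [← hQxm]; exact hd xm
  · rw [← hQxp]; exact hd xp
  · rw [← hQx]; exact hd _
  · rw [← hQm]; exact hd _
  · rw [← hQp]; exact hd _

/-- The solutions through the points of the antidiagonal near the origin. -/
theorem exists_solution_of_antidiagonal {K₀ K₁ : ℝ × ℝ} {h₁ h₂ : ℝ → ℝ}
    (h0 : 0 < K₀.2) (hD0 : K₀.1 + K₀.2 < 0) (h1 : K₁.1 < 0) (hD1 : 0 < K₁.1 + K₁.2)
    (hc₁ : Continuous h₁) (hc₂ : Continuous h₂)
    (hneg₁ : ∀ x, x < 0 → HasDerivAt h₁ K₀.1 x) (hneg₂ : ∀ x, x < 0 → HasDerivAt h₂ K₀.2 x)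
    (hpos₁ : ∀ x, 0 < x → HasDerivAt h₁ K₁.1 x) (hpos₂ : ∀ x, 0 < x → HasDerivAt h₂ K₁.2 x) :
    ∃ ε R : ℝ, 0 < ε ∧ ∀ P : ℝ × ℝ, P.1 + P.2 = 0 → 0 < P.2 → P.2 < ε →
      ∃ (u : ℝ → ℝ × ℝ) (p : ℝ → ℝ × ℝ) (x : ℝ → ℝ),
        (IsAdmissibleSolution h₁ h₂ u ∧ GivesNash h₁ h₂ u ∧ IsSwitchedTrajectory K₀ K₁ P p ∧
        Tendsto p atTop (𝓝 K₁) ∧ Tendsto p atBot (𝓝 K₀) ∧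
        x 0 = 0 ∧ Tendsto x atTop atTop ∧ Tendsto x atBot atBot ∧ Represents p x u) ∧
        Continuous (deriv u) ∧ (∀ z, ‖deriv u z‖ ≤ R) ∧ deriv u 0 = P := by
  have hK₀ : K₀ ≠ 0 := by rintro rfl; simp at h0
  have hK₁ : K₁ ≠ 0 := by rintro rfl; simp at h1
  obtain ⟨R₁, H₁⟩ := exists_forward_from_antidiagonal h1 hD1
  obtain ⟨R₀, H₀⟩ := exists_forward_from_antidiagonal (K := refl K₀)
    (by simpa using h0) (by simp only [refl_fst, refl_snd]; linarith)
  simp only [refl_fst, refl_snd] at H₀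
  refine ⟨min ((K₁.2 - K₁.1) / 4) ((-K₀.1 - -K₀.2) / 4), max R₀ R₁,
    lt_min (by linarith) (by linarith), fun P hP hP0 hPε => ?_⟩
  -- As `refl` fixes the antidiagonal, the reflected forward trajectory of `refl K₀` from `P` is a
  -- backward trajectory of `K₀` from the same `P`.
  have hrP : refl P = P := Prod.ext (by simp only [refl_fst]; linarith)
    (by simp only [refl_snd]; linarith)
  obtain ⟨g, hg0, hgtop, hg⟩ := H₁ P hP hP0 (hPε.le.trans (min_le_left _ _))
  obtain ⟨q, hq0, hqtop, hq⟩ := H₀ P hP hP0 (hPε.le.trans (min_le_right _ _))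
  set f : ℝ → ℝ × ℝ := fun s => refl (q (-s)) with hfdef
  have hf0 : f 0 = P := by simp [hfdef, hq0, hrP]
  have hf : ∀ s, s ≤ 0 → HasDerivAt f (field K₀ (f s)) s := fun s hs =>
    hasDerivAt_refl_comp_neg' (hq (-s) (by linarith)).1
  have hfbot : Tendsto f atBot (𝓝 K₀) := by
    have := tendsto_refl_comp_neg_atBot hqtop
    rwa [refl_refl] at this
  have hfg : f 0 = g 0 := hf0.trans hg0.symm
  have hsw : IsSwitchedTrajectory K₀ K₁ P (glue f g) :=
    isSwitchedTrajectory_glue hf0 hg0 hf fun s hs => (hg s hs).1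
  have hne : ∀ s, glue f g s ≠ 0 := fun s => by
    rcases le_total s 0 with hs | hs
    · rw [glue_of_le hs]
      exact fun h => (hq (-s) (by linarith)).2.1 (refl_eq_zero.1 h)
    · rw [glue_of_ge hfg hs]
      exact (hg s hs).2.1
  have hR : ∀ s, ‖glue f g s‖ ≤ max R₀ R₁ := fun s => by
    rcases le_total s 0 with hs | hs
    · rw [glue_of_le hs, hfdef, norm_refl]
      exact (hq (-s) (by linarith)).2.2.trans (le_max_left _ _)
    · rw [glue_of_ge hfg hs]
      exact (hg s hs).2.2.trans (le_max_right _ _)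
  obtain ⟨u, x, hadm, hnash, hx0, hxtop, hxbot, hrep, hdc, hdR⟩ :=
    exists_solution_of_switched hK₀ hK₁ hc₁ hc₂ hneg₁ hneg₂ hpos₁ hpos₂ hsw hne hR
      (tendsto_glue_atTop hgtop) (tendsto_glue_atBot hfbot)
  refine ⟨u, glue f g, x, ⟨hadm, hnash, hsw, tendsto_glue_atTop hgtop, tendsto_glue_atBot hfbot,
    hx0, hxtop, hxbot, hrep⟩, hdc, hdR, ?_⟩
  have := (hrep 0).2.deriv
  rwa [hx0, hsw.2.1] at this

end DiffGame

end

/-! ### Assembly of the four claims -/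

theorem mainTheorem3 (K₀ K₁ : ℝ × ℝ) (hK₀ : K₀ ∈ DiffGame.sector 4) (hK₁ : K₁ ∈ DiffGame.sector 3)
    (h₁ h₂ : ℝ → ℝ) (hc₁ : Continuous h₁) (hc₂ : Continuous h₂)
    (hneg₁ : ∀ x, x < 0 → HasDerivAt h₁ K₀.1 x) (hneg₂ : ∀ x, x < 0 → HasDerivAt h₂ K₀.2 x)
    (hpos₁ : ∀ x, 0 < x → HasDerivAt h₁ K₁.1 x) (hpos₂ : ∀ x, 0 < x → HasDerivAt h₂ K₁.2 x) :
    -- infinitely many admissible solutions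
    {u : ℝ → ℝ × ℝ | DiffGame.IsAdmissibleSolution h₁ h₂ u}.Infinite ∧
    -- infinitely many Nash equilibria with continuous feedbacks, for all large control sets
    (∃ R : ℝ, 0 < R ∧ ∀ A₁ A₂ : Set ℝ, IsCompact A₁ → IsCompact A₂ →
      Icc (-R) R ⊆ A₁ → Icc (-R) R ⊆ A₂ →
      {α : (ℝ → ℝ) × (ℝ → ℝ) | Continuous α.1 ∧ Continuous α.2 ∧
        DiffGame.IsFeedbackNash h₁ h₂ A₁ A₂ α.1 α.2}.Infinite) ∧
    -- one from every point of the half antidiagonal near the origin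
    (∃ ε : ℝ, 0 < ε ∧ ∀ P : ℝ × ℝ, P.1 + P.2 = 0 → P.1 < 0 → 0 < P.2 → ‖P‖ < ε →
      DiffGame.LiesBetween (DiffGame.unstableOrbit K₁) (DiffGame.stableOrbit K₀) P ∧
      ∃ (u : ℝ → ℝ × ℝ) (p : ℝ → ℝ × ℝ) (x : ℝ → ℝ),
        DiffGame.IsAdmissibleSolution h₁ h₂ u ∧ DiffGame.GivesNash h₁ h₂ u ∧
        DiffGame.IsSwitchedTrajectory K₀ K₁ P p ∧
        Tendsto p atTop (𝓝 K₁) ∧ Tendsto p atBot (𝓝 K₀) ∧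
        x 0 = 0 ∧ Tendsto x atTop atTop ∧ Tendsto x atBot atBot ∧
        DiffGame.Represents p x u) ∧
    -- one more from every intersection of the two other orbits
    (∀ P ∈ DiffGame.unstableOrbit K₀ ∩ DiffGame.stableOrbit K₁,
      ∃ (u : ℝ → ℝ × ℝ) (p : ℝ → ℝ × ℝ) (x : ℝ → ℝ) (xm xp : ℝ)
        (pm : ℝ → ℝ × ℝ) (ym : ℝ → ℝ) (pp : ℝ → ℝ × ℝ) (yp : ℝ → ℝ),
        DiffGame.IsAdmissibleSolution h₁ h₂ u ∧ DiffGame.GivesNash h₁ h₂ u ∧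
        xm < 0 ∧ 0 < xp ∧ HasDerivAt u 0 xm ∧ HasDerivAt u 0 xp ∧
        -- on the bounded interval between `xm` and `xp`
        DiffGame.IsSwitchedTrajectory K₀ K₁ P p ∧
        Tendsto p atTop (𝓝 0) ∧ Tendsto p atBot (𝓝 0) ∧
        x 0 = 0 ∧ Tendsto x atTop (𝓝 xp) ∧ Tendsto x atBot (𝓝 xm) ∧
        DiffGame.Represents p x u ∧
        -- to the left of `xm`, along a stable orbit of the system of `K₀`
        (∀ s, HasDerivAt pm (DiffGame.field K₀ (pm s)) s) ∧ (∀ s, pm s ≠ 0) ∧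
        Tendsto pm atTop (𝓝 0) ∧ Tendsto pm atBot (𝓝 K₀) ∧
        Tendsto ym atTop (𝓝 xm) ∧ Tendsto ym atBot atBot ∧
        DiffGame.Represents pm ym u ∧
        -- to the right of `xp`, along an unstable orbit of the system of `K₁`
        (∀ s, HasDerivAt pp (DiffGame.field K₁ (pp s)) s) ∧ (∀ s, pp s ≠ 0) ∧
        Tendsto pp atBot (𝓝 0) ∧ Tendsto pp atTop (𝓝 K₁) ∧
        Tendsto yp atBot (𝓝 xp) ∧ Tendsto yp atTop atTop ∧
        DiffGame.Represents pp yp u) := by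
  obtain ⟨-, a2, a3⟩ := DiffGame.mem_sector_four hK₀
  obtain ⟨b1, -, b3⟩ := DiffGame.mem_sector_three hK₁
  obtain ⟨ε₁, hε₁, hbetween⟩ := DiffGame.exists_liesBetween a2 a3 b1 b3
  obtain ⟨ε₂, R, hε₂, hsol⟩ := DiffGame.exists_solution_of_antidiagonal a2 a3 b1 b3 hc₁ hc₂
    hneg₁ hneg₂ hpos₁ hpos₂
  -- The prescribed value of `u'(0)` separates the members of the family, and the common bound `R`
  -- on `u'` lets one choice of control sets serve them all.
  have hfam : ∀ t : Ioo 0 ε₂, ∃ u : ℝ → ℝ × ℝ, DiffGame.IsAdmissibleSolution h₁ h₂ u ∧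
      DiffGame.GivesNash h₁ h₂ u ∧ Continuous (deriv u) ∧ (∀ z, ‖deriv u z‖ ≤ R) ∧
      deriv u 0 = (-(t : ℝ), (t : ℝ)) := fun t => by
    obtain ⟨u, p, x, h, h'⟩ := hsol (-(t : ℝ), (t : ℝ)) (by simp) t.2.1 t.2.2
    exact ⟨u, h.1, h.2.1, h'⟩
  choose U hadm hnash hcont hbound hzero using hfam
  have : Infinite (Ioo 0 ε₂) := (Ioo_infinite hε₂).to_subtype
  refine ⟨?_, ⟨max R 1, lt_max_of_lt_right one_pos, fun A₁ A₂ hA₁ hA₂ hs₁ hs₂ => ?_⟩,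
    ⟨min ε₁ ε₂, lt_min hε₁ hε₂, fun P hP hP1 hP2 hPε => ?_⟩, fun P hP => ?_⟩
  · refine infinite_of_injective_forall_mem (f := U) (fun s t hst => ?_) hadm
    have := hzero t
    rw [← hst, hzero s] at this
    exact Subtype.ext (Prod.ext_iff.1 this).2
  · refine infinite_of_injective_forall_mem
      (f := fun t => (fun x => -(deriv (U t) x).1, fun x => -(deriv (U t) x).2))
      (fun s t hst => ?_) fun t => ⟨?_, ?_, ?_⟩
    · have := congrFun (Prod.ext_iff.1 hst).2 0
      simp only [hzero, neg_inj] at this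
      exact Subtype.ext this
    · have := hcont t
      fun_prop
    · have := hcont t
      fun_prop
    · refine hnash t A₁ A₂ hA₁ hA₂ (fun x => hs₁ ?_) (fun x => hs₂ ?_)
      · have := abs_le.1 ((norm_fst_le (deriv (U t) x)).trans (hbound t x))
        have := le_max_left R 1
        exact ⟨by linarith, by linarith⟩
      · have := abs_le.1 ((norm_snd_le (deriv (U t) x)).trans (hbound t x))
        have := le_max_left R 1
        exact ⟨by linarith, by linarith⟩
  · have hlt : P.2 < min ε₁ ε₂ := ((le_abs_self _).trans (norm_snd_le P)).trans_lt hPε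
    refine ⟨hbetween P hP hP2 (hlt.trans_le (min_le_left _ _)), ?_⟩
    obtain ⟨u, p, x, h, -⟩ := hsol P hP hP2 (hlt.trans_le (min_le_right _ _))
    exact ⟨u, p, x, h⟩
  · exact DiffGame.exists_solution_of_intersection a2 a3 b1 b3 hc₁ hc₂ hneg₁ hneg₂ hpos₁ hpos₂ hP
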